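/- **Proposition 2.4.** All graphs are finite, simple and non-empty. For an integer $k\ge 0$, a $k$-$b$-coloring of a graph $G$ is a map $\chi\colon V(G)\to\{1,\dots,k\}$ with $\chi(u)\neq\chi(v)$ for every edge $uv$, such that for every color $c\in\{1,\dots,k\}$ there is a vertex $u$ with $\chi(u)=c$ and $\chi(N[u])=\{1,\dots,k\}$, where $N[u]$ is the closed neighbourhood of $u$. The problem $b$-Coloring receives a graph $G$ and an integer $k$ and asks whether $G$ has a $k$-$b$-coloring. The vertex integrity of $G$ is the smallest integer $p$ such that there is a set $S\subsetneq V(G)$ with $|S\cup V(H)|\le p$ for each connected component $H$ of $G-S$. The problem $b$-Coloring can be solved in time $2^{\mathcal O(p^2)}\cdot n$, where $n$ is the number of vertices of the input graph and $p$ is its vertex integrity. More precisely, there are a constant $C$ and a single word-RAM program that, for every graph $G$ on $n\ge 1$ vertices, given by adjacency lists in any order, and every integer $k\ge 0$ (but not given $p$), halts after at most $2^{C p^2}\cdot n$ steps with the correct answer, while using words of at most $C\,(p^2+\lfloor\log_2(n+k)\rfloor)$ bits. -/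

import Mathlib

/-! ## b-colorings -/

namespace BCol

/-- `u` is a b-vertex in `χ`: the closed neighbourhood of `u` sees every color, `χ(N[u]) = [k]`. -/
def IsBVertex {V : Type*} (G : SimpleGraph V) {k : ℕ} (χ : V → Fin k) (u : V) : Prop :=
  χ '' (insert u (G.neighborSet u)) = Set.univ

/-- `χ` is a `k`-b-coloring: it is proper and every color class contains a b-vertex. -/
def IsBColoring {V : Type*} (G : SimpleGraph V) {k : ℕ} (χ : V → Fin k) : Prop :=
  (∀ u v, G.Adj u v → χ u ≠ χ v) ∧ ∀ c : Fin k, ∃ u, IsBVertex G χ u ∧ χ u = c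

/-- The question asked by the b-coloring problem on the instance `(G, k)`. -/
def HasBColoring {V : Type*} (G : SimpleGraph V) (k : ℕ) : Prop :=
  ∃ χ : V → Fin k, IsBColoring G χ

/-- The vertex integrity of a (finite, non-empty) graph: the smallest `p` such that for some
proper subset `S` of the vertex set, `|S ∪ V(H)| ≤ p` for each connected component `H` of
`G - S`. -/
noncomputable def vertexIntegrity {V : Type*} (G : SimpleGraph V) : ℕ :=
  sInf {p : ℕ | ∃ S : Set V, S ≠ Set.univ ∧
    ∀ H : (G.induce Sᶜ).ConnectedComponent, (S ∪ Subtype.val '' H.supp).ncard ≤ p}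

/-! ## Input encoding: adjacency lists -/

/-- `adj` lists the neighbours of every vertex, without repetitions, in an arbitrary order. -/
def IsAdjList {n : ℕ} (G : SimpleGraph (Fin n)) (adj : Fin n → List (Fin n)) : Prop :=
  ∀ v, (adj v).Nodup ∧ ∀ u, u ∈ adj v ↔ G.Adj v u

/-- The instance as a list of numbers: `n`, `k`, and then, for each vertex
`v = 0, …, n - 1`, the degree of `v` followed by the neighbours of `v`. -/
def encode {n : ℕ} (adj : Fin n → List (Fin n)) (k : ℕ) : List ℕ :=
  n :: k ::
    (List.ofFn fun v : Fin n => (adj v).length :: (adj v).map fun u => (u : ℕ)).flatten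

end BCol

/-! ## A word RAM

A program has finitely many registers and one random-access memory; both hold natural numbers
below `2 ^ w`, where `w` is the word length. Control flow is structured (sequencing,
conditionals, loops). -/

namespace RAM

/-- The binary word operations. -/
inductive Op
  | add | sub | mul | div | mod | land | lor | xor | shl | shr | lt | eq

/-- The value of a word operation, before it is checked against the word length. -/
def Op.eval : Op → ℕ → ℕ → ℕ
  | .add, a, b => a + b
  | .sub, a, b => a - b
  | .mul, a, b => a * b
  | .div, a, b => a / b
  | .mod, a, b => a % b
  | .land, a, b => a &&& b
  | .lor, a, b => a ||| b
  | .xor, a, b => a ^^^ b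
  | .shl, a, b => a <<< b
  | .shr, a, b => a >>> b
  | .lt, a, b => if a < b then 1 else 0
  | .eq, a, b => if a = b then 1 else 0

/-- Programs. The numbers `x y z` are names of registers, fixed in the program text. -/
inductive Prog
  /-- do nothing -/
  | skip
  /-- `r[x] := c` -/
  | const (x c : ℕ)
  /-- `r[x] := o (r[y], r[z])` -/
  | op (o : Op) (x y z : ℕ)
  /-- `r[x] := mem[r[y]]` -/
  | load (x y : ℕ)
  /-- `mem[r[x]] := r[y]` -/
  | store (x y : ℕ)
  /-- `P; Q` -/
  | seq (P Q : Prog)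
  /-- if `r[x] ≠ 0` then `P` else `Q` -/
  | ite (x : ℕ) (P Q : Prog)
  /-- while `r[x] ≠ 0` do `P` -/
  | loop (x : ℕ) (P : Prog)

/-- The contents of the registers and of the memory. -/
structure Store where
  reg : ℕ → ℕ
  mem : ℕ → ℕ

/-- Overwrite a register. -/
def Store.setReg (s : Store) (x a : ℕ) : Store := ⟨Function.update s.reg x a, s.mem⟩

/-- Overwrite a memory cell. -/
def Store.setMem (s : Store) (i a : ℕ) : Store := ⟨s.reg, Function.update s.mem i a⟩

/-- The initial store: the input occupies the memory cells `0, 1, 2, …`; every other memory cell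
and every register holds `0`. -/
def Store.start (input : List ℕ) : Store := ⟨fun _ => 0, fun i => input.getD i 0⟩

/-- `Exec w P s t s'`: with word length `w`, the program `P`, started in the store `s`, halts after
exactly `t` steps in the store `s'`. Each elementary instruction and each evaluation of a test
costs one step. An instruction whose result is not below `2 ^ w` cannot be executed: a program
that reaches such an instruction does not halt in the sense of this relation. -/
inductive Exec (w : ℕ) : Prog → Store → ℕ → Store → Prop
  | skip (s : Store) : Exec w .skip s 1 s
  | const (s : Store) (x c : ℕ) (h : c < 2 ^ w) : Exec w (.const x c) s 1 (s.setReg x c)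
  | op (s : Store) (o : Op) (x y z : ℕ) (h : o.eval (s.reg y) (s.reg z) < 2 ^ w) :
      Exec w (.op o x y z) s 1 (s.setReg x (o.eval (s.reg y) (s.reg z)))
  | load (s : Store) (x y : ℕ) : Exec w (.load x y) s 1 (s.setReg x (s.mem (s.reg y)))
  | store (s : Store) (x y : ℕ) : Exec w (.store x y) s 1 (s.setMem (s.reg x) (s.reg y))
  | seq {P Q : Prog} {s s₁ s₂ : Store} {t₁ t₂ : ℕ} (h₁ : Exec w P s t₁ s₁)
      (h₂ : Exec w Q s₁ t₂ s₂) : Exec w (.seq P Q) s (t₁ + t₂) s₂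
  | iteTrue {x : ℕ} {P Q : Prog} {s s' : Store} {t : ℕ} (hx : s.reg x ≠ 0)
      (h : Exec w P s t s') : Exec w (.ite x P Q) s (t + 1) s'
  | iteFalse {x : ℕ} {P Q : Prog} {s s' : Store} {t : ℕ} (hx : s.reg x = 0)
      (h : Exec w Q s t s') : Exec w (.ite x P Q) s (t + 1) s'
  | loopDone {x : ℕ} {P : Prog} {s : Store} (hx : s.reg x = 0) : Exec w (.loop x P) s 1 s
  | loopStep {x : ℕ} {P : Prog} {s s₁ s₂ : Store} {t₁ t₂ : ℕ} (hx : s.reg x ≠ 0)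
      (h₁ : Exec w P s t₁ s₁) (h₂ : Exec w (.loop x P) s₁ t₂ s₂) :
      Exec w (.loop x P) s (t₁ + t₂ + 1) s₂

/-- Runs are deterministic: the halting time and the final store are determined by the program
and the initial store. -/
theorem Exec.deterministic {w : ℕ} {P : Prog} {s s₁ s₂ : Store} {t₁ t₂ : ℕ}
    (h₁ : Exec w P s t₁ s₁) (h₂ : Exec w P s t₂ s₂) : t₁ = t₂ ∧ s₁ = s₂ := by
  induction h₁ generalizing t₂ s₂ with
  | skip | const | op | load | store => cases h₂; exact ⟨rfl, rfl⟩
  | seq _ _ ih₁ ih₂ =>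
    cases h₂ with
    | seq a b =>
      obtain ⟨rfl, rfl⟩ := ih₁ a
      obtain ⟨rfl, rfl⟩ := ih₂ b
      exact ⟨rfl, rfl⟩
  | iteTrue hx _ ih =>
    cases h₂ with
    | iteTrue _ a => obtain ⟨rfl, rfl⟩ := ih a; exact ⟨rfl, rfl⟩
    | iteFalse hx' _ => exact absurd hx' hx
  | iteFalse hx _ ih =>
    cases h₂ with
    | iteTrue hx' _ => exact absurd hx hx'
    | iteFalse _ a => obtain ⟨rfl, rfl⟩ := ih a; exact ⟨rfl, rfl⟩
  | loopDone hx =>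
    cases h₂ with
    | loopDone => exact ⟨rfl, rfl⟩
    | loopStep hx' _ _ => exact absurd hx hx'
  | loopStep hx _ _ ih₁ ih₂ =>
    cases h₂ with
    | loopDone hx' => exact absurd hx' hx
    | loopStep _ a b =>
      obtain ⟨rfl, rfl⟩ := ih₁ a
      obtain ⟨rfl, rfl⟩ := ih₂ b
      exact ⟨rfl, rfl⟩

/-- With word length `w`, the program `P` answers the yes/no question `Q` on the given input
within `T` steps: the input words have at most `w` bits, and `P` halts after at most `T` steps,
having never computed a number of more than `w` bits, with `1` in register `0` if the answer is
yes and with `0` in register `0` if the answer is no. -/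
def Prog.Decides (P : Prog) (w : ℕ) (input : List ℕ) (T : ℕ) (Q : Prop) : Prop :=
  (∀ a ∈ input, a < 2 ^ w) ∧
    ∃ t ≤ T, ∃ s : Store, Exec w P (Store.start input) t s ∧
      (Q → s.reg 0 = 1) ∧ (¬ Q → s.reg 0 = 0)

end RAM

/-! The vertex integrity p is unknown to the program, so the bounds q = 1, 2, … are tried in turn.
For a fixed q a separator S is grown from the empty set. If some component of G - S has more than q
- |S| vertices, then its first q + 1 - |S| vertices in breadth-first order form a connected set, and
every T ⊇ S that witnesses integrity at most q must meet this set: otherwise T and the connected set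
would together exceed q. Guessing the vertex that belongs to T takes at most q + 1 ≤ 2^q choices,
and fewer than q guesses are needed because |T| < q. A sequence of guesses is coded by the digits of
a number below 2^(q²), and for q = p some code succeeds (`Grow.exists_attempt`, `Mach.search_tri`).
Success yields a set R with |R| ≤ q such that |R| + |C| ≤ q for every component C of G - R
(`Grow.layout_of_ovf`). One round is linear in the size of the graph, which is O(pn) because
vertices outside a witness T have degree below p (`Mach.wt_range_le`).

If k > q, there is no b-coloring: a b-vertex outside R has at most q vertices in its closed
neighbourhood, and if every color has its b-vertex in R, then k ≤ |R| ≤ q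
(`Mach.Groups.le_of_posColoring`).

If k ≤ q, all colorings of R are enumerated by codes below 2^(q²). The components (the groups)
interact only through R. A partial coloring is therefore summarised by a mask of q² + q bits: bit iq
+ c says that the vertex in position i of R sees color c, and bit q² + c says that color c has a
b-vertex already recognised without the first q² bits. The summary of a union is the bitwise or of
the summaries. A table over all masks holds those that are reachable after a number of groups; a new
group is treated by running through its at most 2^(q²) color codes and combining each contribution
with every reachable mask (`Mach.Groups.reach_zero`, `Mach.Groups.reach_succ`). A b-coloring exists
if and only if some final mask provides a b-vertex for each color (`Mach.Groups.accept_iff`). There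
are at most n groups, their vertices have degree at most q, and each group costs 2^(O(q²)) steps.

To obtain a word-RAM program, the algorithm is written in a small structured language whose
compilation preserves the step count exactly (`Mach.Run.comp`). Correctness and time are proved
together by triples `Mach.Tri`, where the time bound is a credit that the loops consume. Codes and
masks have O(p²) bits, and addresses and input numbers have O(p² + log(n + k)) bits, which gives the
word length. -/

set_option linter.constructorNameAsVariable false

/-! ## A small imperative language with named variables and arrays -/

namespace Mach

/-- Names of variables. -/
inductive Va
  | ans | n | k | q | M | code | s | c | act | ov | ovst | tail | g | v | head | x | j | u | d | o
  | full | W | sc | hc | ga | gb | a | bad | e | i | ci | m | pu | cu | b | fin | len | r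
  deriving DecidableEq

/-- Names of arrays. -/
inductive Ar
  | off | mark | ord | start | t1 | t2
  deriving DecidableEq

theorem Va.ctorIdx_injective : Function.Injective Va.ctorIdx := by
  intro a b h
  have key : ∀ a : Va, Va.ofNat a.ctorIdx = a := by intro a; cases a <;> rfl
  rw [← key a, h, key b]

theorem Ar.ctorIdx_injective : Function.Injective Ar.ctorIdx := by
  intro a b h
  have key : ∀ a : Ar, Ar.ofNat a.ctorIdx = a := by intro a; cases a <;> rfl
  rw [← key a, h, key b]

/-- The arrays are interleaved in memory with stride 8. An array index below 8 is the residue of the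
address relative to the base, so cells of different arrays never coincide. -/
theorem Ar.ctorIdx_lt (a : Ar) : a.ctorIdx < 8 := by cases a <;> decide

/-- The input words, the length of the input, and the number of bits of a value. -/
structure Env where
  inp : ℕ → ℕ
  L : ℕ
  lg : ℕ

/-- The bound for the values. -/
def Env.N (E : Env) : ℕ := 2 ^ E.lg

/-- The contents of the variables and the arrays. -/
structure St where
  reg : Va → ℕ
  arr : Ar → ℕ → ℕ

/-- Overwrite a variable. -/
def St.setReg (σ : St) (x : Va) (a : ℕ) : St := ⟨Function.update σ.reg x a, σ.arr⟩

/-- Overwrite an array cell. -/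
def St.setArr (σ : St) (a : Ar) (i b : ℕ) : St :=
  ⟨σ.reg, Function.update σ.arr a (Function.update (σ.arr a) i b)⟩

@[simp] theorem St.setReg_reg (σ : St) (x y : Va) (a : ℕ) :
    (σ.setReg x a).reg y = if y = x then a else σ.reg y := by
  simp [St.setReg, Function.update_apply]

@[simp] theorem St.setReg_arr (σ : St) (x : Va) (a : ℕ) : (σ.setReg x a).arr = σ.arr := rfl

@[simp] theorem St.setArr_reg (σ : St) (a : Ar) (i b : ℕ) : (σ.setArr a i b).reg = σ.reg := rfl

@[simp] theorem St.setArr_arr (σ : St) (a a' : Ar) (i b : ℕ) :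
    (σ.setArr a i b).arr a' = if a' = a then Function.update (σ.arr a) i b else σ.arr a' := by
  simp only [St.setArr, Function.update_apply]

/-- Expressions. -/
inductive Ex
  | var (x : Va)
  | lit (c : ℕ)
  | bin (o : RAM.Op) (a b : Ex)
  | get (a : Ar) (i : Ex)
  | inp (i : Ex)

instance : Coe Va Ex := ⟨.var⟩
instance : Add Ex := ⟨.bin .add⟩
instance : Sub Ex := ⟨.bin .sub⟩
instance : Mul Ex := ⟨.bin .mul⟩
instance : Mod Ex := ⟨.bin .mod⟩
instance : Div Ex := ⟨.bin .div⟩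
instance : HOr Ex Ex Ex := ⟨.bin .lor⟩
instance : HAnd Ex Ex Ex := ⟨.bin .land⟩
instance : HShiftLeft Ex Ex Ex := ⟨.bin .shl⟩
instance : HShiftRight Ex Ex Ex := ⟨.bin .shr⟩
instance (c : ℕ) : OfNat Ex c := ⟨.lit c⟩

/-- Comparison of two expressions. -/
def Ex.less (a b : Ex) : Ex := .bin .lt a b
/-- Equality of two expressions. -/
def Ex.same (a b : Ex) : Ex := .bin .eq a b

/-- The value of an expression. -/
def Ex.eval (E : Env) (σ : St) : Ex → ℕ
  | .var x => σ.reg x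
  | .lit c => c
  | .bin o a b => o.eval (a.eval E σ) (b.eval E σ)
  | .get a i => σ.arr a (i.eval E σ)
  | .inp i => E.inp (i.eval E σ)

/-- The operation does not overflow. -/
def opSafe (E : Env) (o : RAM.Op) (x y : ℕ) : Prop :=
  match o with
  | .add => x + y < E.N
  | .mul => x * y < E.N
  | .shl => x <<< y < E.N
  | _ => True

/-- The evaluation of the expression does not overflow. -/
def Ex.safe (E : Env) (σ : St) : Ex → Prop
  | .var _ => True
  | .lit c => c < E.N
  | .bin o a b => a.safe E σ ∧ b.safe E σ ∧ opSafe E o (a.eval E σ) (b.eval E σ)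
  | .get _ i => i.safe E σ
  | .inp i => i.safe E σ ∧ i.eval E σ < E.L

/-- The time needed to evaluate an expression. -/
def Ex.cost : Ex → ℕ
  | .var _ => 1
  | .lit _ => 1
  | .bin _ a b => a.cost + b.cost + 1
  | .get _ i => i.cost + 6
  | .inp i => i.cost + 1

section simps
variable (E : Env) (σ : St) (x : Va) (c : ℕ) (a b i : Ex) (t : Ar)
@[simp] theorem Ex.eval_var : (Ex.var x).eval E σ = σ.reg x := rfl
@[simp] theorem Ex.eval_lit : (Ex.lit c).eval E σ = c := rfl
@[simp] theorem Ex.eval_zero : (0 : Ex).eval E σ = 0 := rfl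
@[simp] theorem Ex.eval_one : (1 : Ex).eval E σ = 1 := rfl
@[simp] theorem Ex.eval_add : (a + b).eval E σ = a.eval E σ + b.eval E σ := rfl
@[simp] theorem Ex.eval_sub : (a - b).eval E σ = a.eval E σ - b.eval E σ := rfl
@[simp] theorem Ex.eval_mul : (a * b).eval E σ = a.eval E σ * b.eval E σ := rfl
@[simp] theorem Ex.eval_mod : (a % b).eval E σ = a.eval E σ % b.eval E σ := rfl
@[simp] theorem Ex.eval_div : (a / b).eval E σ = a.eval E σ / b.eval E σ := rfl
@[simp] theorem Ex.eval_or : (a ||| b).eval E σ = a.eval E σ ||| b.eval E σ := rfl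
@[simp] theorem Ex.eval_and : (a &&& b).eval E σ = a.eval E σ &&& b.eval E σ := rfl
@[simp] theorem Ex.eval_shl : (a <<< b).eval E σ = a.eval E σ <<< b.eval E σ := rfl
@[simp] theorem Ex.eval_shr : (a >>> b).eval E σ = a.eval E σ >>> b.eval E σ := rfl
@[simp] theorem Ex.eval_less :
    (a.less b).eval E σ = if a.eval E σ < b.eval E σ then 1 else 0 := rfl
@[simp] theorem Ex.eval_same :
    (a.same b).eval E σ = if a.eval E σ = b.eval E σ then 1 else 0 := rfl
@[simp] theorem Ex.eval_get : (Ex.get t i).eval E σ = σ.arr t (i.eval E σ) := rfl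
@[simp] theorem Ex.eval_inp : (Ex.inp i).eval E σ = E.inp (i.eval E σ) := rfl
@[simp] theorem Ex.safe_var : (Ex.var x).safe E σ ↔ True := Iff.rfl
@[simp] theorem Ex.safe_lit : (Ex.lit c).safe E σ ↔ c < E.N := Iff.rfl
@[simp] theorem Ex.safe_zero : (0 : Ex).safe E σ ↔ 0 < E.N := Iff.rfl
@[simp] theorem Ex.safe_one : (1 : Ex).safe E σ ↔ 1 < E.N := Iff.rfl
@[simp] theorem Ex.safe_add : (a + b).safe E σ ↔
    a.safe E σ ∧ b.safe E σ ∧ a.eval E σ + b.eval E σ < E.N := Iff.rfl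
@[simp] theorem Ex.safe_mul : (a * b).safe E σ ↔
    a.safe E σ ∧ b.safe E σ ∧ a.eval E σ * b.eval E σ < E.N := Iff.rfl
@[simp] theorem Ex.safe_shl : (a <<< b).safe E σ ↔
    a.safe E σ ∧ b.safe E σ ∧ a.eval E σ <<< b.eval E σ < E.N := Iff.rfl
@[simp] theorem Ex.safe_sub : (a - b).safe E σ ↔ a.safe E σ ∧ b.safe E σ :=
  ⟨fun h => ⟨h.1, h.2.1⟩, fun h => ⟨h.1, h.2, trivial⟩⟩
@[simp] theorem Ex.safe_mod : (a % b).safe E σ ↔ a.safe E σ ∧ b.safe E σ :=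
  ⟨fun h => ⟨h.1, h.2.1⟩, fun h => ⟨h.1, h.2, trivial⟩⟩
@[simp] theorem Ex.safe_div : (a / b).safe E σ ↔ a.safe E σ ∧ b.safe E σ :=
  ⟨fun h => ⟨h.1, h.2.1⟩, fun h => ⟨h.1, h.2, trivial⟩⟩
@[simp] theorem Ex.safe_or : (a ||| b).safe E σ ↔ a.safe E σ ∧ b.safe E σ :=
  ⟨fun h => ⟨h.1, h.2.1⟩, fun h => ⟨h.1, h.2, trivial⟩⟩
@[simp] theorem Ex.safe_and : (a &&& b).safe E σ ↔ a.safe E σ ∧ b.safe E σ :=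
  ⟨fun h => ⟨h.1, h.2.1⟩, fun h => ⟨h.1, h.2, trivial⟩⟩
@[simp] theorem Ex.safe_shr : (a >>> b).safe E σ ↔ a.safe E σ ∧ b.safe E σ :=
  ⟨fun h => ⟨h.1, h.2.1⟩, fun h => ⟨h.1, h.2, trivial⟩⟩
@[simp] theorem Ex.safe_less : (a.less b).safe E σ ↔ a.safe E σ ∧ b.safe E σ :=
  ⟨fun h => ⟨h.1, h.2.1⟩, fun h => ⟨h.1, h.2, trivial⟩⟩
@[simp] theorem Ex.safe_same : (a.same b).safe E σ ↔ a.safe E σ ∧ b.safe E σ :=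
  ⟨fun h => ⟨h.1, h.2.1⟩, fun h => ⟨h.1, h.2, trivial⟩⟩
@[simp] theorem Ex.safe_get : (Ex.get t i).safe E σ ↔ i.safe E σ := Iff.rfl
@[simp] theorem Ex.safe_inp : (Ex.inp i).safe E σ ↔ i.safe E σ ∧ i.eval E σ < E.L := Iff.rfl
end simps

/-- Statements. -/
inductive Stm
  | skip
  | set (x : Va) (e : Ex)
  | put (a : Ar) (i e : Ex)
  | seq (P Q : Stm)
  | ite (e : Ex) (P Q : Stm)
  | whl (e : Ex) (P : Stm)

infixr:60 " ;; " => Stm.seq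
infix:62 " ≔ " => Stm.set

/-- `Run E P σ t σ'`: the statement `P` leads from `σ` to `σ'` in `t` steps. -/
inductive Run (E : Env) : Stm → St → ℕ → St → Prop
  | skip (σ) : Run E .skip σ 1 σ
  | set (σ x e) (h : e.safe E σ) : Run E (.set x e) σ (e.cost + 1) (σ.setReg x (e.eval E σ))
  | put (σ a i e) (hi : i.safe E σ) (he : e.safe E σ) :
      Run E (.put a i e) σ (i.cost + e.cost + 6) (σ.setArr a (i.eval E σ) (e.eval E σ))
  | seq {P Q σ σ₁ σ₂ t₁ t₂} (h₁ : Run E P σ t₁ σ₁) (h₂ : Run E Q σ₁ t₂ σ₂) :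
      Run E (.seq P Q) σ (t₁ + t₂) σ₂
  | iteTrue {e P Q σ σ' t} (hs : e.safe E σ) (he : e.eval E σ ≠ 0) (h : Run E P σ t σ') :
      Run E (.ite e P Q) σ (e.cost + (t + 1)) σ'
  | iteFalse {e P Q σ σ' t} (hs : e.safe E σ) (he : e.eval E σ = 0) (h : Run E Q σ t σ') :
      Run E (.ite e P Q) σ (e.cost + (t + 1)) σ'
  | whlDone {e P σ} (hs : e.safe E σ) (he : e.eval E σ = 0) : Run E (.whl e P) σ (e.cost + 1) σ
  | whlStep {e P σ σ₁ σ₂ t₁ t₂} (hs : e.safe E σ) (he : e.eval E σ ≠ 0) (h₁ : Run E P σ t₁ σ₁)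
      (h₂ : Run E (.whl e P) σ₁ t₂ σ₂) : Run E (.whl e P) σ (e.cost + (t₁ + t₂ + 1)) σ₂

/-! ### Compilation -/

/-- The register of a variable. -/
def Va.rg (x : Va) : ℕ := 2 * x.ctorIdx
/-- The register of the temporary at depth `d`. -/
def tmp (d : ℕ) : ℕ := 2 * d + 3

/-- Replaces an index in temporary `d` by the address of the cell. -/
def addrCode (a : Ar) (d : ℕ) : RAM.Prog :=
  .seq (.const (tmp (d + 1)) 8) (.seq (.op .mul (tmp d) (tmp d) (tmp (d + 1)))
    (.seq (.op .add (tmp d) (tmp d) 1) (.seq (.const (tmp (d + 1)) a.ctorIdx)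
      (.op .add (tmp d) (tmp d) (tmp (d + 1))))))

/-- Compiles an expression; the value is left in temporary `d`. -/
def Ex.comp : Ex → ℕ → RAM.Prog
  | .var x, d => .op .lor (tmp d) x.rg x.rg
  | .lit c, d => .const (tmp d) c
  | .bin o a b, d =>
      .seq (.seq (a.comp d) (b.comp (d + 1))) (.op o (tmp d) (tmp d) (tmp (d + 1)))
  | .get a i, d => .seq (i.comp d) (.seq (addrCode a d) (.load (tmp d) (tmp d)))
  | .inp i, d => .seq (i.comp d) (.load (tmp d) (tmp d))

/-- Compiles a statement. -/
def Stm.comp : Stm → RAM.Prog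
  | .skip => .skip
  | .set x e => .seq (e.comp 0) (.op .lor x.rg (tmp 0) (tmp 0))
  | .put a i e => .seq (i.comp 0) (.seq (addrCode a 0) (.seq (e.comp 1) (.store (tmp 0) (tmp 1))))
  | .seq P Q => .seq P.comp Q.comp
  | .ite e P Q => .seq (e.comp 0) (.ite (tmp 0) P.comp Q.comp)
  | .whl e P => .seq (e.comp 0) (.loop (tmp 0) (.seq P.comp (e.comp 0)))

/-- All values are below the bound. -/
def Bdd (E : Env) (σ : St) : Prop :=
  (∀ x, σ.reg x < E.N) ∧ (∀ a i, σ.arr a i < E.N) ∧ (∀ i, E.inp i < E.N) ∧ 0 < E.lg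

/-- The store `s` represents the state `σ`, with arrays placed from address `B` on. -/
structure Rep (E : Env) (B : ℕ) (σ : St) (s : RAM.Store) : Prop where
  reg : ∀ x : Va, s.reg x.rg = σ.reg x
  base : s.reg 1 = B
  inp : ∀ i < E.L, s.mem i = E.inp i
  arr : ∀ (a : Ar) i, s.mem (B + 8 * i + a.ctorIdx) = σ.arr a i

/-- The word length leaves room for the arrays. -/
structure Room (E : Env) (B w : ℕ) : Prop where
  hL : E.L ≤ B
  hw : B + 8 * E.N + 8 ≤ 2 ^ w

theorem Room.lt {E : Env} {B w x : ℕ} (h : Room E B w) (hx : x < E.N) : x < 2 ^ w := by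
  have := h.hw; omega

theorem rg_ne_tmp (x : Va) (d : ℕ) : x.rg ≠ tmp d := by unfold Va.rg tmp; omega
theorem rg_ne_one (x : Va) : x.rg ≠ 1 := by unfold Va.rg; omega
theorem one_ne_tmp (d : ℕ) : 1 ≠ tmp d := by unfold tmp; omega
theorem tmp_ne {d d' : ℕ} (h : d ≠ d') : tmp d ≠ tmp d' := by unfold tmp; omega
theorem rg_inj {x y : Va} (h : x.rg = y.rg) : x = y :=
  Va.ctorIdx_injective (by unfold Va.rg at h; omega)

theorem Rep.setTmp {E : Env} {B : ℕ} {σ : St} {s : RAM.Store} (h : Rep E B σ s) (d a : ℕ) :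
    Rep E B σ (s.setReg (tmp d) a) where
  reg x := by simp [RAM.Store.setReg, rg_ne_tmp, h.reg]
  base := by simp [RAM.Store.setReg, one_ne_tmp, h.base]
  inp := h.inp
  arr := h.arr

/-- Only addition, multiplication and left shift can leave the range. The bitwise operations stay
inside because the bound is a power of two, and the comparisons because `0 < E.lg` makes 1 an
admissible value. -/
theorem opSafe.lt {E : Env} {o : RAM.Op} {x y : ℕ} (h : opSafe E o x y) (h0 : 0 < E.lg) (hx : x < E.N)
    (hy : y < E.N) : o.eval x y < E.N := by
  cases o <;> simp only [RAM.Op.eval]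
  case add => exact h
  case mul => exact h
  case shl => exact h
  case sub => omega
  case div => exact (Nat.div_le_self _ _).trans_lt hx
  case mod => exact (Nat.mod_le _ _).trans_lt hx
  case land => exact Nat.and_lt_two_pow _ hy
  case lor => exact Nat.or_lt_two_pow hx hy
  case xor => exact Nat.xor_lt_two_pow hx hy
  case shr => exact (Nat.shiftRight_le _ _).trans_lt hx
  all_goals split_ifs <;> first | exact Nat.one_lt_two_pow h0.ne' | exact Nat.two_pow_pos _

theorem Ex.eval_lt {E : Env} {σ : St} (hb : Bdd E σ) : ∀ {e : Ex}, e.safe E σ →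
    e.eval E σ < E.N
  | .var x, _ => hb.1 x
  | .lit _, h => h
  | .bin _ _ _, h => h.2.2.lt hb.2.2.2 (eval_lt hb h.1) (eval_lt hb h.2.1)
  | .get _ _, _ => hb.2.1 _ _
  | .inp _, _ => hb.2.2.1 _

theorem addrCode_exec {E : Env} {B w : ℕ} (hr : Room E B w) {σ : St} {s : RAM.Store}
    (h : Rep E B σ s) (a : Ar) (d i : ℕ) (hi : i < E.N) (hs : s.reg (tmp d) = i) :
    ∃ s', RAM.Exec w (addrCode a d) s 5 s' ∧ s'.reg (tmp d) = B + 8 * i + a.ctorIdx ∧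
      Rep E B σ s' ∧ ∀ d' < d, s'.reg (tmp d') = s.reg (tmp d') := by
  have hw := hr.hw
  have ha := a.ctorIdx_lt
  have hd := tmp_ne (Nat.succ_ne_self d)
  have hd1 := hd.symm
  have h1 := one_ne_tmp d
  have h1' := one_ne_tmp (d + 1)
  have hb := h.base
  refine ⟨_, .seq (.const _ _ _ (by omega)) (.seq (.op _ _ _ _ _ ?_) (.seq (.op _ _ _ _ _ ?_)
    (.seq (.const _ _ _ (by omega)) (.op _ _ _ _ _ ?_)))), ?_, ?_, ?_⟩
  · simp [RAM.Store.setReg, RAM.Op.eval, hd1, hs]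
    omega
  · simp [RAM.Store.setReg, RAM.Op.eval, hd1, h1, h1', hs, hb]
    omega
  · simp [RAM.Store.setReg, RAM.Op.eval, hd1, h1, h1', hs, hb]
    omega
  · simp [RAM.Store.setReg, RAM.Op.eval, hd1, h1, h1', hs, hb]
    omega
  · exact ((((h.setTmp _ _).setTmp _ _).setTmp _ _).setTmp _ _).setTmp _ _
  · intro d' hd'
    have e1 := tmp_ne hd'.ne
    have e2 := tmp_ne (show d' ≠ d + 1 by omega)
    simp [RAM.Store.setReg, Function.update_apply, e1, e2]

/-- The last clause drives the induction: evaluation at depth `d` leaves the shallower temporaries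
alone, so a left operand survives the evaluation of the right one at depth `d + 1`. -/
theorem Ex.comp_exec {E : Env} {B w : ℕ} (hr : Room E B w) {σ : St} (hb : Bdd E σ) :
    ∀ (e : Ex) (d : ℕ) {s : RAM.Store}, Rep E B σ s → e.safe E σ →
    ∃ s', RAM.Exec w (e.comp d) s e.cost s' ∧ s'.reg (tmp d) = e.eval E σ ∧ Rep E B σ s' ∧
      ∀ d' < d, s'.reg (tmp d') = s.reg (tmp d') := by
  have upd : ∀ {s : RAM.Store} {d d' a : ℕ}, d' < d →
      (s.setReg (tmp d) a).reg (tmp d') = s.reg (tmp d') := by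
    intro s d d' a h
    simp [RAM.Store.setReg, tmp_ne h.ne]
  have self : ∀ {s : RAM.Store} {x a : ℕ}, (s.setReg x a).reg x = a := by
    intro s x a; simp [RAM.Store.setReg]
  intro e
  induction e with
  | var x =>
    intro d s h hs
    refine ⟨_, .op _ _ _ _ _ ?_, ?_, h.setTmp _ _, fun d' hd => upd hd⟩
    · simpa [RAM.Op.eval, h.reg] using hr.lt (hb.1 x)
    · simp [RAM.Op.eval, h.reg, self]
  | lit c =>
    intro d s h hs
    exact ⟨_, .const _ _ _ (hr.lt hs), self, h.setTmp _ _, fun d' hd => upd hd⟩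
  | bin o a b iha ihb =>
    intro d s h hs
    obtain ⟨s1, x1, v1, r1, f1⟩ := iha d h hs.1
    obtain ⟨s2, x2, v2, r2, f2⟩ := ihb (d + 1) r1 hs.2.1
    have v2' : s2.reg (tmp d) = a.eval E σ := by rw [f2 d (by omega), v1]
    refine ⟨_, .seq (.seq x1 x2) (.op _ _ _ _ _ ?_), ?_, r2.setTmp _ _, fun d' hd => ?_⟩
    · rw [v2, v2']
      exact hr.lt (Ex.eval_lt (e := .bin o a b) hb hs)
    · rw [self, v2, v2']; rfl
    · rw [upd hd, f2 _ (by omega), f1 _ hd]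
  | get a i ih =>
    intro d s h hs
    obtain ⟨s1, x1, v1, r1, f1⟩ := ih d h hs
    obtain ⟨s2, x2, v2, r2, f2⟩ := addrCode_exec hr r1 a d _ (Ex.eval_lt (e := i) hb hs) v1
    refine ⟨_, .seq x1 (.seq x2 (.load _ _ _)), ?_, r2.setTmp _ _, fun d' hd => ?_⟩
    · rw [self, v2, r2.arr]; rfl
    · rw [upd hd, f2 _ (by omega), f1 _ hd]
  | inp i ih =>
    intro d s h hs
    obtain ⟨s1, x1, v1, r1, f1⟩ := ih d h hs.1
    refine ⟨_, .seq x1 (.load _ _ _), ?_, r1.setTmp _ _, fun d' hd => ?_⟩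
    · rw [self, v1, r1.inp _ hs.2]; rfl
    · rw [upd hd, f1 _ hd]

theorem Run.bdd {E : Env} {P : Stm} {σ σ' : St} {t : ℕ} (h : Run E P σ t σ') :
    Bdd E σ → Bdd E σ' := by
  induction h with
  | skip => exact id
  | set σ x e h =>
    intro hb
    refine ⟨fun y => ?_, hb.2.1, hb.2.2⟩
    rw [St.setReg_reg]
    split_ifs
    exacts [Ex.eval_lt hb h, hb.1 y]
  | put σ a i e hi he =>
    intro hb
    refine ⟨hb.1, fun b j => ?_, hb.2.2⟩
    rw [St.setArr_arr]
    split_ifs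
    · rw [Function.update_apply]
      split_ifs
      exacts [Ex.eval_lt hb he, hb.2.1 _ _]
    · exact hb.2.1 _ _
  | seq _ _ ih₁ ih₂ => exact ih₂ ∘ ih₁
  | iteTrue _ _ _ ih => exact ih
  | iteFalse _ _ _ ih => exact ih
  | whlDone => exact id
  | whlStep _ _ _ _ ih₁ ih₂ => exact ih₂ ∘ ih₁

/-- The compiled program simulates the statement. -/
theorem Run.comp {E : Env} {B w : ℕ} (hr : Room E B w) {P : Stm} {σ σ' : St} {t : ℕ}
    (h : Run E P σ t σ') : Bdd E σ → ∀ {s : RAM.Store}, Rep E B σ s →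
    ∃ s', RAM.Exec w P.comp s t s' ∧ Rep E B σ' s' := by
  induction h with
  | skip => exact fun _ s h => ⟨s, .skip s, h⟩
  | set σ x e hs =>
    intro hb s h
    obtain ⟨s1, x1, v1, r1, -⟩ := e.comp_exec hr hb 0 h hs
    refine ⟨_, .seq x1 (.op _ _ _ _ _ ?_), ?_⟩
    · simpa [RAM.Op.eval, v1] using hr.lt (Ex.eval_lt hb hs)
    · refine ⟨fun y => ?_, ?_, r1.inp, r1.arr⟩
      · rw [St.setReg_reg]
        by_cases hy : y = x
        · subst hy; simp [RAM.Store.setReg, RAM.Op.eval, v1]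
        · simp [RAM.Store.setReg, Function.update_apply, hy, r1.reg]
          exact fun h => absurd (rg_inj h) hy
      · simp [RAM.Store.setReg, (rg_ne_one x).symm, r1.base]
  | put σ a i e hi he =>
    intro hb s h
    obtain ⟨s1, x1, v1, r1, -⟩ := i.comp_exec hr hb 0 h hi
    obtain ⟨s2, x2, v2, r2, -⟩ := addrCode_exec hr r1 a 0 _ (Ex.eval_lt hb hi) v1
    obtain ⟨s3, x3, v3, r3, f3⟩ := e.comp_exec hr hb 1 r2 he
    have v3' := f3 0 (by omega)
    rw [v2] at v3'
    have ex := RAM.Exec.seq x1 (.seq x2 (.seq x3 (.store s3 (tmp 0) (tmp 1))))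
    rw [show i.cost + (5 + (e.cost + 1)) = i.cost + e.cost + 6 by ring] at ex
    refine ⟨_, ex, r3.reg, r3.base, fun j hj => ?_, fun b j => ?_⟩
    -- Arrays begin at `B ≥ E.L`, so a write to an array cannot damage the input.
    · have := hr.hL
      rw [RAM.Store.setMem, v3']
      simp only [Function.update_apply]
      rw [if_neg (by omega), r3.inp j hj]
    · have ha := a.ctorIdx_lt
      have hb' := b.ctorIdx_lt
      rw [RAM.Store.setMem, v3', v3]
      simp only [Function.update_apply, St.setArr_arr]
      by_cases hba : b = a
      · subst hba
        by_cases hj : j = i.eval E σ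
        · subst hj; simp
        · rw [if_neg (by omega)]; simp [hj, r3.arr]
      · have : b.ctorIdx ≠ a.ctorIdx := fun h => hba (Ar.ctorIdx_injective h)
        rw [if_neg (by omega), if_neg hba, r3.arr]
  | seq h₁ _ ih₁ ih₂ =>
    intro hb s h
    obtain ⟨s1, x1, r1⟩ := ih₁ hb h
    obtain ⟨s2, x2, r2⟩ := ih₂ (h₁.bdd hb) r1
    exact ⟨s2, .seq x1 x2, r2⟩
  | iteTrue hs he _ ih =>
    intro hb s h
    obtain ⟨s1, x1, v1, r1, -⟩ := Ex.comp_exec hr hb _ 0 h hs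
    obtain ⟨s2, x2, r2⟩ := ih hb r1
    exact ⟨s2, .seq x1 (.iteTrue (v1.trans_ne he) x2), r2⟩
  | iteFalse hs he _ ih =>
    intro hb s h
    obtain ⟨s1, x1, v1, r1, -⟩ := Ex.comp_exec hr hb _ 0 h hs
    obtain ⟨s2, x2, r2⟩ := ih hb r1
    exact ⟨s2, .seq x1 (.iteFalse (v1.trans he) x2), r2⟩
  | whlDone hs he =>
    intro hb s h
    obtain ⟨s1, x1, v1, r1, -⟩ := Ex.comp_exec hr hb _ 0 h hs
    exact ⟨s1, .seq x1 (.loopDone (v1.trans he)), r1⟩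
  | whlStep hs he h₁ _ ih₁ ih₂ =>
    intro hb s h
    obtain ⟨s1, x1, v1, r1, -⟩ := Ex.comp_exec hr hb _ 0 h hs
    obtain ⟨s2, x2, r2⟩ := ih₁ hb r1
    obtain ⟨s3, x3, r3⟩ := ih₂ (h₁.bdd hb) r2
    -- The run of the remaining loop starts with an evaluation of the guard. In the compiled code
    -- this evaluation belongs to the end of the loop body, so the two halves are regrouped; the
    -- number of steps is unchanged.
    cases x3 with
    | seq y z =>
      refine ⟨s3, ?_, r3⟩
      have := RAM.Exec.seq x1 (.loopStep (v1.trans_ne he) (.seq x2 y) z)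
      rwa [show ∀ a b c d : ℕ, a + (b + c + d + 1) = a + (b + (c + d) + 1) by intros; ring] at this

/-! ### Frames -/

/-- The statement contains an assignment to `x`. -/
def Stm.wr : Stm → Va → Bool
  | .skip, _ => false
  | .set y _, x => y == x
  | .put _ _ _, _ => false
  | .seq P Q, x => P.wr x || Q.wr x
  | .ite _ P Q, x => P.wr x || Q.wr x
  | .whl _ P, x => P.wr x

/-- The statement contains an assignment to the array `a`. -/
def Stm.wa : Stm → Ar → Bool
  | .skip, _ => false
  | .set _ _, _ => false
  | .put b _ _, a => b == a
  | .seq P Q, a => P.wa a || Q.wa a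
  | .ite _ P Q, a => P.wa a || Q.wa a
  | .whl _ P, a => P.wa a

/-- `σ'` differs from `σ` only where `P` may write. -/
def Fr (P : Stm) (σ σ' : St) : Prop :=
  (∀ x, P.wr x = false → σ'.reg x = σ.reg x) ∧ ∀ a, P.wa a = false → σ'.arr a = σ.arr a

/-- The write sets are Boolean functions of the program text, so the preservation of a given
variable or array is later settled by `rfl` or `decide`, and postconditions need not list what stays
the same. -/
theorem Run.frame {E : Env} {P : Stm} {σ σ' : St} {t : ℕ} (h : Run E P σ t σ') : Fr P σ σ' := by
  induction h with
  | skip => exact ⟨fun _ _ => rfl, fun _ _ => rfl⟩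
  | set σ x e h =>
    refine ⟨fun y hy => ?_, fun _ _ => rfl⟩
    have : y ≠ x := by rintro rfl; simp [Stm.wr] at hy
    simp [this]
  | put σ a i e hi he =>
    refine ⟨fun _ _ => rfl, fun b hb => ?_⟩
    have : b ≠ a := by rintro rfl; simp [Stm.wa] at hb
    simp [this]
  | seq _ _ ih₁ ih₂ =>
    refine ⟨fun x hx => ?_, fun a ha => ?_⟩
    · simp only [Stm.wr, Bool.or_eq_false_iff] at hx
      rw [ih₂.1 x hx.2, ih₁.1 x hx.1]
    · simp only [Stm.wa, Bool.or_eq_false_iff] at ha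
      rw [ih₂.2 a ha.2, ih₁.2 a ha.1]
  | iteTrue _ _ _ ih =>
    refine ⟨fun x hx => ?_, fun a ha => ?_⟩
    · simp only [Stm.wr, Bool.or_eq_false_iff] at hx; exact ih.1 x hx.1
    · simp only [Stm.wa, Bool.or_eq_false_iff] at ha; exact ih.2 a ha.1
  | iteFalse _ _ _ ih =>
    refine ⟨fun x hx => ?_, fun a ha => ?_⟩
    · simp only [Stm.wr, Bool.or_eq_false_iff] at hx; exact ih.1 x hx.2
    · simp only [Stm.wa, Bool.or_eq_false_iff] at ha; exact ih.2 a ha.2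
  | whlDone => exact ⟨fun _ _ => rfl, fun _ _ => rfl⟩
  | whlStep _ _ _ _ ih₁ ih₂ =>
    exact ⟨fun x hx => (ih₂.1 x hx).trans (ih₁.1 x hx),
      fun a ha => (ih₂.2 a ha).trans (ih₁.2 a ha)⟩

/-! ### Total correctness with time bounds -/

/-- From `σ`, the statement `P` reaches a state satisfying `Q` within `T` steps. -/
def Tri (E : Env) (P : Stm) (σ : St) (T : ℕ) (Q : St → Prop) : Prop :=
  ∃ t σ', Run E P σ t σ' ∧ t ≤ T ∧ Q σ'

variable {E : Env} {P P' : Stm} {σ : St} {T T₁ T₂ : ℕ} {Q R : St → Prop} {e : Ex}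

theorem Tri.mono (h : Tri E P σ T₁ R) (hT : T₁ ≤ T) (hQ : ∀ σ', Fr P σ σ' → R σ' → Q σ') :
    Tri E P σ T Q := by
  obtain ⟨t, σ', h, ht, hr⟩ := h
  exact ⟨t, σ', h, ht.trans hT, hQ _ h.frame hr⟩

theorem Tri.seq (h₁ : Tri E P σ T₁ R) (h₂ : ∀ σ', Fr P σ σ' → R σ' → Tri E P' σ' T₂ Q)
    (hT : T₁ + T₂ ≤ T) : Tri E (P ;; P') σ T Q := by
  obtain ⟨t, σ', h, ht, hr⟩ := h₁
  obtain ⟨t', σ'', h', ht', hq⟩ := h₂ σ' h.frame hr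
  exact ⟨_, σ'', .seq h h', by omega, hq⟩

theorem Tri.ite (hs : e.safe E σ) (h₁ : e.eval E σ ≠ 0 → Tri E P σ T₁ Q)
    (h₂ : e.eval E σ = 0 → Tri E P' σ T₁ Q) (hT : e.cost + T₁ + 1 ≤ T) :
    Tri E (.ite e P P') σ T Q := by
  by_cases h : e.eval E σ = 0
  · obtain ⟨t, σ', h', ht, hr⟩ := h₂ h
    exact ⟨_, σ', .iteFalse hs h h', by omega, hr⟩
  · obtain ⟨t, σ', h', ht, hr⟩ := h₁ h
    exact ⟨_, σ', .iteTrue hs h h', by omega, hr⟩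

/-- The loop rule, with a credit that pays for the iterations. -/
theorem Tri.whl (I : ℕ → St → Prop) (hs : ∀ m σ, I m σ → e.safe E σ)
    (step : ∀ m σ₁, I m σ₁ → Fr (.whl e P) σ σ₁ → e.eval E σ₁ ≠ 0 →
      ∃ m' T, m' + T + e.cost + 1 ≤ m ∧ Tri E P σ₁ T (I m')) {m : ℕ} (h : I m σ)
    (hT : m + e.cost + 1 ≤ T)
    (hQ : ∀ m' σ', I m' σ' → Fr (.whl e P) σ σ' → e.eval E σ' = 0 → Q σ') :
    Tri E (.whl e P) σ T Q := by
  suffices H : ∀ m σ₁, I m σ₁ → Fr (.whl e P) σ σ₁ → ∃ t σ', Run E (.whl e P) σ₁ t σ' ∧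
      t ≤ m + e.cost + 1 ∧ Q σ' by
    obtain ⟨t, σ', a, b, c⟩ := H m σ h ⟨fun _ _ => rfl, fun _ _ => rfl⟩
    exact ⟨t, σ', a, by omega, c⟩
  intro m
  induction m using Nat.strong_induction_on with
  | _ m ih =>
    intro σ₁ h hf
    by_cases h0 : e.eval E σ₁ = 0
    · exact ⟨_, σ₁, .whlDone (hs _ _ h) h0, by omega, hQ _ _ h hf h0⟩
    · obtain ⟨m', T, hm, t, σ', hr, ht, hI⟩ := step m σ₁ h hf h0
      have hf' : Fr (.whl e P) σ σ' := ⟨fun x hx => (hr.frame.1 x hx).trans (hf.1 x hx),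
        fun x hx => (hr.frame.2 x hx).trans (hf.2 x hx)⟩
      obtain ⟨t', σ'', hr', ht', hQ'⟩ := ih m' (by omega) σ' hI hf'
      exact ⟨_, σ'', .whlStep (hs _ _ h) h0 hr hr', by omega, hQ'⟩

/-- `for x in 0, …, y - 1 do P`. -/
def Stm.fors (x y : Va) (P : Stm) : Stm :=
  x ≔ 0 ;; .whl (Ex.less x y) (P ;; x ≔ (x + 1 : Ex))

/-- The invariant for `i + 1` is required of the state in which the counter is already raised. The
allowance 10 per round covers the guard (4 steps) and the increment (4 steps); the final 10 covers
the initial assignment and the last guard. -/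
theorem Tri.fors {x y : Va} (b : ℕ) (hb : σ.reg y = b) (hN : b < E.N) (hxy : x ≠ y)
    (hx : P.wr x = false) (hy : P.wr y = false) (I : ℕ → St → Prop) (t : ℕ → ℕ)
    (h0 : I 0 (σ.setReg x 0))
    (step : ∀ i σ₁, i < b → σ₁.reg x = i → σ₁.reg y = b → Fr (.fors x y P) σ σ₁ → I i σ₁ →
      Tri E P σ₁ (t i) (fun σ₂ => I (i + 1) (σ₂.setReg x (i + 1))))
    (hT : ∑ i ∈ Finset.range b, (t i + 10) + 10 ≤ T)
    (hQ : ∀ σ', Fr (.fors x y P) σ σ' → I b σ' → Q σ') : Tri E (.fors x y P) σ T Q := by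
  have hfr : ∀ σ₁, Fr (.whl (Ex.less x y) (P ;; x ≔ (x + 1 : Ex))) (σ.setReg x 0) σ₁ →
      Fr (.fors x y P) σ σ₁ := by
    rintro σ₁ ⟨f1, f2⟩
    refine ⟨fun z hz => ?_, fun a ha => ?_⟩
    · simp only [Stm.fors, Stm.wr, Bool.or_eq_false_iff] at hz f1
      rw [f1 z hz.2, St.setReg_reg, if_neg]
      rintro rfl
      simp at hz
    · simp only [Stm.fors, Stm.wa, Bool.or_eq_false_iff] at ha f2
      rw [f2 a ha.2]; rfl
  refine Tri.seq (T₁ := 2) (T₂ := ∑ i ∈ Finset.range b, (t i + 10) + 8)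
    (R := fun σ' => σ' = σ.setReg x 0) ⟨_, _, .set _ _ _ ?_, le_rfl, rfl⟩ ?_ (by omega)
  · simp; omega
  · rintro _ - rfl
    refine Tri.whl (fun m σ₁ => ∃ i ≤ b, σ₁.reg x = i ∧ σ₁.reg y = b ∧ I i σ₁ ∧
      m = ∑ i ∈ Finset.Ico i b, (t i + 10)) ?_ ?_ (m := ∑ i ∈ Finset.range b, (t i + 10))
      ⟨0, Nat.zero_le _, by simp, by simp [hxy.symm, hb], h0, by simp⟩ ?_ ?_
    · simp
    · rintro m σ₁ ⟨i, hi, hxi, hyb, hI, rfl⟩ hf hlt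
      have hib : i < b := by
        by_contra hc
        simp [hxi, hyb, hc] at hlt
      refine ⟨_, t i + 4, ?_, Tri.seq (step i σ₁ hib hxi hyb (hfr _ hf) hI) (T₂ := 4)
        (Q := fun σ' => ∃ j ≤ b, σ'.reg x = j ∧ σ'.reg y = b ∧ I j σ' ∧
          ∑ i ∈ Finset.Ico (i + 1) b, (t i + 10) = ∑ i ∈ Finset.Ico j b, (t i + 10)) ?_ le_rfl⟩
      · rw [Finset.sum_eq_sum_Ico_succ_bot hib]
        simp only [Ex.less, Ex.cost]
        omega
      · intro σ₂ hf2 hI2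
        have hx2 : σ₂.reg x = i := (hf2.1 x hx).trans hxi
        have hy2 : σ₂.reg y = b := (hf2.1 y hy).trans hyb
        refine ⟨_, _, .set _ _ _ ?_, le_rfl, i + 1, hib, ?_, ?_, ?_, rfl⟩
        · simp only [Ex.safe_add, Ex.safe_var, Ex.safe_one, Ex.eval_var,
            Ex.eval_one, hx2, true_and]
          omega
        · simp [hx2]
        · simp [hxy.symm, hy2]
        · simpa [hx2] using hI2
    · simp only [Ex.less, Ex.cost]
      omega
    · rintro m σ₁ ⟨i, hi, hxi, hyb, hI, -⟩ hf hge
      have : i = b := by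
        by_contra hc
        simp [hxi, hyb] at hge
        omega
      subst this
      exact hQ _ (hfr _ hf) hI

/-! ### Loop-free statements -/

/-- The effect of a loop-free statement. -/
def Stm.den (E : Env) : Stm → St → St
  | .skip, σ => σ
  | .set x e, σ => σ.setReg x (e.eval E σ)
  | .put a i e, σ => σ.setArr a (i.eval E σ) (e.eval E σ)
  | .seq P Q, σ => Q.den E (P.den E σ)
  | .ite e P Q, σ => if e.eval E σ ≠ 0 then P.den E σ else Q.den E σ
  | .whl _ _, σ => σ

/-- The loop-free statement can be executed. -/
def Stm.ok (E : Env) : Stm → St → Prop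
  | .skip, _ => True
  | .set _ e, σ => e.safe E σ
  | .put _ i e, σ => i.safe E σ ∧ e.safe E σ
  | .seq P Q, σ => P.ok E σ ∧ Q.ok E (P.den E σ)
  | .ite e P Q, σ => e.safe E σ ∧ (e.eval E σ ≠ 0 → P.ok E σ) ∧ (e.eval E σ = 0 → Q.ok E σ)
  | .whl _ _, _ => False

/-- A bound on the running time of a loop-free statement. -/
def Stm.cost : Stm → ℕ
  | .skip => 1
  | .set _ e => e.cost + 1
  | .put _ i e => i.cost + e.cost + 6
  | .seq P Q => P.cost + Q.cost
  | .ite e P Q => e.cost + (max P.cost Q.cost + 1)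
  | .whl _ _ => 0

theorem Stm.run_den : ∀ (P : Stm) {σ : St}, P.ok E σ → ∃ t ≤ P.cost, Run E P σ t (P.den E σ)
  | .skip, _, _ => ⟨1, le_rfl, .skip _⟩
  | .set _ _, _, h => ⟨_, le_rfl, .set _ _ _ h⟩
  | .put _ _ _, _, h => ⟨_, le_rfl, .put _ _ _ _ h.1 h.2⟩
  | .seq P Q, _, h => by
    obtain ⟨t, ht, r⟩ := P.run_den h.1
    obtain ⟨t', ht', r'⟩ := Q.run_den h.2
    exact ⟨_, add_le_add ht ht', .seq r r'⟩
  | .ite e P Q, σ, h => by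
    simp only [Stm.den, Stm.cost]
    by_cases h0 : e.eval E σ = 0
    · obtain ⟨t, ht, r⟩ := Q.run_den (h.2.2 h0)
      exact ⟨e.cost + (t + 1), by omega, by simpa [h0] using Run.iteFalse h.1 h0 r⟩
    · obtain ⟨t, ht, r⟩ := P.run_den (h.2.1 h0)
      exact ⟨e.cost + (t + 1), by omega, by simpa [h0] using Run.iteTrue h.1 h0 r⟩
  | .whl _ _, _, h => h.elim

/-- For a loop-free block, safety, effect and cost are computable functions of the text, so such
blocks are verified by simplification and `decide`. -/
theorem Tri.block (h : P.ok E σ) (hT : P.cost ≤ T) (hQ : Q (P.den E σ)) : Tri E P σ T Q := by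
  obtain ⟨t, ht, r⟩ := P.run_den h
  exact ⟨t, _, r, ht.trans hT, hQ⟩

end Mach

/-! ## Breadth-first search on lists -/

namespace Grow

/-- `nb` lists the neighbours in a simple graph on the vertices `0, …, n - 1`. -/
structure IsNb (n : ℕ) (nb : ℕ → List ℕ) : Prop where
  nodup : ∀ v, (nb v).Nodup
  lt : ∀ v, ∀ u ∈ nb v, u < n
  symm : ∀ u v, u ∈ nb v → v ∈ nb u
  irrefl : ∀ v, v ∉ nb v

/-- A list of distinct vertices. -/
structure Good (n : ℕ) (o : List ℕ) : Prop where
  nodup : o.Nodup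
  lt : ∀ v ∈ o, v < n

theorem Good.length_le {n : ℕ} {o : List ℕ} (h : Good n o) : o.length ≤ n := by
  have := (h.nodup.subperm (l₂ := List.range n) fun v hv => List.mem_range.2 (h.lt v hv)).length_le
  simpa using this

theorem Good.snoc {n v : ℕ} {o : List ℕ} (h : Good n o) (hv : v < n) (ho : v ∉ o) :
    Good n (o ++ [v]) := by
  refine ⟨?_, ?_⟩
  · rw [List.nodup_append]
    refine ⟨h.nodup, List.nodup_singleton v, ?_⟩
    rintro a ha b hb rfl
    exact ho (by simpa using List.mem_singleton.1 hb ▸ ha)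
  · intro u hu
    rcases List.mem_append.1 hu with hu | hu
    · exact h.lt u hu
    · rwa [List.mem_singleton.1 hu]

variable (nb : ℕ → List ℕ)

/-- Appends the new neighbours of `x`. -/
def scan (o : List ℕ) (x : ℕ) : List ℕ := o ++ (nb x).filter (fun u => u ∉ o)

/-- Breadth-first search from position `h` of the queue `o`. -/
def bfs : ℕ → List ℕ → ℕ → List ℕ
  | 0, o, _ => o
  | f + 1, o, h => if hh : h < o.length then bfs f (scan nb o o[h]) (h + 1) else o

variable {nb}

theorem Good.scan {n : ℕ} (hn : IsNb n nb) {o : List ℕ} (h : Good n o) (x : ℕ) :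
    Good n (scan nb o x) := by
  refine ⟨?_, ?_⟩
  · unfold Grow.scan
    rw [List.nodup_append]
    refine ⟨h.nodup, (hn.nodup x).filter _, ?_⟩
    rintro a ha b hb rfl
    simp at hb
    exact hb.2 ha
  · intro u hu
    rcases List.mem_append.1 hu with hu | hu
    · exact h.lt u hu
    · exact hn.lt x u (List.mem_filter.1 hu).1

theorem mem_scan {o : List ℕ} {x u : ℕ} (h : u ∈ nb x) : u ∈ scan nb o x := by
  unfold scan
  by_cases ho : u ∈ o
  · exact List.mem_append_left _ ho
  · exact List.mem_append_right _ (List.mem_filter.2 ⟨h, by simpa using ho⟩)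

/-- From position `l` on, every entry in positions below `h` has all its neighbours in the list. -/
def Closed (nb : ℕ → List ℕ) (l h : ℕ) (o : List ℕ) : Prop :=
  ∀ i, l ≤ i → i < h → ∀ x, o[i]? = some x → ∀ u ∈ nb x, u ∈ o

/-- Every entry in a position strictly between `l` and `m` has an earlier neighbour. -/
def Parents (nb : ℕ → List ℕ) (l m : ℕ) (o : List ℕ) : Prop :=
  ∀ i, l < i → i < m → ∃ j, l ≤ j ∧ j < i ∧ o.getD i 0 ∈ nb (o.getD j 0)

theorem getD_prefix {o o' : List ℕ} (h : o <+: o') {i : ℕ} (hi : i < o.length) (d : ℕ) :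
    o'.getD i d = o.getD i d := by
  obtain ⟨t, rfl⟩ := h
  exact List.getD_append _ _ _ _ hi

/-- The fuel suffices when `n ≤ f + h`: the queue holds distinct vertices, so its length is at most
`n`, and when the fuel is used up the head has reached the end. `Closed` then says that whole
components were listed, and `Parents` that every initial segment from `l` on is connected. -/
theorem bfs_spec {n : ℕ} (hn : IsNb n nb) (l : ℕ) : ∀ (f : ℕ) (o : List ℕ) (h : ℕ), n ≤ f + h →
    Good n o → h ≤ o.length → l ≤ h → Closed nb l h o → Parents nb l o.length o →
    Good n (bfs nb f o h) ∧ o <+: bfs nb f o h ∧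
      Closed nb l (bfs nb f o h).length (bfs nb f o h) ∧
      Parents nb l (bfs nb f o h).length (bfs nb f o h) := by
  intro f
  induction f with
  | zero =>
    intro o h hf hg hh hl hc hp
    have := hg.length_le
    have : h = o.length := by omega
    subst this
    exact ⟨hg, List.prefix_rfl, hc, hp⟩
  | succ f ih =>
    intro o h hf hg hh hl hc hp
    unfold bfs
    split_ifs with hlt
    · have hpre : o <+: scan nb o o[h] := ⟨_, rfl⟩
      have hlen : o.length ≤ (scan nb o o[h]).length := hpre.length_le
      have h1 : Closed nb l (h + 1) (scan nb o o[h]) := by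
        intro i hli hih x hx u hu
        rw [scan, List.getElem?_append_left (by omega)] at hx
        rcases Nat.lt_succ_iff_lt_or_eq.1 hih with hi | rfl
        · exact hpre.subset (hc i hli hi x hx u hu)
        · rw [List.getElem?_eq_getElem hlt] at hx
          cases hx
          exact mem_scan hu
      have h2 : Parents nb l (scan nb o o[h]).length (scan nb o o[h]) := by
        intro i hli hi
        by_cases hio : i < o.length
        · obtain ⟨j, h1, h2, h3⟩ := hp i hli hio
          exact ⟨j, h1, h2, by rwa [getD_prefix hpre hio, getD_prefix hpre (by omega)]⟩
        -- A newly appended vertex has the scanned vertex, in position `h`, as its earlier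
        -- neighbour.
        · refine ⟨h, hl, by omega, ?_⟩
          rw [getD_prefix hpre hlt, List.getD_eq_getElem _ _ hlt, List.getD_eq_getElem _ _ hi]
          simp only [scan]
          rw [List.getElem_append_right (by omega)]
          exact (List.mem_filter.1 (List.getElem_mem _)).1
      obtain ⟨a, b, c, d⟩ := ih (scan nb o o[h]) (h + 1) (by omega) (hg.scan hn _) (by omega)
        (by omega) h1 h2
      exact ⟨a, hpre.trans b, c, d⟩
    · have : h = o.length := by omega
      subst this
      exact ⟨hg, List.prefix_rfl, hc, hp⟩

/-! ### Listing the components that remain after the removal of a separator -/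

variable (nb) (n q : ℕ) (S : List ℕ)

/-- The vertices of `S` followed by those of the components of the rest that contain a vertex
below `v`. -/
def ordr : ℕ → List ℕ
  | 0 => S
  | v + 1 => if v ∈ ordr v then ordr v else
      bfs nb (n - (ordr v).length) (ordr v ++ [v]) (ordr v).length

/-- The positions where the components begin. -/
def strt : ℕ → List ℕ
  | 0 => []
  | v + 1 => if v ∈ ordr nb n S v then strt v else strt v ++ [(ordr nb n S v).length]

/-- The position where the last large component begins. -/
def ovf : ℕ → Option ℕ
  | 0 => none
  | v + 1 => if v ∈ ordr nb n S v then ovf v else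
      if q < (ordr nb n S (v + 1)).length - (ordr nb n S v).length + S.length then
        some (ordr nb n S v).length else ovf v

variable {nb n q S}

/-- One step of `ordr`. -/
theorem bfs_snoc (hn : IsNb n nb) {o : List ℕ} (hg : Good n o) {v : ℕ} (hv : v < n) (ho : v ∉ o) :
    let R := bfs nb (n - o.length) (o ++ [v]) o.length
    Good n R ∧ o ++ [v] <+: R ∧ Closed nb o.length R.length R ∧
      Parents nb o.length R.length R := by
  have := hg.length_le
  refine bfs_spec hn o.length _ _ _ (by omega) (hg.snoc hv ho) (by simp) le_rfl ?_ ?_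
  · intro i h1 h2; omega
  · intro i h1 h2; simp at h2; omega

theorem ordr_good (hn : IsNb n nb) (hS : Good n S) : ∀ v ≤ n, Good n (ordr nb n S v) := by
  intro v
  induction v with
  | zero => exact fun _ => hS
  | succ v ih =>
    intro hv
    unfold ordr
    split_ifs with h
    · exact ih (by omega)
    · exact (bfs_snoc hn (ih (by omega)) hv h).1

theorem ordr_succ (hn : IsNb n nb) (hS : Good n S) {v : ℕ} (hv : v < n)
    (h : v ∉ ordr nb n S v) : ordr nb n S v ++ [v] <+: ordr nb n S (v + 1) := by
  rw [ordr, if_neg h]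
  exact (bfs_snoc hn (ordr_good hn hS v hv.le) hv h).2.1

theorem ordr_prefix_succ (hn : IsNb n nb) (hS : Good n S) {v : ℕ} (hv : v < n) :
    ordr nb n S v <+: ordr nb n S (v + 1) := by
  by_cases h : v ∈ ordr nb n S v
  · rw [ordr, if_pos h]
  · exact (List.prefix_append _ _).trans (ordr_succ hn hS hv h)

theorem ordr_prefix (hn : IsNb n nb) (hS : Good n S) {u v : ℕ} (huv : u ≤ v) (hv : v ≤ n) :
    ordr nb n S u <+: ordr nb n S v := by
  induction v, huv using Nat.le_induction with
  | base => exact List.prefix_rfl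
  | succ v _ ih => exact (ih (by omega)).trans (ordr_prefix_succ hn hS hv)

theorem mem_ordr (hn : IsNb n nb) (hS : Good n S) {u v : ℕ} (huv : u < v) (hv : v ≤ n) :
    u ∈ ordr nb n S v := by
  refine (ordr_prefix hn hS (show u + 1 ≤ v from huv) hv).subset ?_
  by_cases h : u ∈ ordr nb n S u
  · rwa [ordr, if_pos h]
  · exact (ordr_succ hn hS (by omega) h).subset (by simp)

theorem ordr_length (hn : IsNb n nb) (hS : Good n S) : (ordr nb n S n).length = n := by
  apply le_antisymm (ordr_good hn hS n le_rfl).length_le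
  have : List.range n ⊆ ordr nb n S n := fun u hu => mem_ordr hn hS (List.mem_range.1 hu) le_rfl
  have := (List.nodup_range.subperm this).length_le
  simpa using this

/-- The boundaries of the groups of vertices. -/
structure Layout (n q : ℕ) (nb : ℕ → List ℕ) (s : ℕ) (o : List ℕ) (g : ℕ) (bd : ℕ → ℕ) :
    Prop where
  good : Good n o
  len : o.length = n
  bd0 : bd 0 = s
  bdg : bd g = n
  mono : ∀ a < g, bd a < bd (a + 1)
  size : ∀ a < g, bd (a + 1) - bd a + s ≤ q
  inside : ∀ a < g, ∀ i, bd a ≤ i → i < bd (a + 1) → ∀ u ∈ nb (o.getD i 0),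
    ∃ j, o.getD j 0 = u ∧ (j < s ∨ bd a ≤ j ∧ j < bd (a + 1))

/-- The boundaries of the groups found so far. -/
def bdy (o L : List ℕ) (a : ℕ) : ℕ := L.getD a o.length

/-- Beyond the recorded starts, `bdy` falls back on the current length, so the last boundary needs
no storage. Closedness is demanded of every initial run of groups; as adjacency is symmetric, this
also excludes edges into earlier groups. -/
structure Partial (nb : ℕ → List ℕ) (s : ℕ) (o L : List ℕ) : Prop where
  bd0 : bdy o L 0 = s
  mono : ∀ a < L.length, bdy o L a < bdy o L (a + 1)
  closed : ∀ a ≤ L.length, ∀ i, s ≤ i → i < bdy o L a → ∀ u ∈ nb (o.getD i 0),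
    ∃ j < bdy o L a, o.getD j 0 = u

theorem bdy_top {o L : List ℕ} {a : ℕ} (h : L.length ≤ a) : bdy o L a = o.length :=
  List.getD_eq_default _ _ h

/-- Recording the old length as the start of a new group turns the default boundary into a stored
one; no earlier boundary moves. -/
theorem bdy_snoc {o o' L : List ℕ} {a : ℕ} (h : a ≤ L.length) :
    bdy o' (L ++ [o.length]) a = bdy o L a := by
  unfold bdy
  rcases h.lt_or_eq with h | rfl
  · rw [List.getD_append _ _ _ _ h, List.getD_eq_getElem _ _ h, List.getD_eq_getElem _ _ h]
  · simp

theorem Partial.le {s : ℕ} {o L : List ℕ} (h : Partial nb s o L) {a : ℕ} (ha : a ≤ L.length) :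
    bdy o L a ≤ o.length := by
  induction ha using Nat.decreasingInduction with
  | of_succ a ha ih => exact (h.mono a ha).le.trans ih
  | self => exact (bdy_top le_rfl).le

theorem Partial.ge {s : ℕ} {o L : List ℕ} (h : Partial nb s o L) {a : ℕ} (ha : a ≤ L.length) :
    s ≤ bdy o L a := by
  induction a with
  | zero => exact h.bd0.ge
  | succ a ih => exact (ih (by omega)).trans (h.mono a ha).le

theorem Partial.snoc {s : ℕ} {o o' L : List ℕ} (h : Partial nb s o L) (hp : o <+: o')
    (hlt : o.length < o'.length) (hc : Closed nb o.length o'.length o') :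
    Partial nb s o' (L ++ [o.length]) := by
  have top : bdy o' (L ++ [o.length]) (L.length + 1) = o'.length := bdy_top (by simp)
  have key : ∀ a ≤ L.length, ∀ i, s ≤ i → i < bdy o L a → ∀ u ∈ nb (o'.getD i 0),
      ∃ j < bdy o L a, o'.getD j 0 = u := by
    intro a ha i hsi hi u hu
    have hle := h.le ha
    rw [getD_prefix hp (by omega)] at hu
    obtain ⟨j, hj, hu⟩ := h.closed a ha i hsi hi u hu
    exact ⟨j, hj, by rw [getD_prefix hp (by omega), hu]⟩
  refine ⟨?_, ?_, ?_⟩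
  · rw [bdy_snoc (Nat.zero_le _), h.bd0]
  · intro a ha
    simp at ha
    rw [bdy_snoc (by omega)]
    rcases ha.lt_or_eq with ha' | rfl
    · rw [bdy_snoc ha']; exact h.mono a ha'
    · rw [top, bdy_top le_rfl]; exact hlt
  · intro a ha i hsi hi u hu
    simp at ha
    rcases Nat.le_succ_iff.1 ha with ha' | rfl
    · rw [bdy_snoc ha'] at hi ⊢
      exact key a ha' i hsi hi u hu
    · rw [Nat.succ_eq_add_one, top] at hi ⊢
      by_cases hio : i < o.length
      · obtain ⟨j, hj, hu⟩ := key L.length le_rfl i hsi (by rwa [bdy_top le_rfl]) u hu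
        exact ⟨j, by rw [bdy_top le_rfl] at hj; omega, hu⟩
      · have := hc i (by omega) hi _ (List.getElem?_eq_getElem hi) u
          (by rwa [List.getD_eq_getElem _ _ hi] at hu)
        obtain ⟨j, hj, rfl⟩ := List.mem_iff_getElem.1 this
        exact ⟨j, hj, List.getD_eq_getElem _ _ hj⟩

theorem partial_ordr (hn : IsNb n nb) (hS : Good n S) : ∀ v ≤ n,
    Partial nb S.length (ordr nb n S v) (strt nb n S v) := by
  intro v
  induction v with
  | zero =>
    intro _
    refine ⟨bdy_top le_rfl, by simp [strt], ?_⟩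
    intro a _ i h1 h2
    rw [bdy_top (by simp [strt])] at h2
    simp [ordr] at h2
    omega
  | succ v ih =>
    intro hv
    rw [strt]
    split_ifs with h
    · rw [ordr, if_pos h]; exact ih (by omega)
    · have hp := ordr_succ hn hS hv h
      refine (ih (by omega)).snoc ((List.prefix_append _ _).trans hp) ?_ ?_
      · simpa using hp.length_le
      · rw [ordr, if_neg h]
        exact (bfs_snoc hn (ordr_good hn hS v (by omega)) hv h).2.2.1

theorem size_of_ovf : ∀ v ≤ n, ovf nb n q S v = none →
    ∀ a < (strt nb n S v).length, bdy (ordr nb n S v) (strt nb n S v) (a + 1) -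
      bdy (ordr nb n S v) (strt nb n S v) a + S.length ≤ q := by
  intro v
  induction v with
  | zero => simp [strt]
  | succ v ih =>
    intro hv
    by_cases h : v ∈ ordr nb n S v
    · rw [ovf, strt, ordr, if_pos h, if_pos h, if_pos h]; exact ih (by omega)
    · rw [ovf, strt, if_neg h, if_neg h]
      intro ho a ha
      have ho' : ¬ q < (ordr nb n S (v + 1)).length - (ordr nb n S v).length + S.length :=
        fun h => by simp [h] at ho
      rw [if_neg ho'] at ho
      simp at ha
      rw [bdy_snoc ha]
      rcases ha.lt_or_eq with ha' | rfl
      · rw [bdy_snoc ha']; exact ih (by omega) ho a ha'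
      · rw [bdy_top (by simp), bdy_top le_rfl]; exact not_lt.1 ho'

/-- Without overflow, all groups are small. -/
theorem layout_of_ovf (hn : IsNb n nb) (hS : Good n S) (h : ovf nb n q S n = none) :
    Layout n q nb S.length (ordr nb n S n) (strt nb n S n).length
      (bdy (ordr nb n S n) (strt nb n S n)) := by
  have hp := partial_ordr hn hS n le_rfl
  have hg := ordr_good hn hS n le_rfl
  have hl := ordr_length hn hS
  refine ⟨hg, hl, hp.bd0, by rw [bdy_top le_rfl, hl], hp.mono, size_of_ovf n le_rfl h, ?_⟩
  intro a ha i h1 h2 u hu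
  have hs := hp.ge ha.le
  have hle := hp.le (show a + 1 ≤ _ from ha)
  obtain ⟨j, hj, rfl⟩ := hp.closed (a + 1) ha i (by omega) h2 u hu
  refine ⟨j, rfl, ?_⟩
  -- A neighbour in an earlier group is impossible: that run of groups is closed, so by symmetry it
  -- would contain position `i` as well, and positions are unique.
  by_contra hc
  obtain ⟨i', hi', he⟩ := hp.closed a ha.le j (by omega) (by omega) _ (hn.symm _ _ hu)
  have := hp.le ha.le
  rw [List.getD_eq_getElem _ _ (by omega), List.getD_eq_getElem _ _ (by omega)] at he
  have := (hg.nodup.getElem_inj_iff).1 he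
  omega

/-- This supplies the connected set for branching: the positions from `l` to `m` are too many, and
each but the first has an earlier neighbour among them. The list only grows at its end, so the
property persists while later components are appended. -/
theorem ovf_some (hn : IsNb n nb) (hS : Good n S) {l : ℕ} : ∀ v ≤ n, ovf nb n q S v = some l →
    S.length ≤ l ∧ ∃ m ≤ (ordr nb n S v).length, q < m - l + S.length ∧
      Parents nb l m (ordr nb n S v) := by
  intro v
  induction v with
  | zero => simp [ovf]
  | succ v ih =>
    intro hv
    have hpre := ordr_prefix_succ hn hS hv
    have old : ovf nb n q S v = some l → S.length ≤ l ∧ ∃ m ≤ (ordr nb n S (v + 1)).length,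
        q < m - l + S.length ∧ Parents nb l m (ordr nb n S (v + 1)) := by
      intro h
      obtain ⟨a, m, hm, hq, hp⟩ := ih (by omega) h
      refine ⟨a, m, hm.trans hpre.length_le, hq, fun i h1 h2 => ?_⟩
      obtain ⟨j, h3, h4, h5⟩ := hp i h1 h2
      exact ⟨j, h3, h4, by rwa [getD_prefix hpre (by omega), getD_prefix hpre (by omega)]⟩
    rw [ovf]
    split_ifs with h hq
    · exact old
    · intro he
      cases he
      refine ⟨(ordr_prefix hn hS (Nat.zero_le v) (by omega)).length_le, _, le_rfl, hq, ?_⟩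
      rw [ordr, if_neg h]
      exact (bfs_snoc hn (ordr_good hn hS v (by omega)) hv h).2.2.2
    · exact old

/-! ### Searching for a separator -/

variable (nb n q) in
/-- Extends `S` until no component is too large. The choices are the digits of `c`. -/
def attempt : ℕ → ℕ → List ℕ → Option (List ℕ)
  | 0, _, S => if ovf nb n q S n = none then some S else none
  | f + 1, c, S =>
    match ovf nb n q S n with
    | none => some S
    | some l => attempt f (c / (q + 1 - S.length))
        (S ++ [(ordr nb n S n).getD (l + c % (q + 1 - S.length)) 0])

/-- `T` leaves only components that, together with `T`, have at most `q` vertices. -/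
structure Separator (n q : ℕ) (nb : ℕ → List ℕ) (T : Finset ℕ) : Prop where
  sub : ∀ v ∈ T, v < n
  card : T.card < q
  conn : ∀ l : List ℕ, Good n l → (∀ v ∈ l, v ∉ T) → l ≠ [] → Parents nb 0 l.length l →
    T.card + l.length ≤ q

/-- The properties of the vertex chosen by a digit. -/
theorem pick_good (hn : IsNb n nb) (hS : Good n S) {l d : ℕ} (h : ovf nb n q S n = some l)
    (hq : S.length ≤ q) (hd : d < q + 1 - S.length) :
    l + d < n ∧ Good n (S ++ [(ordr nb n S n).getD (l + d) 0]) := by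
  obtain ⟨hl, m, hm, hqm, -⟩ := ovf_some hn hS n le_rfl h
  have hlen := ordr_length hn hS
  have hlt : l + d < (ordr nb n S n).length := by omega
  have hg := ordr_good hn hS n le_rfl
  refine ⟨by omega, hS.snoc ?_ ?_⟩
  · rw [List.getD_eq_getElem _ _ hlt]
    exact hg.lt _ (List.getElem_mem _)
  · intro hmem
    obtain ⟨i, hi, he⟩ := List.mem_iff_getElem.1 hmem
    have hpre : S <+: ordr nb n S n := ordr_prefix hn hS (Nat.zero_le n) le_rfl
    rw [List.getD_eq_getElem _ _ hlt, ← List.getD_eq_getElem _ 0 hi, ← getD_prefix hpre hi,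
      List.getD_eq_getElem _ _ (by omega)] at he
    have := (hg.nodup.getElem_inj_iff).1 he
    omega

/-- Soundness holds for every code, however arbitrary, since success is reported only after the
absence of large components has been tested. The fuel keeps the separator within `q` vertices. -/
theorem attempt_spec (hn : IsNb n nb) : ∀ (f c : ℕ) (S R : List ℕ), Good n S → S.length + f ≤ q →
    attempt nb n q f c S = some R → Good n R ∧ R.length ≤ q ∧ ovf nb n q R n = none := by
  intro f
  induction f with
  | zero =>
    intro c S R hS hf h
    rw [attempt] at h
    split_ifs at h with h'
    cases h
    exact ⟨hS, by omega, h'⟩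
  | succ f ih =>
    intro c S R hS hf h
    rw [attempt] at h
    cases ho : ovf nb n q S n with
    | none =>
      simp only [ho] at h
      cases h
      exact ⟨hS, by omega, ho⟩
    | some l =>
      simp only [ho] at h
      exact ih _ _ _ (pick_good hn hS ho (by omega) (Nat.mod_lt _ (by omega))).2 (by simp; omega) h

/-- The invariant is that the current list stays inside `T`. Each overflow exposes a connected set
that must meet `T`, so a digit leading to another vertex of `T` exists. The fuel cannot run out,
since `T` has fewer than `q` vertices. -/
theorem exists_attempt (hn : IsNb n nb) {T : Finset ℕ} (hT : Separator n q nb T) :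
    ∀ (f : ℕ) (S : List ℕ), Good n S → S.length + f = q → (∀ v ∈ S, v ∈ T) →
    ∃ c < 2 ^ (q * f), attempt nb n q f c S ≠ none := by
  intro f
  induction f with
  | zero =>
    intro S hS hf hST
    have := (hS.nodup.subperm (l₂ := T.toList) fun v hv => by simpa using hST v hv).length_le
    have := hT.card
    simp at *
    omega
  | succ f ih =>
    intro S hS hf hST
    cases ho : ovf nb n q S n with
    | none => exact ⟨0, by positivity, by simp [attempt, ho]⟩
    | some l =>
      have hcard := (hS.nodup.subperm (l₂ := T.toList)
        fun v hv => by simpa using hST v hv).length_le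
      simp at hcard
      obtain ⟨hl, m, hm, hqm, hp⟩ := ovf_some hn hS n le_rfl ho
      have hlen := ordr_length hn hS
      have hg := ordr_good hn hS n le_rfl
      have : ∃ d < q + 1 - S.length, (ordr nb n S n).getD (l + d) 0 ∈ T := by
        by_contra! hno
        -- An initial segment of the large component, hence connected. If it avoided `T`, then |T| +
        -- (q + 1 - |S|) ≤ q, contrary to |S| ≤ |T|.
        set X := ((ordr nb n S n).drop l).take (q + 1 - S.length) with hX
        have hXl : X.length = q + 1 - S.length := by simp [hX]; omega
        have hXi : ∀ i < X.length, X.getD i 0 = (ordr nb n S n).getD (l + i) 0 := by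
          intro i hi
          rw [List.getD_eq_getElem _ _ hi, List.getD_eq_getElem _ _ (by omega)]
          simp [hX]
        have hsub : X.Sublist (ordr nb n S n) :=
          (List.take_sublist _ _).trans (List.drop_sublist _ _)
        have := hT.conn X ⟨hg.nodup.sublist hsub, fun v hv => hg.lt v (hsub.subset hv)⟩ ?_ ?_ ?_
        · omega
        · intro v hv
          obtain ⟨i, hi, rfl⟩ := List.mem_iff_getElem.1 hv
          rw [← List.getD_eq_getElem _ 0 hi, hXi i hi]
          exact hno i (by omega)
        · rw [← List.length_pos_iff]; omega
        · intro i h1 h2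
          obtain ⟨j, h3, h4, h5⟩ := hp (l + i) (by omega) (by omega)
          refine ⟨j - l, by omega, by omega, ?_⟩
          rw [hXi i h2, hXi _ (by omega), show l + (j - l) = j by omega]
          exact h5
      obtain ⟨d, hd, hdT⟩ := this
      obtain ⟨-, hg'⟩ := pick_good hn hS ho (by omega) hd
      obtain ⟨c, hc, ha⟩ := ih _ hg' (by simp; omega) (by
        intro v hv
        rcases List.mem_append.1 hv with hv | hv
        · exact hST v hv
        · rwa [List.mem_singleton.1 hv])
      -- The new choice is the lowest digit, in base `q + 1 - S.length`. This base is at most 2^q,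
      -- so each choice adds at most `q` bits to the code.
      refine ⟨d + (q + 1 - S.length) * c, ?_, ?_⟩
      · have h1 : q + 1 - S.length ≤ 2 ^ q := by have := q.lt_two_pow_self; omega
        calc d + (q + 1 - S.length) * c < (q + 1 - S.length) * (c + 1) := by
              rw [mul_add_one]; omega
          _ ≤ 2 ^ q * 2 ^ (q * f) := Nat.mul_le_mul h1 hc
          _ = 2 ^ (q * (f + 1)) := by rw [← pow_add]; ring_nf
      · simp only [attempt, ho]
        rwa [Nat.add_mul_mod_self_left, Nat.mod_eq_of_lt hd,
          Nat.add_mul_div_left _ _ (by omega), Nat.div_eq_of_lt hd, zero_add]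

end Grow

/-! ## The search for a separator as a program -/

namespace Mach

open Grow

/-- The input describes the graph `nb` on `n` vertices; the record of `v` begins at `off v`. -/
structure Inp (E : Env) (n : ℕ) (nb : ℕ → List ℕ) (off : ℕ → ℕ) : Prop where
  isNb : IsNb n nb
  deg : ∀ v < n, E.inp (off v) = (nb v).length
  ent : ∀ v < n, ∀ j (h : j < (nb v).length), E.inp (off v + 1 + j) = (nb v)[j]
  lim : ∀ v < n, off v + 1 + (nb v).length ≤ E.L
  hL : E.L < E.N
  hn : 2 * n + 2 < E.N

/-- The variable `n` and the array of offsets are initialised. -/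
structure Base (n : ℕ) (off : ℕ → ℕ) (σ : St) : Prop where
  hn : σ.reg .n = n
  hoff : ∀ v < n, σ.arr .off v = off v

theorem Base.congr {n : ℕ} {off : ℕ → ℕ} {σ σ' : St} (h : Base n off σ)
    (h1 : σ'.reg .n = σ.reg .n) (h2 : σ'.arr .off = σ.arr .off) : Base n off σ' :=
  ⟨h1.trans h.hn, fun v hv => by rw [h2, h.hoff v hv]⟩

/-- The arrays `ord` and `mark` represent the list `o`. -/
structure Queue (n : ℕ) (o : List ℕ) (σ : St) : Prop where
  tail : σ.reg .tail = o.length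
  ord : ∀ i (h : i < o.length), σ.arr .ord i = o[i]
  mark : ∀ i (h : i < o.length), σ.arr .mark o[i] = i + 1
  mark0 : ∀ v < n, v ∉ o → σ.arr .mark v = 0

theorem Queue.congr {n : ℕ} {o : List ℕ} {σ σ' : St} (h : Queue n o σ)
    (h1 : σ'.reg .tail = σ.reg .tail) (h2 : σ'.arr .ord = σ.arr .ord)
    (h3 : σ'.arr .mark = σ.arr .mark) : Queue n o σ' :=
  ⟨h1.trans h.tail, fun i hi => by rw [h2, h.ord i hi], fun i hi => by rw [h3, h.mark i hi],
    fun v hv ho => by rw [h3, h.mark0 v hv ho]⟩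

/-- Marks are positions shifted by one, which frees 0 to mean "not visited". The same array later
translates neighbours into positions. -/
theorem Queue.mark_eq_zero {n : ℕ} {o : List ℕ} {σ : St} (h : Queue n o σ) {v : ℕ} (hv : v < n) :
    σ.arr .mark v = 0 ↔ v ∉ o := by
  refine ⟨fun h0 hm => ?_, h.mark0 v hv⟩
  obtain ⟨i, hi, rfl⟩ := List.mem_iff_getElem.1 hm
  rw [h.mark i hi] at h0
  omega

theorem Queue.push {n : ℕ} {o : List ℕ} {σ σ' : St} (h : Queue n o σ) {u : ℕ} (ho : u ∉ o)
    (h1 : σ'.reg .tail = o.length + 1)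
    (h2 : σ'.arr .ord = Function.update (σ.arr .ord) o.length u)
    (h3 : σ'.arr .mark = Function.update (σ.arr .mark) u (o.length + 1)) :
    Queue n (o ++ [u]) σ' := by
  refine ⟨by simp [h1], fun i hi => ?_, fun i hi => ?_, fun v hv hvo => ?_⟩
  · rw [h2, Function.update_apply]
    split_ifs with hil
    · subst hil; simp
    · simp at hi
      rw [List.getElem_append_left (by omega), h.ord i (by omega)]
  · rw [h3]
    by_cases hil : i = o.length
    · subst hil; simp
    · simp at hi
      rw [List.getElem_append_left (by omega), Function.update_of_ne, h.mark i (by omega)]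
      exact fun he => ho (he ▸ List.getElem_mem _)
  · simp at hvo
    rw [h3, Function.update_of_ne hvo.2, h.mark0 v hv hvo.1]

/-- Appends the unmarked neighbours of the vertex at the head of the queue. -/
def scanBody : Stm :=
  .x ≔ .get .ord (Va.head : Ex) ;; .o ≔ .get .off (Va.x : Ex) ;; .d ≔ .inp (Va.o : Ex) ;;
  .fors .j .d (.u ≔ .inp (Va.o + 1 + Va.j : Ex) ;;
    .ite (.get .mark (Va.u : Ex)) .skip
      (.put .ord (Va.tail : Ex) (Va.u : Ex) ;; .tail ≔ (Va.tail + 1 : Ex) ;;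
        .put .mark (Va.u : Ex) (Va.tail : Ex))) ;;
  .head ≔ (Va.head + 1 : Ex)

/-- Enters a new vertex into the queue and visits its component. -/
def growBody : Stm :=
  .put .start (Va.g : Ex) (Va.tail : Ex) ;; .head ≔ (Va.tail : Ex) ;;
  .put .ord (Va.tail : Ex) (Va.v : Ex) ;; .tail ≔ (Va.tail + 1 : Ex) ;;
  .put .mark (Va.v : Ex) (Va.tail : Ex) ;;
  .whl (Ex.less Va.head Va.tail) scanBody ;;
  .ite (Ex.less Va.q ((Va.tail - .get .start (Va.g : Ex)) + Va.s : Ex))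
    (.ov ≔ 1 ;; .ovst ≔ .get .start (Va.g : Ex)) .skip ;;
  .g ≔ (Va.g + 1 : Ex)

/-- Lists the components of the graph without the vertices `ord[0], …, ord[s - 1]`. -/
def components : Stm :=
  .fors .v .n (.put .mark (Va.v : Ex) 0) ;;
  .fors .i .s (.put .mark (.get .ord (Va.i : Ex)) (Va.i + 1 : Ex)) ;;
  .tail ≔ (Va.s : Ex) ;; .g ≔ 0 ;; .ov ≔ 0 ;;
  .fors .v .n (.ite (.get .mark (Va.v : Ex)) .skip growBody) ;;
  .put .start (Va.g : Ex) (Va.tail : Ex)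

variable {E : Env} {n : ℕ} {nb : ℕ → List ℕ} {off : ℕ → ℕ} {σ : St}

theorem scanBody_tri (hE : Inp E n nb off) (hb : Base n off σ) {o : List ℕ} (hq : Queue n o σ)
    (hg : Good n o) {h : ℕ} (hh : h < o.length) (hr : σ.reg .head = h) :
    Tri E scanBody σ (60 * ((nb o[h]).length + 1)) (fun σ' =>
      Queue n (scan nb o o[h]) σ' ∧ σ'.reg .head = h + 1) := by
  have hx : o[h] < n := hg.lt _ (List.getElem_mem _)
  have hlen := hg.length_le
  have hdeg := hE.lim _ hx
  have hL := hE.hL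
  have hn := hE.hn
  set x := o[h] with hxdef
  unfold scanBody
  have hord := hq.ord h hh
  refine Tri.seq (T₁ := 20) (T₂ := 40 + 60 * (nb x).length)
    (R := fun σ' => σ' = σ.setReg .x x) (Tri.block ?_ (by decide) ?_) ?_ (by ring_nf; omega)
  · simp [Stm.ok]
  · simp [Stm.den, hr, hord, hxdef]
  rintro _ - rfl
  refine Tri.seq (T₁ := 9) (T₂ := 31 + 60 * (nb x).length)
    (R := fun σ' => σ' = (σ.setReg .x x).setReg .o (off x)) (Tri.block ?_ (by decide) ?_) ?_
    (by ring_nf; omega)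
  · simp [Stm.ok]
  · simp [Stm.den, hb.hoff _ hx]
  rintro _ - rfl
  refine Tri.seq (T₁ := 3) (T₂ := 28 + 60 * (nb x).length)
    (R := fun σ' => σ' = ((σ.setReg .x x).setReg .o (off x)).setReg .d (nb x).length)
    (Tri.block ?_ (by decide) ?_) ?_
    (by ring_nf; omega)
  · simp [Stm.ok]; omega
  · simp [Stm.den, hE.deg _ hx]
  rintro _ - rfl
  refine Tri.seq (T₁ := 10 + 60 * (nb x).length) (T₂ := 18)
    (R := fun σ' => Queue n (scan nb o x) σ') ?_ ?_ (by ring_nf; omega)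
  · refine Tri.fors (nb x).length (by simp) (by omega) (by decide) (by rfl) (by rfl)
      (fun j σ' => Queue n (o ++ ((nb x).take j).filter (fun u => u ∉ o)) σ') (fun _ => 50)
      ?_ ?_ (by simp; ring_nf; omega) ?_
    · simpa using hq.congr (σ' := (((σ.setReg .x x).setReg .o (off x)).setReg .d (nb x).length).setReg .j 0)
        rfl rfl rfl
    · intro j σ₁ hj hj1 hd1 hf hq1
      have ho1 : σ₁.reg .o = off x := by rw [hf.1 .o rfl]; simp
      have hent := hE.ent x hx j hj
      have hult : (nb x)[j] < n := hE.isNb.lt x _ (List.getElem_mem _)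
      have hlen1 : (o ++ ((nb x).take j).filter (fun u => u ∉ o)).length ≤ n := by
        refine Good.length_le ⟨?_, fun v hv => ?_⟩
        · refine ((hg.scan hE.isNb x).nodup).sublist ?_
          exact List.Sublist.append_left (List.Sublist.filter _ (List.take_sublist _ _)) _
        · rcases List.mem_append.1 hv with hv | hv
          · exact hg.lt v hv
          · exact hE.isNb.lt x v (List.take_subset _ _ (List.mem_filter.1 hv).1)
      have htake : (nb x).take (j + 1) = (nb x).take j ++ [(nb x)[j]] := by simp
      -- `scan` filters by the list at the start of the scan, whereas the program tests the current
      -- marks. The two tests agree because an adjacency list has no repetitions.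
      have hnt : (nb x)[j] ∉ (nb x).take j := by
        have := hE.isNb.nodup x
        have h2 := this.sublist (List.take_sublist (j + 1) (nb x))
        rw [htake, List.nodup_append] at h2
        intro hmem
        exact h2.2.2 _ hmem _ (by simp) rfl
      have hmark := hq1.mark_eq_zero hult
      rw [htake, List.filter_append]
      by_cases hm : (nb x)[j] ∈ o
      · have hm' : σ₁.arr .mark (nb x)[j] ≠ 0 := by
          rw [Ne, hmark]; simp [hm]
        refine Tri.block ?_ (by decide) ?_
        · simp [Stm.ok, Stm.den, ho1, hj1, hent, hm']
          omega
        · simp only [List.filter_singleton, hm, not_true_eq_false, decide_false, cond_false,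
            List.append_nil]
          refine hq1.congr ?_ ?_ ?_ <;> simp [Stm.den, ho1, hj1, hent, hm']
      · have hm' : (nb x)[j] ∉ o ++ ((nb x).take j).filter (fun u => u ∉ o) := by
          simp [hm, hnt]
        have h0 := hmark.2 hm'
        have ht1 := hq1.tail
        refine Tri.block ?_ (by decide) ?_
        · simp [Stm.ok, Stm.den, ho1, hj1, hent, h0, ht1] at hlen1 ⊢
          omega
        · simp only [List.filter_singleton, hm, not_false_eq_true, decide_true, cond_true,
            ← List.append_assoc]
          refine hq1.push hm' ?_ ?_ ?_ <;> simp [Stm.den, ho1, hj1, hent, h0, ht1]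
    · intro σ' _ h
      simpa [scan] using h
  · intro σ₁ hf hq1
    have hr1 : σ₁.reg .head = h := by rw [hf.1 .head rfl]; simpa using hr
    refine Tri.block ?_ (by decide) ?_
    · simp [Stm.ok, hr1]; omega
    · exact ⟨hq1.congr rfl rfl rfl, by simp [Stm.den, hr1]⟩

/-- The time needed to scan the vertices of a list. -/
def wt (nb : ℕ → List ℕ) (l : List ℕ) : ℕ := (l.map fun v => (nb v).length + 1).sum

theorem wt_prefix {l l' : List ℕ} (h : l <+: l') : wt nb l ≤ wt nb l' := by
  obtain ⟨t, rfl⟩ := h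
  simp [wt]

theorem bfs_prefix : ∀ (f : ℕ) (o : List ℕ) (h : ℕ), o <+: bfs nb f o h
  | 0, o, h => List.prefix_rfl
  | f + 1, o, h => by
    unfold bfs
    split_ifs
    · exact (List.prefix_append _ _).trans (bfs_prefix f _ _)
    · exact List.prefix_rfl

/-- The final list is determined by the initial state, so the credit can be the total weight, degree
plus one, of its entries that are not yet scanned. Scanning a vertex spends exactly its own weight.
-/
theorem bfs_tri (hE : Inp E n nb off) (hb : Base n off σ) {o : List ℕ} (hq : Queue n o σ)
    (hg : Good n o) {h : ℕ} (hh : h ≤ o.length) (hr : σ.reg .head = h) :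
    Tri E (.whl (Ex.less Va.head Va.tail) scanBody) σ
      (80 * (wt nb (bfs nb (n - h) o h) - wt nb (o.take h)) + 10)
      (fun σ' => Queue n (bfs nb (n - h) o h) σ') := by
  set R := bfs nb (n - h) o h with hR
  refine Tri.whl (fun m σ' => ∃ o h, Queue n o σ' ∧ σ'.reg .head = h ∧ h ≤ o.length ∧ Good n o ∧
      bfs nb (n - h) o h = R ∧ m = 80 * (wt nb R - wt nb (o.take h))) ?_ ?_
      ⟨o, h, hq, hr, hh, hg, hR.symm, rfl⟩ (by simp only [Ex.less, Ex.cost]; omega) ?_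
  · simp
  · rintro m σ₁ ⟨o, h, hq, hr, hh, hg, hR, rfl⟩ hf hlt
    have hlt' : h < o.length := by
      by_contra hc
      simp [hr, hq.tail, hc] at hlt
    have hn := hg.length_le
    have hb1 : Base n off σ₁ := hb.congr (hf.1 _ rfl) (hf.2 _ rfl)
    have hs : bfs nb (n - (h + 1)) (scan nb o o[h]) (h + 1) = R := by
      rw [show n - h = n - (h + 1) + 1 by omega, bfs, dif_pos hlt'] at hR
      exact hR
    have htk : (scan nb o o[h]).take (h + 1) = o.take h ++ [o[h]] := by
      rw [scan, List.take_append_of_le_length (by omega), List.take_succ_eq_append_getElem hlt']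
    have hw : wt nb (o.take h ++ [o[h]]) = wt nb (o.take h) + ((nb o[h]).length + 1) := by
      simp only [wt, List.map_append, List.sum_append, List.map_cons, List.map_nil, List.sum_cons,
        List.sum_nil, add_zero]
    have hle : wt nb (o.take h ++ [o[h]]) ≤ wt nb R := by
      rw [← htk, ← hs]
      exact wt_prefix ((List.take_prefix _ _).trans (bfs_prefix _ _ _))
    refine ⟨80 * (wt nb R - wt nb (o.take h ++ [o[h]])), 60 * ((nb o[h]).length + 1), ?_,
      (scanBody_tri hE hb1 hq hg hlt' hr).mono le_rfl ?_⟩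
    · simp only [Ex.less, Ex.cost]
      omega
    · rintro σ' - ⟨hq', hr'⟩
      refine ⟨_, h + 1, hq', hr', ?_, hg.scan hE.isNb _, hs, by rw [htk]⟩
      have : o.length ≤ (scan nb o o[h]).length := List.IsPrefix.length_le ⟨_, rfl⟩
      omega
  · rintro m σ₁ ⟨o, h, hq, hr, hh, hg, hR, rfl⟩ hf hge
    have : h = o.length := by
      by_contra hc
      simp [hr, hq.tail] at hge
      omega
    subst this
    have : bfs nb (n - o.length) o o.length = o := by
      cases n - o.length <;> simp [bfs]
    rwa [← hR, this]

/-- The starting positions of the groups and the overflow are recorded. -/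
structure Marks (L : List ℕ) (ov : Option ℕ) (σ : St) : Prop where
  g : σ.reg .g = L.length
  start : ∀ a (h : a < L.length), σ.arr .start a = L[a]
  none : ov = none → σ.reg .ov = 0
  some : ∀ l, ov = some l → σ.reg .ov = 1 ∧ σ.reg .ovst = l

theorem Marks.congr {L : List ℕ} {ov : Option ℕ} {σ σ' : St} (h : Marks L ov σ)
    (h1 : σ'.reg .g = σ.reg .g) (h2 : σ'.arr .start = σ.arr .start)
    (h3 : σ'.reg .ov = σ.reg .ov) (h4 : σ'.reg .ovst = σ.reg .ovst) : Marks L ov σ' :=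
  ⟨h1.trans h.g, fun a ha => by rw [h2, h.start a ha], fun ho => h3.trans (h.none ho),
    fun l hl => ⟨h3.trans (h.some l hl).1, h4.trans (h.some l hl).2⟩⟩

/-- The time is charged to the weight of the vertices added, so that the costs telescope when summed
over all starting vertices (`sum_wt_ordr`). -/
theorem growBody_tri (hE : Inp E n nb off) (hb : Base n off σ) {S : List ℕ} (hS : Good n S)
    {q v : ℕ} (hs : σ.reg .s = S.length) (hqr : σ.reg .q = q) (hv : v < n) (hvr : σ.reg .v = v)
    (ho : v ∉ ordr nb n S v) (hq : Queue n (ordr nb n S v) σ)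
    (hm : Marks (strt nb n S v) (ovf nb n q S v) σ) (hL : (strt nb n S v).length ≤ v) :
    Tri E growBody σ (80 * (wt nb (ordr nb n S (v + 1)) - wt nb (ordr nb n S v)) + 120)
      (fun σ' => Queue n (ordr nb n S (v + 1)) σ' ∧
        Marks (strt nb n S (v + 1)) (ovf nb n q S (v + 1)) σ') := by
  have hO := ordr_good hE.isNb hS
  have hO1 := hO (v + 1) hv
  have hOl := (hO v hv.le).length_le
  have hO1l := hO1.length_le
  have hSl := hS.length_le
  have hN := hE.hn
  have hg1 := (hO v hv.le).snoc hv ho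
  have hlt : (ordr nb n S v).length < n := by have := hg1.length_le; simp at this; omega
  have e1 : ordr nb n S (v + 1) =
      bfs nb (n - (ordr nb n S v).length) (ordr nb n S v ++ [v]) (ordr nb n S v).length := by
    rw [ordr, if_neg ho]
  have e2 : strt nb n S (v + 1) = strt nb n S v ++ [(ordr nb n S v).length] := by
    rw [strt, if_neg ho]
  have e3 : ovf nb n q S (v + 1) =
      if q < (ordr nb n S (v + 1)).length - (ordr nb n S v).length + S.length then
        some (ordr nb n S v).length else ovf nb n q S v := by
    rw [ovf, if_neg ho]
  generalize ordr nb n S (v + 1) = O' at *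
  generalize strt nb n S (v + 1) = L' at *
  generalize ovf nb n q S (v + 1) = ov' at *
  generalize ordr nb n S v = O at *
  generalize strt nb n S v = L at *
  generalize ovf nb n q S v = ov at *
  have ht := hq.tail
  have hgr := hm.g
  unfold growBody
  refine Tri.seq (T₁ := 8) (T₂ := 80 * (wt nb O' - wt nb O) + 112)
    (R := fun σ' => σ' = σ.setArr .start L.length O.length) (Tri.block ?_ (by decide) ?_) ?_
    (by omega)
  · simp [Stm.ok]
  · simp [Stm.den, hgr, ht]
  rintro _ - rfl
  refine Tri.seq (T₁ := 2) (T₂ := 80 * (wt nb O' - wt nb O) + 110)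
    (R := fun σ' => σ' = (σ.setArr .start L.length O.length).setReg .head O.length)
    (Tri.block ?_ (by decide) ?_) ?_ (by omega)
  · simp [Stm.ok]
  · simp [Stm.den, ht]
  rintro _ - rfl
  refine Tri.seq (T₁ := 8) (T₂ := 80 * (wt nb O' - wt nb O) + 102)
    (R := fun σ' => σ' = ((σ.setArr .start L.length O.length).setReg .head O.length).setArr
      .ord O.length v)
    (Tri.block ?_ (by decide) ?_) ?_ (by omega)
  · simp [Stm.ok]
  · simp [Stm.den, ht, hvr]
  rintro _ - rfl
  refine Tri.seq (T₁ := 4) (T₂ := 80 * (wt nb O' - wt nb O) + 98)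
    (R := fun σ' => σ' = (((σ.setArr .start L.length O.length).setReg .head O.length).setArr
      .ord O.length v).setReg .tail (O.length + 1))
    (Tri.block ?_ (by decide) ?_) ?_ (by omega)
  · simp [Stm.ok, ht]; omega
  · simp [Stm.den, ht]
  rintro _ - rfl
  refine Tri.seq (T₁ := 8) (T₂ := 80 * (wt nb O' - wt nb O) + 90)
    (R := fun σ' => σ' = ((((σ.setArr .start L.length O.length).setReg .head O.length).setArr
      .ord O.length v).setReg .tail (O.length + 1)).setArr .mark v (O.length + 1))
    (Tri.block ?_ (by decide) ?_) ?_ (by omega)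
  · simp [Stm.ok]
  · simp [Stm.den, hvr]
  rintro _ - rfl
  refine Tri.seq (Tri.mono (bfs_tri hE (hb.congr (by simp) (by simp))
    (hq.push ho (by simp) (by simp) (by simp)) hg1 (h := O.length) (by simp) (by simp)) le_rfl
    (fun _ _ h => h)) (T₂ := 80) ?_ ?_
  · rw [← e1]
    intro σ₁ hf hq1
    have r1 : σ₁.reg .g = L.length := by rw [hf.1 .g rfl]; simp [hgr]
    have r2 : σ₁.reg .q = q := by rw [hf.1 .q rfl]; simp [hqr]
    have r3 : σ₁.reg .s = S.length := by rw [hf.1 .s rfl]; simp [hs]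
    have r4 : σ₁.arr .start = Function.update (σ.arr .start) L.length O.length := by
      rw [hf.2 .start rfl]; simp
    have r5 : σ₁.reg .ov = σ.reg .ov := by rw [hf.1 .ov rfl]; simp
    have r6 : σ₁.reg .ovst = σ.reg .ovst := by rw [hf.1 .ovst rfl]; simp
    have ht1 := hq1.tail
    have hst : ∀ σ' : St, σ'.reg .g = L.length + 1 → σ'.arr .start = σ₁.arr .start →
        (ov' = none → σ'.reg .ov = 0) →
        (∀ l, ov' = some l → σ'.reg .ov = 1 ∧ σ'.reg .ovst = l) → Marks L' ov' σ' := by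
      intro σ' h1 h2 h3 h4
      subst e2
      refine ⟨by simp [h1], fun a ha => ?_, h3, h4⟩
      rw [h2, r4, Function.update_apply]
      split_ifs with h
      · subst h; simp
      · simp at ha
        rw [hm.start a (by omega), List.getElem_append_left (by omega)]
    refine Tri.block ?_ (by decide) ?_
    · by_cases hov : q < O'.length - O.length + S.length
      · simp [Stm.ok, Stm.den, r1, r2, r3, r4, ht1, hov]; omega
      · simp [Stm.ok, Stm.den, r1, r2, r3, r4, ht1, hov]; omega
    · by_cases hov : q < O'.length - O.length + S.length
      · rw [if_pos hov] at e3
        simp [Stm.den, r1, r2, r3, r4, ht1, hov]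
        refine ⟨hq1.congr (by simp) (by simp) (by simp), hst _ (by simp) (by simp) ?_ ?_⟩
        · simp [e3]
        · rintro l h
          rw [e3] at h
          cases h
          simp
      · rw [if_neg hov] at e3
        simp [Stm.den, r1, r2, r3, r4, ht1, hov]
        refine ⟨hq1.congr (by simp) (by simp) (by simp), hst _ (by simp) (by simp) ?_ ?_⟩
        · intro h; simp [r5, hm.none (e3 ▸ h)]
        · intro l h
          have := hm.some l (e3 ▸ h)
          simp [r5, r6, this]
  · rw [← e1, List.take_append_of_le_length le_rfl, List.take_length]

theorem wt_le_range {o : List ℕ} (h : Good n o) : wt nb o ≤ wt nb (List.range n) := by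
  unfold wt
  rw [← List.sum_toFinset _ h.nodup, ← List.sum_toFinset _ List.nodup_range]
  refine Finset.sum_le_sum_of_subset fun v hv => ?_
  simpa using h.lt v (by simpa using hv)

theorem le_wt_range : n ≤ wt nb (List.range n) := by
  have : ∀ l : List ℕ, l.length ≤ wt nb l := by
    intro l
    induction l with
    | nil => simp
    | cons a l ih => simp only [wt, List.map_cons, List.sum_cons, List.length_cons] at *; omega
  simpa using this (List.range n)

theorem sum_wt_ordr (hn : IsNb n nb) {S : List ℕ} (hS : Good n S) : ∀ m ≤ n,
    ∑ v ∈ Finset.range m, (wt nb (ordr nb n S (v + 1)) - wt nb (ordr nb n S v)) +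
      wt nb (ordr nb n S 0) = wt nb (ordr nb n S m) := by
  intro m
  induction m with
  | zero => simp
  | succ m ih =>
    intro hm
    have := wt_prefix (nb := nb) (ordr_prefix_succ hn hS (show m < n from hm))
    rw [Finset.sum_range_succ, ← ih (by omega)] at *
    omega

theorem strt_length_le {S : List ℕ} : ∀ v, (strt nb n S v).length ≤ v
  | 0 => by simp [strt]
  | v + 1 => by
    have := strt_length_le (S := S) v
    rw [strt]
    split_ifs <;> simp <;> omega

/-- Of the earlier queue, only the first |S| cells of `ord` are needed; the marks are cleared and
rebuilt from them. Every vertex and edge is handled a bounded number of times, hence the bound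
linear in the total weight. -/
theorem components_tri (hE : Inp E n nb off) (hb : Base n off σ) {S : List ℕ} (hS : Good n S)
    {q : ℕ} (hs : σ.reg .s = S.length) (hqr : σ.reg .q = q)
    (hord : ∀ i (h : i < S.length), σ.arr .ord i = S[i]) :
    Tri E components σ (400 * wt nb (List.range n) + 100) (fun σ' =>
      Queue n (ordr nb n S n) σ' ∧ Marks (strt nb n S n) (ovf nb n q S n) σ' ∧
      ∀ a ≤ (strt nb n S n).length,
        σ'.arr .start a = bdy (ordr nb n S n) (strt nb n S n) a) := by
  have hN := hE.hn
  have hSl := hS.length_le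
  have hw := le_wt_range (nb := nb) (n := n)
  set Z := wt nb (List.range n) with hZ
  refine Tri.seq (T₁ := 20 * n + 10) (T₂ := 380 * Z + 90)
    (R := fun σ' => ∀ v < n, σ'.arr .mark v = 0) ?_ ?_ (by omega)
  · refine Tri.fors n hb.hn (by omega) (by decide) rfl rfl
      (fun j σ' => ∀ v < j, σ'.arr .mark v = 0) (fun _ => 10) (by simp) ?_
      (by simp; omega) (fun _ _ h => h)
    intro i σ₁ hi h1 h2 hf hI
    refine Tri.block ?_ (by decide) ?_
    · simp [Stm.ok]; omega
    · intro v hv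
      simp [Stm.den, h1, Function.update_apply]
      intro hvi
      exact hI v (by omega)
  intro σ₁ hf1 h0
  refine Tri.seq (T₁ := 30 * n + 10) (T₂ := 350 * Z + 80)
    (R := fun σ' => (∀ i (h : i < S.length), σ'.arr .mark S[i] = i + 1) ∧
      ∀ v < n, v ∉ S → σ'.arr .mark v = 0) ?_ ?_ (by omega)
  · refine Tri.fors S.length ((hf1.1 .s rfl).trans hs) (by omega) (by decide) rfl rfl
      (fun j σ' => (∀ i < j, ∀ (h : i < S.length), σ'.arr .mark S[i] = i + 1) ∧
        ∀ v < n, v ∉ S → σ'.arr .mark v = 0) (fun _ => 20) ?_ ?_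
      (by simp; omega) (fun _ _ h => ⟨fun i hi => h.1 i hi hi, h.2⟩)
    · exact ⟨by simp, fun v hv _ => by simpa using h0 v hv⟩
    intro i σ₂ hi h1 h2 hf hI
    have e : σ₂.arr .ord i = S[i] := by rw [hf.2 .ord rfl, hf1.2 .ord rfl, hord i hi]
    refine Tri.block ?_ (by decide) ?_
    · simp [Stm.ok]; omega
    · simp only [Stm.den, St.setReg_arr, St.setArr_arr, if_true, Ex.eval_add, Ex.eval_var,
        Ex.eval_one, Ex.eval_get, h1, e]
      refine ⟨fun j hj hjl => ?_, fun v hv hvS => ?_⟩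
      · by_cases hji : j = i
        · subst hji; simp
        · rw [Function.update_of_ne, hI.1 j (by omega) hjl]
          exact fun h => hji ((hS.nodup.getElem_inj_iff).1 h)
      · rw [Function.update_of_ne, hI.2 v hv hvS]
        rintro rfl
        exact hvS (List.getElem_mem _)
  intro σ₂ hf2 h2
  have r2 : σ₂.reg .s = S.length := by rw [hf2.1 .s rfl, hf1.1 .s rfl, hs]
  refine Tri.seq (T₁ := 2) (T₂ := 350 * Z + 78) (R := fun σ' => σ' = σ₂.setReg .tail S.length)
    (Tri.block (by simp [Stm.ok]) (by decide) (by simp [Stm.den, r2])) ?_ (by omega)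
  rintro _ - rfl
  refine Tri.seq (T₁ := 2) (T₂ := 350 * Z + 76)
    (R := fun σ' => σ' = (σ₂.setReg .tail S.length).setReg .g 0)
    (Tri.block (by simp [Stm.ok]; omega) (by decide) (by simp [Stm.den])) ?_ (by omega)
  rintro _ - rfl
  refine Tri.seq (T₁ := 2) (T₂ := 350 * Z + 74)
    (R := fun σ' => σ' = ((σ₂.setReg .tail S.length).setReg .g 0).setReg .ov 0)
    (Tri.block (by simp [Stm.ok]; omega) (by decide) (by simp [Stm.den])) ?_ (by omega)
  rintro _ - rfl
  set σ₃ := ((σ₂.setReg .tail S.length).setReg .g 0).setReg .ov 0 with hσ₃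
  have hb3 : Base n off σ₃ := hb.congr
    (by simp [hσ₃]; rw [hf2.1 .n rfl, hf1.1 .n rfl]) (by simp [hσ₃]; rw [hf2.2 .off rfl, hf1.2 .off rfl])
  have hq3 : Queue n S σ₃ := by
    refine ⟨by simp [hσ₃], fun i hi => ?_, fun i hi => ?_, fun v hv hvS => ?_⟩
    · simp [hσ₃]; rw [hf2.2 .ord rfl, hf1.2 .ord rfl, hord i hi]
    · simpa [hσ₃] using h2.1 i hi
    · simpa [hσ₃] using h2.2 v hv hvS
  have hs3 : σ₃.reg .s = S.length := by simp [hσ₃, r2]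
  have hqr3 : σ₃.reg .q = q := by simp [hσ₃]; rw [hf2.1 .q rfl, hf1.1 .q rfl, hqr]
  have hm3 : Marks [] none σ₃ := ⟨by simp [hσ₃], by simp, by simp [hσ₃], by simp⟩
  refine Tri.seq (T₁ := 350 * Z + 10) (T₂ := 64)
    (R := fun σ' => Queue n (ordr nb n S n) σ' ∧ Marks (strt nb n S n) (ovf nb n q S n) σ')
    ?_ ?_ (by omega)
  · refine Tri.fors n hb3.hn (by omega) (by decide) rfl rfl
      (fun v σ' => Queue n (ordr nb n S v) σ' ∧ Marks (strt nb n S v) (ovf nb n q S v) σ')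
      (fun v => 80 * (wt nb (ordr nb n S (v + 1)) - wt nb (ordr nb n S v)) + 130) ?_ ?_ ?_
      (fun _ _ h => h)
    · exact ⟨hq3.congr (by simp) (by simp) (by simp),
        hm3.congr (by simp) (by simp) (by simp) (by simp)⟩
    · rintro v σ₄ hv hvr hnr hf ⟨hq4, hm4⟩
      have hb4 : Base n off σ₄ := hb3.congr (hf.1 .n rfl) (hf.2 .off rfl)
      have hmk := hq4.mark_eq_zero hv
      refine Tri.ite (T₁ := 80 * (wt nb (ordr nb n S (v + 1)) - wt nb (ordr nb n S v)) + 120)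
        (by simp) ?_ ?_ (by simp only [Ex.cost]; omega)
      · intro h
        simp [hvr, hmk] at h
        refine Tri.block (by simp [Stm.ok]) (by simp only [Stm.cost]; omega) ?_
        simp only [Stm.den]
        rw [ordr, strt, ovf, if_pos h, if_pos h, if_pos h]
        exact ⟨hq4.congr (by simp) (by simp) (by simp),
          hm4.congr (by simp) (by simp) (by simp) (by simp)⟩
      · intro h
        simp [hvr, hmk] at h
        refine (growBody_tri hE hb4 hS ((hf.1 .s rfl).trans hs3) ((hf.1 .q rfl).trans hqr3) hv hvr h
          hq4 hm4 (strt_length_le v)).mono le_rfl ?_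
        rintro σ₅ - ⟨a, b⟩
        exact ⟨a.congr (by simp) (by simp) (by simp),
          b.congr (by simp) (by simp) (by simp) (by simp)⟩
    · have h1 := sum_wt_ordr hE.isNb hS n le_rfl
      have h2 := wt_le_range (nb := nb) (ordr_good hE.isNb hS n le_rfl)
      rw [Finset.sum_add_distrib, Finset.sum_add_distrib, ← Finset.mul_sum]
      simp
      omega
  · rintro σ₄ hf ⟨hq4, hm4⟩
    have h1 := hm4.g
    have h2 := hq4.tail
    refine Tri.block (by simp [Stm.ok]) (by decide) ⟨?_, ?_, ?_⟩
    · exact hq4.congr (by simp [Stm.den]) (by simp [Stm.den]) (by simp [Stm.den])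
    · refine ⟨by simpa [Stm.den] using h1, fun a ha => ?_, by simpa [Stm.den] using hm4.none,
        by simpa [Stm.den] using hm4.some⟩
      simp [Stm.den, h1, h2]
      rw [Function.update_of_ne (by omega), hm4.start a ha]
    · intro a ha
      simp [Stm.den, h1, h2]
      rcases ha.lt_or_eq with ha | rfl
      · rw [Function.update_of_ne (by omega), hm4.start a ha, bdy, List.getD_eq_getElem _ _ ha]
      · rw [Function.update_self, bdy_top le_rfl]

end Mach

/-! ### Running through the branching codes and the bounds q -/

namespace Mach

open Grow

/-- Lists the components, and extends the separator if one of them is too large. -/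
def roundBody : Stm :=
  components ;; .act ≔ (Va.ov * Ex.less Va.s Va.q : Ex) ;;
  .ite (Va.act : Ex)
    (.put .ord (Va.s : Ex) (.get .ord (Va.ovst + Va.c % (Va.q + 1 - Va.s) : Ex)) ;;
      .c ≔ (Va.c / (Va.q + 1 - Va.s) : Ex) ;; .s ≔ (Va.s + 1 : Ex)) .skip

/-- Follows the choices given by a code. -/
def codeBody : Stm :=
  .s ≔ 0 ;; .c ≔ (Va.code : Ex) ;; .act ≔ 1 ;; .whl (Va.act : Ex) roundBody ;;
  .fin ≔ Ex.same Va.ov 0 ;; .code ≔ (Va.code + 1 : Ex)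

/-- Tries all codes for the next size. -/
def sizeBody : Stm :=
  .q ≔ (Va.q + 1 : Ex) ;; .M ≔ ((1 : Ex) <<< (Va.q * Va.q : Ex)) ;; .code ≔ 0 ;;
  .whl (Ex.less Va.code Va.M * Ex.same Va.fin 0) codeBody

/-- The search for a separator. -/
def search : Stm :=
  .q ≔ 0 ;; .fin ≔ 0 ;; .whl (Ex.same Va.fin 0) sizeBody

variable {E : Env} {n : ℕ} {nb : ℕ → List ℕ} {off : ℕ → ℕ} {σ : St}

/-- The list of components for the separator `R` has been computed. -/
structure Listed (n : ℕ) (nb : ℕ → List ℕ) (q : ℕ) (R : List ℕ) (σ : St) : Prop where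
  s : σ.reg .s = R.length
  queue : Queue n (ordr nb n R n) σ
  marks : Marks (strt nb n R n) (ovf nb n q R n) σ
  start : ∀ a ≤ (strt nb n R n).length, σ.arr .start a = bdy (ordr nb n R n) (strt nb n R n) a

theorem Listed.congr {q : ℕ} {R : List ℕ} {σ σ' : St} (h : Listed n nb q R σ)
    (hr : ∀ x ∈ [Va.s, .tail, .g, .ov, .ovst], σ'.reg x = σ.reg x)
    (ha : ∀ a ∈ [Ar.start, .ord, .mark], σ'.arr a = σ.arr a) : Listed n nb q R σ' := by
  simp at hr ha
  exact ⟨hr.1.trans h.s, h.queue.congr hr.2.1 ha.2.1 ha.2.2,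
    h.marks.congr hr.2.2.1 ha.1 hr.2.2.2.1 hr.2.2.2.2, fun a h' => by rw [ha.1, h.start a h']⟩

/-- The outcome of an attempt. -/
def Outcome (n : ℕ) (nb : ℕ → List ℕ) (q : ℕ) (res : Option (List ℕ)) (σ : St) : Prop :=
  (res = none → σ.reg .ov = 1) ∧ ∀ R, res = some R → Listed n nb q R σ

/-- One round is one unfolding of `attempt`: either the result is settled, or it equals the result
of the attempt that continues with one unit of fuel less. The fuel is not stored; it is q - |S|, and
its exhaustion is the failure of the test `s < q`. -/
theorem round_tri (hE : Inp E n nb off) (hb : Base n off σ) {q : ℕ} (hqN : q + 1 < E.N)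
    (hqr : σ.reg .q = q) {f c : ℕ} {S : List ℕ} (hf : S.length + f = q) (hS : Good n S)
    (hc : σ.reg .c = c) (hs : σ.reg .s = S.length)
    (hord : ∀ i (h : i < S.length), σ.arr .ord i = S[i]) :
    Tri E roundBody σ (400 * wt nb (List.range n) + 170) (fun σ' =>
      (σ'.reg .act = 0 ∧ Outcome n nb q (attempt nb n q f c S) σ') ∨
      ∃ f' c' S', f = f' + 1 ∧ σ'.reg .act = 1 ∧ S'.length + f' = q ∧ Good n S' ∧
        σ'.reg .c = c' ∧ σ'.reg .s = S'.length ∧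
        (∀ i (h : i < S'.length), σ'.arr .ord i = S'[i]) ∧
        attempt nb n q f c S = attempt nb n q f' c' S') := by
  have hN := hE.hn
  refine Tri.seq (components_tri hE hb hS hs hqr hord) (T₂ := 70) ?_ (by omega)
  rintro σ₁ hf1 ⟨hq1, hm1, hst1⟩
  have r1 : σ₁.reg .s = S.length := (hf1.1 .s rfl).trans hs
  have r2 : σ₁.reg .q = q := (hf1.1 .q rfl).trans hqr
  have r3 : σ₁.reg .c = c := (hf1.1 .c rfl).trans hc
  cases ho : ovf nb n q S n with
  | none =>
    have h0 := hm1.none ho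
    refine Tri.block (by simp [Stm.ok, Stm.den, h0]; omega) (by decide) (Or.inl ?_)
    simp [Stm.den, h0]
    refine ⟨fun h => ?_, fun R h => ?_⟩
    · cases f <;> simp [attempt, ho] at h
    · have : S = R := by cases f <;> simpa [attempt, ho] using h
      subst this
      refine (Listed.mk r1 hq1 hm1 hst1).congr ?_ ?_ <;> simp
  | some l =>
    obtain ⟨h1, h2⟩ := hm1.some l ho
    cases f with
    | zero =>
      simp at hf
      refine Tri.block (by simp [Stm.ok, Stm.den, h1, r1, r2, hf]; omega) (by decide) (Or.inl ?_)
      simp [Stm.den, h1, r1, r2, hf]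
      refine ⟨fun h => ?_, fun R h => ?_⟩
      · simp [h1]
      · simp [attempt, ho] at h
    | succ f =>
      have hlt : S.length < q := by omega
      have hm := Nat.mod_lt c (show q + 1 - S.length > 0 by omega)
      obtain ⟨hln, hg'⟩ := pick_good hE.isNb hS ho (by omega) hm
      have hol := ordr_length hE.isNb hS
      have hget := hq1.ord (l + c % (q + 1 - S.length)) (by omega)
      have hsl := hS.length_le
      refine Tri.block ?_ (by decide) (Or.inr ?_)
      · simp [Stm.ok, Stm.den, h1, h2, r1, r2, r3, hlt]; omega
      · refine ⟨f, c / (q + 1 - S.length), _, rfl, ?_, ?_, hg', ?_, ?_, ?_, ?_⟩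
        · simp [Stm.den, h1, h2, r1, r2, r3, hlt]
        · simp; omega
        · simp [Stm.den, h1, h2, r1, r2, r3, hlt]
        · simp [Stm.den, h1, h2, r1, r2, r3, hlt]
        · intro i hi
          simp [Stm.den, h1, h2, r1, r2, r3, hlt, hget, Function.update_apply]
          split_ifs with his
          · subst his
            simp
            rw [← List.getD_eq_getElem _ 0, List.getD_eq_getElem?_getD]
          · simp at hi
            rw [hq1.ord i (by omega), List.getElem_append_left (by omega)]
            -- The component listing keeps `S` as its beginning, so overwriting cell |S| extends the
            -- separator in place.
            have hp : S <+: ordr nb n S n := ordr_prefix hE.isNb hS (Nat.zero_le n) le_rfl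
            exact (hp.getElem _).symm
        · simp only [attempt, ho]

theorem rounds_tri (hE : Inp E n nb off) (hb : Base n off σ) {q : ℕ} (hqN : q + 1 < E.N)
    (hqr : σ.reg .q = q) {c : ℕ} (hc : σ.reg .c = c) (hs : σ.reg .s = 0) (hact : σ.reg .act = 1) :
    Tri E (.whl (Va.act : Ex) roundBody) σ
      ((q + 1) * (400 * wt nb (List.range n) + 200) + 10)
      (Outcome n nb q (attempt nb n q q c [])) := by
  set K := 400 * wt nb (List.range n) + 200 with hK
  refine Tri.whl (fun m σ' => (σ'.reg .act = 0 ∧ Outcome n nb q (attempt nb n q q c []) σ') ∨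
      ∃ f' c' S', m = (f' + 1) * K ∧ σ'.reg .act = 1 ∧ S'.length + f' = q ∧ Good n S' ∧
        σ'.reg .c = c' ∧ σ'.reg .s = S'.length ∧
        (∀ i (h : i < S'.length), σ'.arr .ord i = S'[i]) ∧
        attempt nb n q q c [] = attempt nb n q f' c' S') (by simp) ?_ (m := (q + 1) * K) ?_
      (by simp only [Ex.cost]; omega) ?_
  · rintro m σ₁ (⟨h, -⟩ | ⟨f, c', S, rfl, hact, hfq, hS, hc1, hs1, hord, hatt⟩) hfr hne
    · simp [h] at hne
    · have hr := round_tri hE (hb.congr (hfr.1 .n rfl) (hfr.2 .off rfl)) hqN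
        ((hfr.1 .q rfl).trans hqr) hfq hS hc1 hs1 hord
      refine ⟨f * K, _, ?_, hr.mono le_rfl ?_⟩
      · simp only [Ex.cost]; rw [add_one_mul]; omega
      · rintro σ' - (⟨h1, h2⟩ | ⟨f', c'', S', rfl, h1, h2, h3, h4, h5, h6, h7⟩)
        · exact Or.inl ⟨h1, hatt ▸ h2⟩
        · exact Or.inr ⟨f', c'', S', rfl, h1, h2, h3, h4, h5, h6, hatt.trans h7⟩
  · exact Or.inr ⟨q, c, [], rfl, hact, by simp, ⟨List.nodup_nil, by simp⟩, hc, by simpa using hs,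
      by simp, rfl⟩
  · rintro m σ' (⟨-, h⟩ | ⟨f, c', S, rfl, hact, -⟩) - h0
    · exact h
    · simp [hact] at h0

/-- A separator has been found. -/
structure Found (n : ℕ) (nb : ℕ → List ℕ) (q : ℕ) (σ : St) (R : List ℕ) : Prop where
  fin : σ.reg .fin = 1
  qv : σ.reg .q = q
  M : σ.reg .M = 2 ^ (q * q)
  good : Good n R
  le : R.length ≤ q
  ovf : ovf nb n q R n = none
  listed : Listed n nb q R σ

/-- The invariant keeps either a separator already found or the failure of all codes tried so far;
exhausting the codes thus proves that every code fails. -/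
theorem codes_tri (hE : Inp E n nb off) (hb : Base n off σ) {q : ℕ} (hqN : q + 1 < E.N)
    (hqr : σ.reg .q = q) (hMN : 2 ^ (q * q) < E.N) (hM : σ.reg .M = 2 ^ (q * q))
    (hcode : σ.reg .code = 0) (hfin : σ.reg .fin = 0) :
    Tri E (.whl (Ex.less Va.code Va.M * Ex.same Va.fin 0) codeBody) σ
      (2 ^ (q * q) * ((q + 1) * (400 * wt nb (List.range n) + 200) + 50) + 10) (fun σ' =>
        (∃ R, Found n nb q σ' R) ∨
        σ'.reg .fin = 0 ∧ ∀ c < 2 ^ (q * q), attempt nb n q q c [] = none) := by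
  set K := (q + 1) * (400 * wt nb (List.range n) + 200) + 50 with hK
  have hcost : 2 ^ (q * q) * K + (Ex.less Va.code Va.M * Ex.same Va.fin 0).cost + 1 ≤
      2 ^ (q * q) * K + 10 := by
    have : (Ex.less Va.code Va.M * Ex.same Va.fin 0).cost = 7 := rfl
    omega
  refine Tri.whl (fun m σ' => (∃ R, Found n nb q σ' R) ∨
      ∃ i ≤ 2 ^ (q * q), m = (2 ^ (q * q) - i) * K ∧ σ'.reg .code = i ∧ σ'.reg .fin = 0 ∧
        ∀ c < i, attempt nb n q q c [] = none) ?_ ?_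
      (m := 2 ^ (q * q) * K) (Or.inr ⟨0, by simp, by simp, hcode, hfin, by simp⟩)
      hcost ?_
  · rintro m σ₁ (⟨R, h⟩ | ⟨i, hi, rfl, h1, h2, h3⟩)
    · simp [h.fin, h.M]
      omega
    · simp [h1, h2]
      split_ifs <;> omega
  · rintro m σ₁ (⟨R, h⟩ | ⟨i, hi, rfl, hi1, hf1, hall⟩) hfr hne
    · simp [h.fin] at hne
    have hMr : σ₁.reg .M = 2 ^ (q * q) := (hfr.1 .M rfl).trans hM
    have hlt : i < 2 ^ (q * q) := by
      by_contra hc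
      simp [hi1, hMr, hc] at hne
    have hq1 : σ₁.reg .q = q := (hfr.1 .q rfl).trans hqr
    have hb1 : Base n off σ₁ := hb.congr (hfr.1 .n rfl) (hfr.2 .off rfl)
    refine ⟨(2 ^ (q * q) - (i + 1)) * K, K - 10, ?_, ?_⟩
    · simp only [Ex.less, Ex.same, Ex.cost]
      have : 2 ^ (q * q) - i = 2 ^ (q * q) - (i + 1) + 1 := by omega
      rw [this, add_one_mul]
      omega
    refine Tri.seq (T₁ := 2) (T₂ := K - 12) (R := fun σ' => σ' = σ₁.setReg .s 0)
      (Tri.block (by simp [Stm.ok]; omega) (by decide) (by simp [Stm.den])) ?_ (by omega)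
    rintro _ - rfl
    refine Tri.seq (T₁ := 2) (T₂ := K - 14) (R := fun σ' => σ' = (σ₁.setReg .s 0).setReg .c i)
      (Tri.block (by simp [Stm.ok]) (by decide) (by simp [Stm.den, hi1])) ?_ (by omega)
    rintro _ - rfl
    refine Tri.seq (T₁ := 2) (T₂ := K - 16)
      (R := fun σ' => σ' = ((σ₁.setReg .s 0).setReg .c i).setReg .act 1)
      (Tri.block (by simp [Stm.ok]; omega) (by decide) (by simp [Stm.den])) ?_ (by omega)
    rintro _ - rfl
    refine Tri.seq (rounds_tri hE (hb1.congr (by simp) (by simp)) hqN (by simp [hq1]) (c := i)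
      (by simp) (by simp) (by simp)) (T₂ := 20) ?_ (by omega)
    rintro σ₂ hf2 hout
    have g1 : σ₂.reg .code = i := by rw [hf2.1 .code rfl]; simp [hi1]
    have g2 : σ₂.reg .M = 2 ^ (q * q) := by rw [hf2.1 .M rfl]; simp [hMr]
    have g3 : σ₂.reg .q = q := by rw [hf2.1 .q rfl]; simp [hq1]
    refine Tri.block (by simp [Stm.ok, Stm.den, g1]; omega) (by decide) ?_
    cases ha : attempt nb n q q i [] with
    | none =>
      have := hout.1 ha
      refine Or.inr ⟨i + 1, hlt, rfl, by simp [Stm.den, g1], by simp [Stm.den, this], ?_⟩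
      intro c hc
      rcases Nat.lt_succ_iff_lt_or_eq.1 hc with hc | rfl
      · exact hall c hc
      · exact ha
    | some R =>
      have hl := hout.2 R ha
      obtain ⟨k1, k2, k3⟩ := attempt_spec hE.isNb q i [] R ⟨List.nodup_nil, by simp⟩ (by simp) ha
      refine Or.inl ⟨R, ?_, by simp [Stm.den, g3], by simp [Stm.den, g2], k1, k2, k3, ?_⟩
      · simp [Stm.den, hl.marks.none k3]
      · refine hl.congr ?_ ?_ <;> simp [Stm.den]
  · rintro m σ' (h | ⟨i, hi, rfl, hi1, hf1, hall⟩) hfr h0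
    · exact Or.inl h
    · refine Or.inr ⟨hf1, ?_⟩
      have hMr : σ'.reg .M = 2 ^ (q * q) := (hfr.1 .M rfl).trans hM
      simp [hi1, hMr, hf1] at h0
      exact fun c hc => hall c (by omega)

/-- The hypothetical separator `T` serves only to bound the running time: the search ends at `q = p`
at the latest. Success at a smaller bound would be equally useful. Each bound q ≤ p is charged the
cost for `p`, which adds a factor `p`. -/
theorem search_tri (hE : Inp E n nb off) (hb : Base n off σ) {p : ℕ} {T : Finset ℕ}
    (hT : Separator n p nb T) (hN : 2 ^ (p * p) < E.N) (hpN : p + 1 < E.N) :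
    Tri E search σ
      (p * (2 ^ (p * p) * ((p + 1) * (400 * wt nb (List.range n) + 200) + 50) + 50) + 20)
      (fun σ' => ∃ q ≤ p, 0 < q ∧ ∃ R, Found n nb q σ' R) := by
  have hp0 : 0 < p := (Nat.zero_le _).trans_lt hT.card
  have hpos : 0 < 2 ^ (p * p) := by positivity
  set K := 2 ^ (p * p) * ((p + 1) * (400 * wt nb (List.range n) + 200) + 50) + 50 with hK
  clear_value K
  refine Tri.seq (T₁ := 2) (R := fun σ' => σ' = σ.setReg .q 0)
    (Tri.block (by simp [Stm.ok]; omega) (by decide) (by simp [Stm.den])) ?_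
    (show 2 + (p * K + 18) ≤ _ by omega)
  rintro _ - rfl
  refine Tri.seq (T₁ := 2) (R := fun σ' => σ' = (σ.setReg .q 0).setReg .fin 0)
    (Tri.block (by simp [Stm.ok]; omega) (by decide) (by simp [Stm.den])) ?_
    (show 2 + (p * K + 16) ≤ _ by omega)
  rintro _ - rfl
  refine Tri.whl (fun m σ' => (∃ q ≤ p, 0 < q ∧ ∃ R, Found n nb q σ' R) ∨
      ∃ q < p, σ'.reg .q = q ∧ σ'.reg .fin = 0 ∧ m = (p - q) * K) ?_ ?_ (m := p * K)
      (Or.inr ⟨0, hp0, by simp, by simp, by simp⟩) (by simp only [Ex.same, Ex.cost]; omega) ?_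
  · rintro m σ₁ _
    simp; omega
  · rintro m σ₁ (⟨q, -, -, R, h⟩ | ⟨q, hq, hqr, hfin, rfl⟩) hfr hne
    · simp [h.fin] at hne
    have hb1 : Base n off σ₁ := hb.congr (by rw [hfr.1 .n rfl]; simp)
      (by rw [hfr.2 .off rfl]; simp)
    have hqp : (q + 1) * (q + 1) ≤ p * p := Nat.mul_le_mul hq hq
    have h2 : 2 ^ ((q + 1) * (q + 1)) ≤ 2 ^ (p * p) := Nat.pow_le_pow_right (by norm_num) hqp
    have hlt2 : (q + 1) * (q + 1) < 2 ^ ((q + 1) * (q + 1)) := Nat.lt_two_pow_self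
    have hKq : 2 ^ ((q + 1) * (q + 1)) * ((q + 1 + 1) * (400 * wt nb (List.range n) + 200) + 50)
        + 50 ≤ K := by
      rw [hK]
      gcongr; omega
    refine ⟨(p - (q + 1)) * K, K - 10, ?_, ?_⟩
    · simp only [Ex.same, Ex.cost]
      have : p - q = p - (q + 1) + 1 := by omega
      rw [this, add_one_mul]
      omega
    refine Tri.seq (T₁ := 4) (T₂ := K - 14) (R := fun σ' => σ' = σ₁.setReg .q (q + 1))
      (Tri.block (by simp [Stm.ok, hqr]; omega) (by decide) (by simp [Stm.den, hqr])) ?_ (by omega)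
    rintro _ - rfl
    refine Tri.seq (T₁ := 6) (T₂ := K - 20)
      (R := fun σ' => σ' = (σ₁.setReg .q (q + 1)).setReg .M (2 ^ ((q + 1) * (q + 1))))
      (Tri.block ?_ (by decide) (by simp [Stm.den, Nat.shiftLeft_eq])) ?_ (by omega)
    · simp [Stm.ok, Nat.shiftLeft_eq]
      omega
    rintro _ - rfl
    refine Tri.seq (T₁ := 2) (T₂ := K - 22) (R := fun σ' => σ' =
        ((σ₁.setReg .q (q + 1)).setReg .M (2 ^ ((q + 1) * (q + 1)))).setReg .code 0)
      (Tri.block (by simp [Stm.ok]; omega) (by decide) (by simp [Stm.den])) ?_ (by omega)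
    rintro _ - rfl
    set σ₂ := ((σ₁.setReg .q (q + 1)).setReg .M (2 ^ ((q + 1) * (q + 1)))).setReg .code 0 with hσ₂
    have hb2 : Base n off σ₂ := hb1.congr (by simp [hσ₂]) (by simp [hσ₂])
    have a1 : σ₂.reg .q = q + 1 := by simp [hσ₂]
    have a2 : σ₂.reg .M = 2 ^ ((q + 1) * (q + 1)) := by simp [hσ₂]
    have a3 : σ₂.reg .code = 0 := by simp [hσ₂]
    have a4 : σ₂.reg .fin = 0 := by simp [hσ₂, hfin]
    clear_value σ₂
    have hq1 : q + 1 + 1 < E.N := by omega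
    have hq2 : 2 ^ ((q + 1) * (q + 1)) < E.N := by omega
    have hle : 2 ^ ((q + 1) * (q + 1)) * ((q + 1 + 1) * (400 * wt nb (List.range n) + 200) + 50)
        + 10 ≤ K - 22 := by
      generalize 2 ^ ((q + 1) * (q + 1)) * ((q + 1 + 1) * (400 * wt nb (List.range n) + 200) + 50)
        = X at hKq ⊢
      omega
    have := codes_tri hE hb2 hq1 a1 hq2 a2 a3 a4
    refine Tri.mono this hle ?_
    rintro σ' hfr' (⟨R, h⟩ | ⟨h0, hall⟩)
    · exact Or.inl ⟨q + 1, hq, by omega, R, h⟩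
    · refine Or.inr ⟨q + 1, ?_, ?_, h0, rfl⟩
      · rcases Nat.lt_or_eq_of_le (show q + 1 ≤ p from hq) with h | h
        · exact h
        -- The bound `p` itself cannot fail, because `exists_attempt` provides a successful code.
        · exfalso
          subst h
          obtain ⟨c, hc, hne⟩ := exists_attempt hE.isNb hT (q + 1) [] ⟨List.nodup_nil, by simp⟩
            (by simp) (by simp)
          exact hne (hall c hc)
      · rw [hfr'.1 .q rfl, a1]
  · rintro m σ' (h | ⟨q, hq, hqr, hfin, rfl⟩) - h0
    · exact h
    · simp [hfin] at h0

end Mach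

/-! ## The contribution of a group of vertices -/

namespace Mach

open Grow

/-- The colour of the vertex in position `pos`. -/
def colorCode (dst pos : Va) : Stm :=
  .ite (Ex.less pos Va.s) (dst ≔ (((Va.sc : Ex) >>> (Va.q * pos : Ex)) % (Va.k : Ex)))
    (dst ≔ (((Va.hc : Ex) >>> (Va.q * (pos - Va.ga) : Ex)) % (Va.k : Ex)))

/-- The vertex of the group in position `r` and its own colour. -/
def effHead : Stm :=
  .i ≔ (Va.ga + Va.r : Ex) ;; .v ≔ .get .ord (Va.i : Ex) ;; colorCode .ci .i ;;
  .m ≔ ((1 : Ex) <<< (Va.ci : Ex)) ;;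
  .ite (Ex.less Va.i Va.s) (.e ≔ ((Va.e : Ex) ||| ((1 : Ex) <<< (Va.i * Va.q + Va.ci : Ex)))) .skip ;;
  .o ≔ .get .off (Va.v : Ex) ;; .d ≔ .inp (Va.o : Ex)

/-- The contribution of a neighbour. -/
def effNbr : Stm :=
  .pu ≔ (.get .mark (.inp (Va.o + 1 + Va.j : Ex)) - 1 : Ex) ;;
  .ite (Ex.less Va.pu Va.gb)
    (colorCode .cu .pu ;; .ite (Ex.same Va.cu Va.ci) (.bad ≔ 1) .skip ;;
      .m ≔ ((Va.m : Ex) ||| ((1 : Ex) <<< (Va.cu : Ex))) ;;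
      .ite (Ex.less Va.pu Va.s)
        (.e ≔ ((Va.e : Ex) ||| ((1 : Ex) <<< (Va.pu * Va.q + Va.ci : Ex)))) .skip)
    .skip

/-- Records a vertex that sees all colours. -/
def effTail : Stm :=
  .ite (Ex.same ((Va.m : Ex) &&& (Va.full : Ex)) Va.full)
    (.e ≔ ((Va.e : Ex) ||| ((1 : Ex) <<< (Va.q * Va.q + Va.ci : Ex)))) .skip

/-- The contribution of the vertices in the positions from `ga` to `gb - 1`. -/
def effect : Stm :=
  (.bad ≔ 0 ;; .e ≔ 0 ;; .len ≔ (Va.gb - Va.ga : Ex)) ;;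
  .fors .r .len (effHead ;; .fors .j .d effNbr ;; effTail)

/-- The colour of position `i` under the colour codes `sc` and `hc`. -/
def colr (q k s sc ga hc i : ℕ) : ℕ :=
  if i < s then (sc >>> (q * i)) % k else (hc >>> (q * (i - ga))) % k

/-- The positions of the neighbours of the vertex in position `i`. -/
def pnb (nb : ℕ → List ℕ) (o : List ℕ) (i : ℕ) : List ℕ := (nb (o.getD i 0)).map fun u => o.idxOf u

/-- The vertex in position `i` sees the colour `c` among the positions below `l`. -/
def Sees (pn : ℕ → List ℕ) (χ : ℕ → ℕ) (l i c : ℕ) : Prop :=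
  c = χ i ∨ ∃ j ∈ pn i, j < l ∧ c = χ j

/-- The vertex in position `i` has a neighbour of its colour among the positions below `l`. -/
def Clash (pn : ℕ → List ℕ) (χ : ℕ → ℕ) (l i : ℕ) : Prop := ∃ j ∈ pn i, j < l ∧ χ j = χ i

/-- The bits contributed by the vertex in position `i`. -/
def Fact (pn : ℕ → List ℕ) (χ : ℕ → ℕ) (q k s l i b : ℕ) : Prop :=
  (i < s ∧ b = i * q + χ i) ∨ (∃ j ∈ pn i, (j < l ∧ j < s) ∧ b = j * q + χ i) ∨
    (b = q * q + χ i ∧ ∀ c < k, Sees pn χ l i c)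

/-- The parameters of the dynamic program. -/
structure Pars where
  n : ℕ
  k : ℕ
  q : ℕ
  s : ℕ
  nb : ℕ → List ℕ
  off : ℕ → ℕ
  o : List ℕ

/-- The numerical constraints on the parameters. -/
structure Pars.Ok (p : Pars) (E : Env) : Prop where
  inp : Inp E p.n p.nb p.off
  good : Good p.n p.o
  len : p.o.length = p.n
  k0 : 0 < p.k
  kq : p.k ≤ p.q
  sq : p.s ≤ p.q
  sn : p.s ≤ p.n
  qn : p.q * p.n + p.n < E.N
  pow : 2 ^ (p.q * p.q + p.q + p.q) < E.N

/-- The variables that do not change during the dynamic program. -/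
structure DP (p : Pars) (σ : St) : Prop where
  base : Base p.n p.off σ
  queue : Queue p.n p.o σ
  k : σ.reg .k = p.k
  qv : σ.reg .q = p.q
  s : σ.reg .s = p.s
  full : σ.reg .full = 2 ^ p.k - 1

/-- The variables of `DP`. -/
def dpRegs : List Va := [.n, .tail, .k, .q, .s, .full]
/-- The arrays of `DP`. -/
def dpArrs : List Ar := [.off, .ord, .mark]

theorem DP.congr {p : Pars} {σ σ' : St} (h : DP p σ) (hr : ∀ x ∈ dpRegs, σ'.reg x = σ.reg x)
    (ha : ∀ a ∈ dpArrs, σ'.arr a = σ.arr a) : DP p σ' := by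
  have r1 := hr .n (by decide)
  have r2 := hr .tail (by decide)
  have r3 := hr .k (by decide)
  have r4 := hr .q (by decide)
  have r5 := hr .s (by decide)
  have r6 := hr .full (by decide)
  have a1 := ha .off (by decide)
  have a2 := ha .ord (by decide)
  have a3 := ha .mark (by decide)
  exact ⟨h.base.congr r1 a1, h.queue.congr r2 a2 a3, r3.trans h.k, r4.trans h.qv, r5.trans h.s,
    r6.trans h.full⟩

theorem Fr.dp {p : Pars} {P : Stm} {σ σ' : St} (hf : Fr P σ σ') (h : DP p σ)
    (hr : ∀ x ∈ dpRegs, P.wr x = false) (ha : ∀ a ∈ dpArrs, P.wa a = false) : DP p σ' :=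
  h.congr (fun x hx => hf.1 x (hr x hx)) fun a h' => hf.2 a (ha a h')

theorem DP.setReg {p : Pars} {σ : St} (h : DP p σ) {x : Va} {a : ℕ} (hx : x ∉ dpRegs) :
    DP p (σ.setReg x a) :=
  h.congr (fun y hy => by rw [St.setReg_reg, if_neg]; rintro rfl; exact hx hy) fun _ _ => rfl

/-- The colour codes and the group. -/
structure Cols (sc ga gb hc : ℕ) (σ : St) : Prop where
  sc : σ.reg .sc = sc
  ga : σ.reg .ga = ga
  gb : σ.reg .gb = gb
  hc : σ.reg .hc = hc

variable {E : Env} {p : Pars} {σ : St} {sc ga gb hc : ℕ}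

theorem two_pow_lt {a b N : ℕ} (h : 2 ^ b < N) (hab : a ≤ b) : 2 ^ a < N :=
  (Nat.pow_le_pow_right (by norm_num) hab).trans_lt h

theorem colr_lt (hk : 0 < p.k) (i : ℕ) : colr p.q p.k p.s sc ga hc i < p.k := by
  unfold colr
  split_ifs <;> exact Nat.mod_lt _ hk

theorem colorCode_den (hd : DP p σ) (hc' : Cols sc ga gb hc σ) {dst pos : Va} {i : ℕ}
    (hi : σ.reg pos = i) :
    (colorCode dst pos).den E σ = σ.setReg dst (colr p.q p.k p.s sc ga hc i) := by
  have h1 := hd.s; have h2 := hd.qv; have h3 := hd.k; have h4 := hc'.sc; have h5 := hc'.hc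
  have h6 := hc'.ga
  by_cases h : i < p.s
  · simp only [colorCode, Stm.den, Ex.eval_less, Ex.eval_var, Ex.eval_mod, Ex.eval_shr,
      Ex.eval_mul, Ex.eval_sub, h1, h2, h3, h4, h5, h6, hi, colr, if_pos h, ne_eq, one_ne_zero,
      not_false_eq_true, if_true]
  · simp only [colorCode, Stm.den, Ex.eval_less, Ex.eval_var, Ex.eval_mod, Ex.eval_shr,
      Ex.eval_mul, Ex.eval_sub, h1, h2, h3, h4, h5, h6, hi, colr, if_neg h, ne_eq,
      not_true_eq_false, if_false]

theorem colorCode_ok (hp : p.Ok E) (hd : DP p σ) (hc' : Cols sc ga gb hc σ) {dst pos : Va} {i : ℕ}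
    (hi : σ.reg pos = i) (hin : i < p.n) : (colorCode dst pos).ok E σ := by
  have h1 := hd.s; have h2 := hd.qv; have h3 := hd.k; have h4 := hc'.sc; have h5 := hc'.hc
  have h6 := hc'.ga
  have := hp.qn
  have h7 : p.q * i ≤ p.q * p.n := Nat.mul_le_mul_left _ hin.le
  have h8 : p.q * (i - ga) ≤ p.q * p.n := Nat.mul_le_mul_left _ (by omega)
  simp only [colorCode, Stm.ok, Ex.safe_less, Ex.safe_var, Ex.safe_mod, Ex.safe_shr, Ex.safe_mul,
    Ex.safe_sub, Ex.eval_var, Ex.eval_sub, h2, h6, hi, true_and, and_true]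
  exact ⟨fun _ => by omega, fun _ => by omega⟩

theorem testBit_or_shift (e b c : ℕ) :
    (e ||| (1 <<< b)).testBit c = true ↔ e.testBit c = true ∨ c = b := by
  rw [Nat.testBit_or, Nat.one_shiftLeft, Nat.testBit_two_pow]
  simp only [Bool.or_eq_true, decide_eq_true_eq, @eq_comm _ b c]

theorem and_full_iff (m k : ℕ) : m &&& (2 ^ k - 1) = 2 ^ k - 1 ↔ ∀ c < k, m.testBit c = true := by
  constructor
  · intro h c hc
    have := congrArg (fun x => x.testBit c) h
    simpa [Nat.testBit_and, Nat.testBit_two_pow_sub_one, hc] using this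
  · intro h
    apply Nat.eq_of_testBit_eq
    intro c
    rw [Nat.testBit_and, Nat.testBit_two_pow_sub_one]
    by_cases hc : c < k
    · simp [hc, h c hc]
    · simp [hc]

theorem exists_mem_take_succ {l : List ℕ} {j : ℕ} (hj : j < l.length) (P : ℕ → Prop) :
    (∃ x ∈ l.take (j + 1), P x) ↔ (∃ x ∈ l.take j, P x) ∨ P l[j] := by
  rw [List.take_succ_eq_append_getElem hj]
  simp only [List.mem_append, List.mem_singleton, or_and_right, exists_or, exists_eq_left]

/-- The part of `effNbr` that follows the computation of the colour. -/
def effNbrEnd : Stm :=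
  .ite (Ex.same Va.cu Va.ci) (.bad ≔ 1) .skip ;;
    .m ≔ ((Va.m : Ex) ||| ((1 : Ex) <<< (Va.cu : Ex))) ;;
    .ite (Ex.less Va.pu Va.s)
      (.e ≔ ((Va.e : Ex) ||| ((1 : Ex) <<< (Va.pu * Va.q + Va.ci : Ex)))) .skip

theorem effNbrEnd_tri {u a c q s : ℕ} (h1 : σ.reg .pu = u) (h2 : σ.reg .cu = a)
    (h3 : σ.reg .ci = c) (h4 : σ.reg .q = q) (h5 : σ.reg .s = s) (p1 : 2 ^ a < E.N)
    (p2 : u < s → 2 ^ (u * q + c) < E.N) :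
    Tri E effNbrEnd σ 45 (fun σ' =>
      (σ'.reg .bad ≠ 0 ↔ σ.reg .bad ≠ 0 ∨ a = c) ∧
      (∀ x, (σ'.reg .m).testBit x = true ↔ (σ.reg .m).testBit x = true ∨ x = a) ∧
      (∀ b, (σ'.reg .e).testBit b = true ↔ (σ.reg .e).testBit b = true ∨
        (u < s ∧ b = u * q + c))) := by
  have p0 : 1 < E.N := Nat.one_le_two_pow.trans_lt p1
  have p3 : u < s → u * q + c < E.N := fun h => Nat.lt_two_pow_self.trans (p2 h)
  have p4 : u < s → u * q < E.N := fun h => (Nat.le_add_right _ _).trans_lt (p3 h)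
  refine Tri.block ?_ (by decide) ?_
  · rcases eq_or_ne a c with rfl | hac <;> by_cases hus : u < s <;>
      simp only [effNbrEnd, Stm.ok, Stm.den, Ex.safe_same, Ex.safe_less, Ex.safe_var, Ex.safe_one,
        Ex.safe_or, Ex.safe_shl, Ex.safe_add, Ex.safe_mul, Ex.eval_same, Ex.eval_less, Ex.eval_var,
        Ex.eval_one, Ex.eval_add, Ex.eval_mul, *, if_true, if_false,
        ne_eq, one_ne_zero, not_false_eq_true, not_true_eq_false, St.setReg_reg, reduceCtorEq,
        Nat.one_shiftLeft, true_and, true_implies, false_implies,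
        and_self]
  · by_cases hac : a = c <;> by_cases hus : u < s <;>
      simp [effNbrEnd, Stm.den, h1, h2, h3, h4, h5, hac, hus, testBit_or_shift, -Nat.testBit_or,
        -Nat.testBit_shiftLeft]

theorem effNbr_tri (hp : p.Ok E) (hd : DP p σ) (hco : Cols sc ga gb hc σ) {i j : ℕ}
    (hi : i < p.n) (ho : σ.reg .o = p.off (p.o.getD i 0)) (hj : σ.reg .j = j)
    (hjl : j < (pnb p.nb p.o i).length)
    (hci : σ.reg .ci = colr p.q p.k p.s sc ga hc i) :
    let χ := colr p.q p.k p.s sc ga hc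
    let u := (pnb p.nb p.o i)[j]
    Tri E effNbr σ 90 (fun σ' =>
      (σ'.reg .bad ≠ 0 ↔ σ.reg .bad ≠ 0 ∨ (u < gb ∧ χ u = χ i)) ∧
      (∀ c, (σ'.reg .m).testBit c = true ↔ (σ.reg .m).testBit c = true ∨ (u < gb ∧ c = χ u)) ∧
      (∀ b, (σ'.reg .e).testBit b = true ↔ (σ.reg .e).testBit b = true ∨
        ((u < gb ∧ u < p.s) ∧ b = u * p.q + χ i))) := by
  intro χ u
  have hE := hp.inp
  have hlen := hp.len
  have hvi : p.o.getD i 0 < p.n := by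
    rw [List.getD_eq_getElem _ _ (by omega)]; exact hp.good.lt _ (List.getElem_mem _)
  have hjl' : j < (p.nb (p.o.getD i 0)).length := by simpa [pnb] using hjl
  have hent := hE.ent _ hvi j hjl'
  have hlim := hE.lim _ hvi
  have hL := hE.hL
  have hN := hE.hn
  set w := (p.nb (p.o.getD i 0))[j] with hw
  have hwn : w < p.n := hE.isNb.lt _ _ (List.getElem_mem _)
  have hu : u = p.o.idxOf w := by simp [u, pnb, hw]
  have hwo : w ∈ p.o := by
    by_contra hno
    have := (hp.good.snoc hwn hno).length_le
    simp at this
    omega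
  have hul : u < p.o.length := by rw [hu]; exact List.idxOf_lt_length_iff.2 hwo
  have hou : p.o[u] = w := by simp [hu]
  -- The mark minus one is the position of the neighbour, so the input lists can be read as
  -- adjacency of positions.
  have hmark : σ.arr .mark w = u + 1 := by rw [← hou, hd.queue.mark u hul]
  have hχ := colr_lt (p := p) (sc := sc) (ga := ga) (hc := hc) hp.k0
  have hχi : χ i < p.k := hχ i
  have hχu : χ u < p.k := hχ u
  have hpow := hp.pow
  have hkq := hp.kq
  have hsq := hp.sq
  have e1 := hco.gb
  have p1 : 2 ^ χ u < E.N := two_pow_lt hpow (by omega)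
  have p2 : u < p.s → 2 ^ (u * p.q + χ i) < E.N := by
    intro h
    refine two_pow_lt hpow ?_
    have : u * p.q ≤ p.q * p.q := Nat.mul_le_mul_right _ (by omega)
    omega
  have p3 : u < p.s → u * p.q + χ i < E.N := fun h => Nat.lt_two_pow_self.trans (p2 h)
  have hmodulo : ∀ σ' : St, σ' = σ.setReg .pu u → Tri E
      (.ite (Ex.less Va.pu Va.gb)
        (colorCode .cu .pu ;; effNbrEnd)
        .skip) σ' 70 (fun σ' =>
      (σ'.reg .bad ≠ 0 ↔ σ.reg .bad ≠ 0 ∨ (u < gb ∧ χ u = χ i)) ∧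
      (∀ c, (σ'.reg .m).testBit c = true ↔ (σ.reg .m).testBit c = true ∨ (u < gb ∧ c = χ u)) ∧
      (∀ b, (σ'.reg .e).testBit b = true ↔ (σ.reg .e).testBit b = true ∨
        ((u < gb ∧ u < p.s) ∧ b = u * p.q + χ i))) := by
    rintro σ' rfl
    refine Tri.ite (T₁ := 66) (by simp) ?_ ?_ (by decide)
    · intro h
      have hgb : u < gb := by simpa [e1] using h
      have hd' := hd.setReg (x := .pu) (a := u) (by decide)
      have hco' : Cols sc ga gb hc (σ.setReg .pu u) :=
        ⟨by simp [hco.sc], by simp [hco.ga], by simp [hco.gb], by simp [hco.hc]⟩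
      have hpu : (σ.setReg .pu u).reg .pu = u := by simp
      refine Tri.seq (T₁ := 20) (T₂ := 46)
        (R := fun σ'' => σ'' = (σ.setReg .pu u).setReg .cu (χ u))
        (Tri.block (colorCode_ok hp hd' hco' hpu (by omega)) (by decide)
          (colorCode_den hd' hco' hpu)) ?_ le_rfl
      rintro _ - rfl
      refine (effNbrEnd_tri (by simp) (by simp) (c := χ i) (by simpa using hci)
        (by simpa using hd.qv) (by simpa using hd.s) p1 p2).mono (by decide) ?_
      rintro σ' - ⟨a1, a2, a3⟩
      refine ⟨by simpa [hgb] using a1, fun c => ?_, fun b => ?_⟩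
      · simpa [hgb] using a2 c
      · simpa [hgb] using a3 b
    · intro h
      -- Neighbours beyond `gb` are skipped. For the separator these are the vertices of the groups;
      -- such an edge is treated when its group is processed.
      have hgb : ¬ u < gb := by simpa [e1] using h
      refine Tri.block trivial (by decide) ?_
      simp [Stm.den, hgb]
  refine Tri.seq (T₁ := 20) (R := fun σ' => σ' = σ.setReg .pu u)
    (Tri.block ?_ (by decide) ?_) (fun σ' _ h => hmodulo σ' h) le_rfl
  · simp [Stm.ok, ho, hj, -List.getD_eq_getElem?_getD]
    omega
  · simp [Stm.den, ho, hj, hent, hmark, -List.getD_eq_getElem?_getD]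

theorem effHead_tri (hp : p.Ok E) (hd : DP p σ) (hco : Cols sc ga gb hc σ) {i r : ℕ}
    (hr : σ.reg .r = r) (hir : ga + r = i) (hi : i < p.n) :
    let χ := colr p.q p.k p.s sc ga hc
    Tri E effHead σ 90 (fun σ' =>
      σ'.reg .ci = χ i ∧ σ'.reg .o = p.off (p.o.getD i 0) ∧
      σ'.reg .d = (pnb p.nb p.o i).length ∧
      (∀ c, (σ'.reg .m).testBit c = true ↔ c = χ i) ∧
      (∀ b, (σ'.reg .e).testBit b = true ↔ (σ.reg .e).testBit b = true ∨
        (i < p.s ∧ b = i * p.q + χ i))) := by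
  intro χ
  have hE := hp.inp
  have hlen := hp.len
  have hL := hE.hL
  have hN := hE.hn
  have hχ : χ i < p.k := colr_lt hp.k0 i
  have hpow := hp.pow
  have hkq := hp.kq
  have hsq := hp.sq
  have hvi : p.o.getD i 0 < p.n := by
    rw [List.getD_eq_getElem _ _ (by omega)]; exact hp.good.lt _ (List.getElem_mem _)
  have hord : σ.arr .ord i = p.o.getD i 0 := by
    rw [hd.queue.ord i (by omega), List.getD_eq_getElem]
  have hpl : (pnb p.nb p.o i).length = (p.nb (p.o.getD i 0)).length := by simp [pnb]
  have hoff := hd.base.hoff _ hvi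
  have hdeg := hE.deg _ hvi
  have hlim := hE.lim _ hvi
  have p1 : 2 ^ χ i < E.N := two_pow_lt hpow (by omega)
  have p2 : i < p.s → 2 ^ (i * p.q + χ i) < E.N := by
    intro h
    refine two_pow_lt hpow ?_
    have : i * p.q ≤ p.q * p.q := Nat.mul_le_mul_right _ (by omega)
    omega
  have p3 : i < p.s → i * p.q + χ i < E.N := fun h => Nat.lt_two_pow_self.trans (p2 h)
  have p4 : i < p.s → i * p.q < E.N := fun h => (Nat.le_add_right _ _).trans_lt (p3 h)
  rw [hpl]
  generalize p.o.getD i 0 = x at *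
  have hga := hco.ga
  refine Tri.seq (T₁ := 4) (T₂ := 86) (R := fun σ' => σ' = σ.setReg .i i)
    (Tri.block ?_ (by decide) (by simp [Stm.den, hga, hr, hir])) ?_ le_rfl
  · simp [Stm.ok, hga, hr, hir]; omega
  rintro _ - rfl
  refine Tri.seq (T₁ := 8) (T₂ := 78) (R := fun σ' => σ' = (σ.setReg .i i).setReg .v x)
    (Tri.block (by simp [Stm.ok]) (by decide) (by simp [Stm.den, hord])) ?_ le_rfl
  rintro _ - rfl
  have hd' : DP p ((σ.setReg .i i).setReg .v x) := (hd.setReg (by decide)).setReg (by decide)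
  have hco' : Cols sc ga gb hc ((σ.setReg .i i).setReg .v x) :=
    ⟨by simp [hco.sc], by simp [hco.ga], by simp [hco.gb], by simp [hco.hc]⟩
  have hpi : ((σ.setReg .i i).setReg .v x).reg .i = i := by simp
  refine Tri.seq (T₁ := 20) (T₂ := 58)
    (R := fun σ'' => σ'' = ((σ.setReg .i i).setReg .v x).setReg .ci (χ i))
    (Tri.block (colorCode_ok hp hd' hco' hpi (by omega)) (by decide)
      (colorCode_den hd' hco' hpi)) ?_ le_rfl
  rintro _ - rfl
  have hs := hd.s
  have hq := hd.qv
  have htb : ∀ c, (1 <<< χ i).testBit c = true ↔ c = χ i := by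
    intro c
    have := testBit_or_shift 0 (χ i) c
    simpa [-Nat.testBit_or, -Nat.testBit_shiftLeft] using this
  refine Tri.block ?_ (by decide) ?_
  · by_cases h : i < p.s
    · have p3 := p3 h
      have p4 := p4 h
      have p2 := p2 h
      simp [Stm.ok, Stm.den, hs, hq, h, Nat.one_shiftLeft, hoff, p3, p4, p2, p1]
      omega
    · simp [Stm.ok, Stm.den, hs, hq, h, Nat.one_shiftLeft, hoff, p1]
      omega
  · by_cases h : i < p.s <;>
      simp [Stm.den, hs, hq, h, hoff, hdeg, testBit_or_shift, -Nat.testBit_or,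
        -Nat.testBit_shiftLeft, htb]

theorem effTail_tri (hp : p.Ok E) (hd : DP p σ) {a : ℕ} (ha : σ.reg .ci = a) (hak : a < p.k) :
    Tri E effTail σ 30 (fun σ' => ∀ b, (σ'.reg .e).testBit b = true ↔
      (σ.reg .e).testBit b = true ∨
        (b = p.q * p.q + a ∧ ∀ c < p.k, (σ.reg .m).testBit c = true)) := by
  have hq := hd.qv
  have hf := hd.full
  have hkq := hp.kq
  have p1 : 2 ^ (p.q * p.q + a) < E.N := two_pow_lt hp.pow (by omega)
  have p2 : p.q * p.q + a < E.N := Nat.lt_two_pow_self.trans p1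
  have p3 : 1 < E.N := Nat.one_le_two_pow.trans_lt p1
  refine Tri.block ?_ (by decide) ?_
  · simp [effTail, Stm.ok, hq, ha, Nat.one_shiftLeft]
    omega
  · by_cases h : σ.reg .m &&& (2 ^ p.k - 1) = 2 ^ p.k - 1
    · have h' := (and_full_iff _ _).1 h
      simp only [effTail, Stm.den, Ex.eval_same, Ex.eval_and, Ex.eval_var, hf, h, if_true, ne_eq,
        one_ne_zero, not_false_eq_true, Ex.eval_or, Ex.eval_shl, Ex.eval_add, Ex.eval_mul,
        Ex.eval_one, hq, ha, St.setReg_reg, testBit_or_shift]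
      intro b
      exact or_congr Iff.rfl ⟨fun hb => ⟨hb, h'⟩, fun hb => hb.1⟩
    · have h' : ¬ ∀ c < p.k, (σ.reg .m).testBit c = true := fun hc => h ((and_full_iff _ _).2 hc)
      simp only [effTail, Stm.den, Ex.eval_same, Ex.eval_and, Ex.eval_var, hf, h, if_false, ne_eq,
        not_true_eq_false]
      intro b
      exact ⟨Or.inl, fun hb => hb.resolve_right fun hb => h' hb.2⟩

/-- The variables changed by `effect` are not among `DP` and `Cols`. -/
theorem Fr.cols {P : Stm} {σ σ' : St} (hf : Fr P σ σ') (h : Cols sc ga gb hc σ)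
    (hr : ∀ x ∈ [Va.sc, .ga, .gb, .hc], P.wr x = false) : Cols sc ga gb hc σ' :=
  ⟨(hf.1 _ (hr _ (by decide))).trans h.sc, (hf.1 _ (hr _ (by decide))).trans h.ga,
    (hf.1 _ (hr _ (by decide))).trans h.gb, (hf.1 _ (hr _ (by decide))).trans h.hc⟩

/-- The result of `effect`. -/
structure EffPost (pn : ℕ → List ℕ) (χ : ℕ → ℕ) (q k s ga gb top : ℕ) (σ : St) : Prop where
  bad : σ.reg .bad ≠ 0 ↔ ∃ i, (ga ≤ i ∧ i < top) ∧ Clash pn χ gb i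
  e : ∀ b, (σ.reg .e).testBit b = true ↔ ∃ i, (ga ≤ i ∧ i < top) ∧ Fact pn χ q k s gb i b

theorem exists_lt_succ {a t : ℕ} (hat : a ≤ t) (P : ℕ → Prop) :
    (∃ i, (a ≤ i ∧ i < t + 1) ∧ P i) ↔ (∃ i, (a ≤ i ∧ i < t) ∧ P i) ∨ P t := by
  constructor
  · rintro ⟨i, ⟨h1, h2⟩, h3⟩
    rcases Nat.lt_succ_iff_lt_or_eq.1 h2 with h | rfl
    · exact Or.inl ⟨i, ⟨h1, h⟩, h3⟩
    · exact Or.inr h3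
  · rintro (⟨i, ⟨h1, h2⟩, h3⟩ | h)
    · exact ⟨i, ⟨h1, by omega⟩, h3⟩
    · exact ⟨t, ⟨hat, by omega⟩, h⟩

/-- The degree bound `D` is left open because of two uses: a separator vertex may have degree up to
`n`, but it is treated only once per coloring of the separator, while the groups, treated for every
color code, have degrees at most `q`. -/
theorem effect_tri (hp : p.Ok E) (hd : DP p σ) (hco : Cols sc ga gb hc σ) (hab : ga ≤ gb)
    (hbn : gb ≤ p.n) {D : ℕ} (hD : ∀ i, ga ≤ i → i < gb → (pnb p.nb p.o i).length ≤ D) :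
    Tri E effect σ ((gb - ga) * (100 * D + 160) + 30)
      (EffPost (pnb p.nb p.o) (colr p.q p.k p.s sc ga hc) p.q p.k p.s ga gb gb) := by
  set pn := pnb p.nb p.o with hpn
  set χ := colr p.q p.k p.s sc ga hc with hχd
  have hχ : ∀ i, χ i < p.k := fun i => colr_lt hp.k0 i
  have hN := hp.inp.hn
  have hga := hco.ga
  have hgb := hco.gb
  refine Tri.seq (T₁ := 20) (T₂ := (gb - ga) * (100 * D + 160) + 10)
    (R := fun σ' => σ' = ((σ.setReg .bad 0).setReg .e 0).setReg .len (gb - ga))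
    (Tri.block ?_ (by decide) (by simp [Stm.den, hga, hgb])) ?_ (by omega)
  · simp [Stm.ok]; omega
  rintro _ - rfl
  have hd0 : DP p (((σ.setReg .bad 0).setReg .e 0).setReg .len (gb - ga)) :=
    ((hd.setReg (by decide)).setReg (by decide)).setReg (by decide)
  have hco0 : Cols sc ga gb hc (((σ.setReg .bad 0).setReg .e 0).setReg .len (gb - ga)) :=
    ⟨by simp [hco.sc], by simp [hco.ga], by simp [hco.gb], by simp [hco.hc]⟩
  refine Tri.fors (gb - ga) (by simp) (by omega) (by decide) (by rfl) (by rfl)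
    (fun r σ' => EffPost pn χ p.q p.k p.s ga gb (ga + r) σ') (fun _ => 100 * D + 150) ?_ ?_
    (by rw [Finset.sum_const, Finset.card_range, smul_eq_mul]) ?_
  · refine ⟨?_, fun b => ?_⟩
    · simp
    · simp
  · rintro r σ₁ hr hr1 - hf hI
    obtain ⟨i, hi⟩ : ∃ i, ga + r = i := ⟨_, rfl⟩
    have hin : i < p.n := by omega
    have hd1 := hf.dp hd0 (by decide) (by decide)
    have hco1 := hf.cols hco0 (by decide)
    refine Tri.seq (effHead_tri hp hd1 hco1 hr1 hi hin) (T₂ := 100 * D + 60) ?_ (by omega)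
    rintro σ₂ hf2 ⟨h1, h2, h3, h4, h5⟩
    have hd2 := hf2.dp hd1 (by decide) (by decide)
    have hco2 := hf2.cols hco1 (by decide)
    have hbad2 : σ₂.reg .bad = σ₁.reg .bad := hf2.1 _ rfl
    have hdeg := hD i (by omega) (by omega)
    have hdn : (pnb p.nb p.o i).length ≤ p.n := by
      rw [pnb, List.length_map]
      exact Good.length_le ⟨hp.inp.isNb.nodup _, hp.inp.isNb.lt _⟩
    refine Tri.seq (T₁ := 100 * D + 10) (T₂ := 30) (R := fun σ' =>
      (σ'.reg .bad ≠ 0 ↔ σ₁.reg .bad ≠ 0 ∨ ∃ u ∈ pn i, u < gb ∧ χ u = χ i) ∧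
      (∀ c, (σ'.reg .m).testBit c = true ↔ c = χ i ∨ ∃ u ∈ pn i, u < gb ∧ c = χ u) ∧
      (∀ b, (σ'.reg .e).testBit b = true ↔ ((σ₁.reg .e).testBit b = true ∨
        (i < p.s ∧ b = i * p.q + χ i)) ∨
        ∃ u ∈ pn i, (u < gb ∧ u < p.s) ∧ b = u * p.q + χ i)) ?_ ?_ (by omega)
    · refine Tri.fors (pnb p.nb p.o i).length h3 (by omega) (by decide) rfl rfl (fun j σ' =>
        (σ'.reg .bad ≠ 0 ↔ σ₁.reg .bad ≠ 0 ∨ ∃ u ∈ (pn i).take j, u < gb ∧ χ u = χ i) ∧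
        (∀ c, (σ'.reg .m).testBit c = true ↔
          c = χ i ∨ ∃ u ∈ (pn i).take j, u < gb ∧ c = χ u) ∧
        (∀ b, (σ'.reg .e).testBit b = true ↔ ((σ₁.reg .e).testBit b = true ∨
          (i < p.s ∧ b = i * p.q + χ i)) ∨
          ∃ u ∈ (pn i).take j, (u < gb ∧ u < p.s) ∧ b = u * p.q + χ i)) (fun _ => 90) ?_ ?_ ?_ ?_
      · refine ⟨by simp [hbad2], fun c => by simpa using h4 c, fun b => by simpa using h5 b⟩
      · rintro j σ₃ hj hj3 - hf3 ⟨i1, i2, i3⟩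
        have hd3 := hf3.dp hd2 (by decide) (by decide)
        have hco3 := hf3.cols hco2 (by decide)
        refine (effNbr_tri hp hd3 hco3 hin ((hf3.1 _ rfl).trans h2) hj3 hj
          ((hf3.1 _ rfl).trans h1)).mono le_rfl ?_
        rintro σ₄ - ⟨j1, j2, j3⟩
        have hj' : j < (pn i).length := hj
        simp only [St.setReg_reg, reduceCtorEq, if_false]
        refine ⟨?_, fun c => ?_, fun b => ?_⟩
        · rw [j1, i1, or_assoc, exists_mem_take_succ hj' fun u => u < gb ∧ χ u = χ i]
        · rw [j2, i2, or_assoc, exists_mem_take_succ hj' fun u => u < gb ∧ c = χ u]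
        · rw [j3, i3, or_assoc (c := _ ∧ _ = _),
            exists_mem_take_succ hj' fun u => (u < gb ∧ u < p.s) ∧ b = u * p.q + χ i]
      · have hdeg' : (pnb p.nb p.o i).length ≤ D := hdeg
        have := Nat.mul_le_mul_right 100 hdeg'
        rw [Finset.sum_const, Finset.card_range, smul_eq_mul]
        omega
      · rintro σ' - h
        simpa only [hpn, List.take_length] using h
    · rintro σ₅ hf5 ⟨j1, j2, j3⟩
      have hd5 := hf5.dp hd2 (by decide) (by decide)
      refine (effTail_tri hp hd5 ((hf5.1 _ rfl).trans h1) (hχ i)).mono le_rfl ?_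
      intro σ₆ hf6 k1
      rw [← Nat.add_assoc, hi]
      refine ⟨?_, fun b => ?_⟩
      · have : ((σ₆.setReg .r (r + 1)).reg .bad) = σ₅.reg .bad := by
          simpa using hf6.1 .bad rfl
        rw [this, j1, exists_lt_succ (by omega), hI.bad, hi]
        rfl
      · have : ((σ₆.setReg .r (r + 1)).reg .e) = σ₆.reg .e := by simp
        rw [this, k1, j3, exists_lt_succ (by omega), hI.e, hi, or_assoc, or_assoc]
        unfold Fact Sees
        simp only [j2]
        exact Iff.rfl
  · intro σ' _ h
    rwa [show ga + (gb - ga) = gb by omega] at h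

end Mach

/-! ## Reachable table entries -/

namespace Mach

open Grow

/-- The positions split into a separator and groups, with `pn` the adjacency of positions. -/
structure Groups (n k q s : ℕ) (pn : ℕ → List ℕ) (g : ℕ) (bd : ℕ → ℕ) : Prop where
  bd0 : bd 0 = s
  bdg : bd g = n
  mono : ∀ a < g, bd a < bd (a + 1)
  size : ∀ a < g, bd (a + 1) - bd a + s ≤ q
  inside : ∀ a < g, ∀ i, bd a ≤ i → i < bd (a + 1) → ∀ j ∈ pn i, j < s ∨ bd a ≤ j ∧ j < bd (a + 1)
  lt : ∀ i < n, ∀ j ∈ pn i, j < n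
  symm : ∀ i < n, ∀ j ∈ pn i, i ∈ pn j
  k0 : 0 < k
  kq : k ≤ q
  sq : s ≤ q

/-- The bound below which the neighbours of the position `i` are inspected. -/
def lm (s n i : ℕ) : ℕ := if i < s then s else n

/-- Locality: what is recorded at a position depends only on its own color and on the colors of its
inspected neighbours. This lemma and the two after it allow a global coloring to be exchanged for a
decoded one, and one inspection bound for another. -/
theorem Clash.congr_iff {pn : ℕ → List ℕ} {χ χ' : ℕ → ℕ} {l l' i : ℕ} (hi : χ i = χ' i)
    (h : ∀ j ∈ pn i, (j < l ↔ j < l') ∧ (j < l → χ j = χ' j)) :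
    Clash pn χ l i ↔ Clash pn χ' l' i := by
  unfold Clash
  refine exists_congr fun j => and_congr_right fun hj => ?_
  obtain ⟨h1, h2⟩ := h j hj
  rw [hi, ← h1]
  exact and_congr_right fun h3 => by rw [h2 h3]

theorem Sees.congr_iff {pn : ℕ → List ℕ} {χ χ' : ℕ → ℕ} {l l' i c : ℕ} (hi : χ i = χ' i)
    (h : ∀ j ∈ pn i, (j < l ↔ j < l') ∧ (j < l → χ j = χ' j)) :
    Sees pn χ l i c ↔ Sees pn χ' l' i c := by
  unfold Sees
  rw [hi]
  refine or_congr Iff.rfl (exists_congr fun j => and_congr_right fun hj => ?_)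
  obtain ⟨h1, h2⟩ := h j hj
  rw [← h1]
  exact and_congr_right fun h3 => by rw [h2 h3]

theorem Fact.congr_iff {pn : ℕ → List ℕ} {χ χ' : ℕ → ℕ} {q k s l l' i b : ℕ} (hi : χ i = χ' i)
    (h : ∀ j ∈ pn i, (j < l ↔ j < l') ∧ (j < l → χ j = χ' j)) :
    Fact pn χ q k s l i b ↔ Fact pn χ' q k s l' i b := by
  unfold Fact
  simp only [hi]
  refine or_congr Iff.rfl (or_congr (exists_congr fun j => and_congr_right fun hj => ?_)
    (and_congr Iff.rfl (forall₂_congr fun c _ => Sees.congr_iff hi h)))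
  rw [(h j hj).1]

theorem exists_testBit (P : ℕ → Prop) (K : ℕ) : ∃ y : ℕ, ∀ b, y.testBit b = true ↔ b < K ∧ P b := by
  induction K with
  | zero => exact ⟨0, by simp⟩
  | succ K ih =>
    obtain ⟨y, hy⟩ := ih
    by_cases hP : P K
    · refine ⟨y ||| (1 <<< K), fun b => ?_⟩
      rw [testBit_or_shift, hy]
      constructor
      · rintro (⟨h1, h2⟩ | rfl)
        · exact ⟨by omega, h2⟩
        · exact ⟨by omega, hP⟩
      · rintro ⟨h1, h2⟩
        rcases Nat.lt_succ_iff_lt_or_eq.1 h1 with h | rfl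
        · exact Or.inl ⟨h, h2⟩
        · exact Or.inr rfl
    · refine ⟨y, fun b => ?_⟩
      rw [hy]
      refine ⟨fun h => ⟨by omega, h.2⟩, fun h => ⟨?_, h.2⟩⟩
      rcases Nat.lt_succ_iff_lt_or_eq.1 h.1 with h' | rfl
      · exact h'
      · exact absurd h.2 hP

/-- Decoding reduces the whole shifted number modulo `k`, including the higher blocks. The blocks
are therefore chosen from the top down, and each block of `q` bits is chosen to correct the residue
of everything above it; this works since a residue modulo `k` fits into `q` bits. -/
theorem exists_code {k q : ℕ} (hk : 0 < k) (hkq : k ≤ 2 ^ q) : ∀ (m : ℕ) (f : ℕ → ℕ),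
    (∀ i, f i < k) → ∃ c < 2 ^ (q * m), ∀ i < m, (c >>> (q * i)) % k = f i := by
  intro m
  induction m with
  | zero => exact fun f _ => ⟨0, by simp, by simp⟩
  | succ m ih =>
    intro f hf
    obtain ⟨c, hc, h⟩ := ih (fun i => f (i + 1)) fun i => hf _
    have hd : (f 0 + (k - 1) * (c * 2 ^ q)) % k < k := Nat.mod_lt _ hk
    -- Modulo `k`, the factor `k - 1` acts as -1: the lowest block is `f 0` minus the contribution
    -- of the higher blocks, without a truncated subtraction.
    set d := (f 0 + (k - 1) * (c * 2 ^ q)) % k with hdd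
    refine ⟨c * 2 ^ q + d, ?_, ?_⟩
    · have : (c + 1) * 2 ^ q ≤ 2 ^ (q * m) * 2 ^ q := Nat.mul_le_mul_right _ hc
      rw [mul_add_one, pow_add]
      rw [add_one_mul] at this
      omega
    · rintro (_ | i) hi
      · simp only [mul_zero, Nat.shiftRight_zero]
        rw [hdd, Nat.add_mod_mod]
        have : c * 2 ^ q + (f 0 + (k - 1) * (c * 2 ^ q)) = f 0 + k * (c * 2 ^ q) := by
          obtain ⟨k, rfl⟩ : ∃ k', k = k' + 1 := ⟨k - 1, by omega⟩
          simp only [Nat.add_sub_cancel]; ring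
        rw [this, Nat.add_mul_mod_self_left, Nat.mod_eq_of_lt (hf 0)]
      · rw [← h i (by omega), mul_add_one, Nat.add_comm (q * i) q, Nat.shiftRight_add,
          Nat.shiftRight_eq_div_pow _ q, mul_comm c, Nat.mul_add_div (by positivity),
          Nat.div_eq_of_lt (by omega), add_zero]

section
variable (n k q s : ℕ) (pn : ℕ → List ℕ) (bd : ℕ → ℕ) (sc : ℕ)

/-- `x` describes a partial coloring of the separator and the first `a` groups. -/
def Reach (a x : ℕ) : Prop :=
  ∃ χ : ℕ → ℕ, (∀ i, χ i < k) ∧ (∀ i < s, χ i = (sc >>> (q * i)) % k) ∧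
    (∀ i < bd a, ¬ Clash pn χ (lm s n i) i) ∧
    ∀ b, x.testBit b = true ↔ ∃ i < bd a, Fact pn χ q k s (lm s n i) i b

/-- The partial coloring described by `x` has a b-vertex for every color. -/
def Accept (x : ℕ) : Prop :=
  ∀ c < k, x.testBit (q * q + c) = true ∨
    ∃ i < s, (sc >>> (q * i)) % k = c ∧ ∀ c' < k, x.testBit (i * q + c') = true

/-- There is a b-coloring of the positions. -/
def PosColoring : Prop :=
  ∃ χ : ℕ → ℕ, (∀ i, χ i < k) ∧ (∀ i < n, ∀ j ∈ pn i, χ j ≠ χ i) ∧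
    ∀ c < k, ∃ i < n, χ i = c ∧ ∀ c' < k, c' = χ i ∨ ∃ j ∈ pn i, c' = χ j
end

variable {n k q s : ℕ} {pn : ℕ → List ℕ} {g : ℕ} {bd : ℕ → ℕ} {sc : ℕ}

theorem Groups.bd_le (hG : Groups n k q s pn g bd) {a b : ℕ} (hab : a ≤ b) (hb : b ≤ g) :
    bd a ≤ bd b := by
  induction b with
  | zero => rw [Nat.le_zero.1 hab]
  | succ b ih =>
    rcases Nat.le_succ_iff.1 hab with h | rfl
    · exact (ih h (by omega)).trans (hG.mono b hb).le
    · exact le_rfl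

theorem Groups.s_le (hG : Groups n k q s pn g bd) {a : ℕ} (ha : a ≤ g) : s ≤ bd a :=
  hG.bd0 ▸ hG.bd_le (Nat.zero_le a) ha

theorem Groups.le_n (hG : Groups n k q s pn g bd) {a : ℕ} (ha : a ≤ g) : bd a ≤ n :=
  hG.bdg ▸ hG.bd_le ha le_rfl

/-- Hence the coloring of later groups is irrelevant to the vertices of the first `a` groups. -/
theorem Groups.nbr_lt (hG : Groups n k q s pn g bd) : ∀ a ≤ g, ∀ i, s ≤ i → i < bd a →
    ∀ j ∈ pn i, j < bd a := by
  intro a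
  induction a with
  | zero => intro _ i h1 h2; have := hG.bd0; omega
  | succ a ih =>
    intro ha i h1 h2 j hj
    have := hG.mono a ha
    rcases Nat.lt_or_ge i (bd a) with h | h
    · exact (ih (by omega) i h1 h j hj).trans this
    · have := hG.s_le ha
      rcases hG.inside a ha i h h2 j hj with h' | h' <;> omega

/-- The separator blocks use the bits below q², and the colors of b-vertices the next `q` bits. This
is why a table of 2^(q² + q) entries suffices. -/
theorem Groups.fact_lt (hG : Groups n k q s pn g bd) {χ : ℕ → ℕ} (hχ : ∀ i, χ i < k) {l i b : ℕ}
    (h : Fact pn χ q k s l i b) : b < q * q + q := by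
  have hkq := hG.kq
  have hsq := hG.sq
  have := hχ i
  have key : ∀ j < s, j * q + χ i < q * q + q := fun j hj => by
    have : j * q ≤ q * q := Nat.mul_le_mul_right _ (by omega)
    omega
  rcases h with ⟨h1, rfl⟩ | ⟨j, -, ⟨-, h1⟩, rfl⟩ | ⟨rfl, -⟩
  · exact key i h1
  · exact key j h1
  · omega

theorem Reach.lt (hG : Groups n k q s pn g bd) {a x : ℕ} (h : Reach n k q s pn bd sc a x) :
    x < 2 ^ (q * q + q) := by
  obtain ⟨χ, h1, -, -, h2⟩ := h
  refine Nat.lt_pow_two_of_testBit _ fun i hi => ?_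
  rw [← Bool.not_eq_true, h2]
  rintro ⟨j, -, hj⟩
  exact absurd (hG.fact_lt h1 hj) (by omega)

theorem colr_sep {hc i : ℕ} {ga : ℕ} (hi : i < s) : colr q k s sc ga hc i = (sc >>> (q * i)) % k := by
  rw [colr, if_pos hi]

/-- Within the separator and the first groups, a coloring only matters on those. -/
theorem Groups.inner (hG : Groups n k q s pn g bd) {χ χ' : ℕ → ℕ} {a : ℕ} (ha : a ≤ g)
    (h : ∀ i < bd a, χ i = χ' i) {i : ℕ} (hi : i < bd a) :
    χ i = χ' i ∧ ∀ j ∈ pn i, (j < lm s n i ↔ j < lm s n i) ∧ (j < lm s n i → χ j = χ' j) := by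
  refine ⟨h i hi, fun j hj => ⟨Iff.rfl, fun hl => h j ?_⟩⟩
  unfold lm at hl
  split_ifs at hl with his
  · exact hl.trans_le (hG.s_le ha)
  · exact hG.nbr_lt a ha i (by omega) hi j hj

/-- Within a group, a coloring only matters on the group and the separator. -/
theorem Groups.outer (hG : Groups n k q s pn g bd) {χ χ' : ℕ → ℕ} {a : ℕ} (ha : a < g)
    (hs : ∀ i < s, χ i = χ' i) (h : ∀ i, bd a ≤ i → i < bd (a + 1) → χ i = χ' i) {i : ℕ}
    (h1 : bd a ≤ i) (h2 : i < bd (a + 1)) :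
    χ i = χ' i ∧ ∀ j ∈ pn i, (j < bd (a + 1) ↔ j < lm s n i) ∧ (j < bd (a + 1) → χ j = χ' j) := by
  have e1 := hG.s_le ha.le
  have e2 := hG.le_n (show a + 1 ≤ g from ha)
  have e3 := hG.mono a ha
  have e4 : lm s n i = n := by rw [lm, if_neg (by omega)]
  refine ⟨h i h1 h2, fun j hj => ?_⟩
  rcases hG.inside a ha i h1 h2 j hj with hj' | hj'
  · exact ⟨by rw [e4]; omega, fun _ => hs j hj'⟩
  · exact ⟨by rw [e4]; omega, fun _ => h j hj'.1 hj'.2⟩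

/-- Before any group, the code `sc` fixes every color that is inspected, so at most one mask is
reachable. The group start 0 and the group code 0 are dummies: they influence only positions outside
the separator, which are not read. -/
theorem Groups.reach_zero (hG : Groups n k q s pn g bd) {x : ℕ} :
    Reach n k q s pn bd sc 0 x ↔
      (¬ ∃ i, (0 ≤ i ∧ i < s) ∧ Clash pn (colr q k s sc 0 0) s i) ∧
      ∀ b, x.testBit b = true ↔ ∃ i, (0 ≤ i ∧ i < s) ∧ Fact pn (colr q k s sc 0 0) q k s s i b := by
  have key : ∀ χ : ℕ → ℕ, (∀ i < s, χ i = (sc >>> (q * i)) % k) → ∀ i < s,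
      χ i = colr q k s sc 0 0 i ∧ ∀ j ∈ pn i, (j < lm s n i ↔ j < s) ∧
        (j < lm s n i → χ j = colr q k s sc 0 0 j) := by
    intro χ h i hi
    have : lm s n i = s := by rw [lm, if_pos hi]
    rw [this]
    exact ⟨by rw [colr_sep hi, h i hi], fun j _ => ⟨Iff.rfl, fun hj => by rw [colr_sep hj, h j hj]⟩⟩
  have main : ∀ χ : ℕ → ℕ, (∀ i < s, χ i = (sc >>> (q * i)) % k) →
      (((∀ i < bd 0, ¬ Clash pn χ (lm s n i) i) ∧
        ∀ b, x.testBit b = true ↔ ∃ i < bd 0, Fact pn χ q k s (lm s n i) i b) ↔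
      (¬ ∃ i, (0 ≤ i ∧ i < s) ∧ Clash pn (colr q k s sc 0 0) s i) ∧
      ∀ b, x.testBit b = true ↔
        ∃ i, (0 ≤ i ∧ i < s) ∧ Fact pn (colr q k s sc 0 0) q k s s i b) := by
    intro χ h
    rw [hG.bd0]
    refine and_congr ?_ (forall_congr' fun b => iff_congr Iff.rfl (exists_congr fun i => ?_))
    · simp only [Nat.zero_le, true_and, not_exists, not_and]
      refine forall₂_congr fun i hi => not_congr ?_
      exact Clash.congr_iff (key χ h i hi).1 (key χ h i hi).2
    · simp only [Nat.zero_le, true_and]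
      exact and_congr_right fun hi => Fact.congr_iff (key χ h i hi).1 (key χ h i hi).2
  constructor
  · rintro ⟨χ, -, h2, h3⟩
    exact (main χ h2).1 h3
  · intro h
    refine ⟨colr q k s sc 0 0, fun i => ?_, fun i hi => colr_sep hi, (main _ fun i hi =>
      colr_sep hi).2 h⟩
    unfold colr
    split_ifs <;> exact Nat.mod_lt _ hG.k0

/-- A coloring of the first `a + 1` groups is the same as one of the first `a` groups together with
one of the new group, agreeing on the separator. No edge joins different groups, so clashes are
tested separately, and the recorded bits form a union. -/
theorem Groups.reach_succ (hG : Groups n k q s pn g bd) {a : ℕ} (ha : a < g) {x : ℕ} :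
    Reach n k q s pn bd sc (a + 1) x ↔ ∃ hc < 2 ^ (q * q),
      (¬ ∃ i, (bd a ≤ i ∧ i < bd (a + 1)) ∧
        Clash pn (colr q k s sc (bd a) hc) (bd (a + 1)) i) ∧
      ∃ y, Reach n k q s pn bd sc a y ∧ ∃ e, x = y ||| e ∧ ∀ b, e.testBit b = true ↔
        ∃ i, (bd a ≤ i ∧ i < bd (a + 1)) ∧
          Fact pn (colr q k s sc (bd a) hc) q k s (bd (a + 1)) i b := by
  have e1 := hG.s_le ha.le
  have e3 := hG.mono a ha
  have e5 := hG.size a ha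
  constructor
  · rintro ⟨χ, h1, h2, h3, h4⟩
    -- A group has at most `q` positions, so `q` blocks of `q` bits, addressed relative to the start
    -- of the group, describe its coloring.
    obtain ⟨hc, hlt, hcode⟩ := exists_code hG.k0 (hG.kq.trans Nat.lt_two_pow_self.le) q
      (fun t => χ (bd a + t)) fun i => h1 _
    have hs : ∀ i < s, colr q k s sc (bd a) hc i = χ i := fun i hi => by rw [colr_sep hi, h2 i hi]
    have hg : ∀ i, bd a ≤ i → i < bd (a + 1) → colr q k s sc (bd a) hc i = χ i := by
      intro i hi1 hi2
      rw [colr, if_neg (by omega), hcode (i - bd a) (by omega)]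
      congr 1; omega
    obtain ⟨y, hy⟩ := exists_testBit (fun b => ∃ i < bd a, Fact pn χ q k s (lm s n i) i b)
      (q * q + q)
    have hy' : ∀ b, y.testBit b = true ↔ ∃ i < bd a, Fact pn χ q k s (lm s n i) i b := by
      intro b
      rw [hy]
      exact and_iff_right_of_imp fun ⟨i, _, hi⟩ => hG.fact_lt h1 hi
    obtain ⟨e, he⟩ := exists_testBit (fun b => ∃ i, (bd a ≤ i ∧ i < bd (a + 1)) ∧
          Fact pn (colr q k s sc (bd a) hc) q k s (bd (a + 1)) i b) (q * q + q)
    have he' : ∀ b, e.testBit b = true ↔ ∃ i, (bd a ≤ i ∧ i < bd (a + 1)) ∧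
          Fact pn (colr q k s sc (bd a) hc) q k s (bd (a + 1)) i b := by
      intro b
      rw [he]
      refine and_iff_right_of_imp fun ⟨i, _, hi⟩ => hG.fact_lt (fun i => ?_) hi
      unfold colr
      split_ifs <;> exact Nat.mod_lt _ hG.k0
    refine ⟨hc, hlt, ?_, y, ⟨χ, h1, h2, fun i hi => h3 i (by omega), hy'⟩, e, ?_, he'⟩
    · rintro ⟨i, ⟨hi1, hi2⟩, hcl⟩
      obtain ⟨c1, c2⟩ := hG.outer ha hs hg hi1 hi2
      exact h3 i hi2 ((Clash.congr_iff c1 c2).1 hcl)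
    · apply Nat.eq_of_testBit_eq
      intro b
      rw [Bool.eq_iff_iff, Nat.testBit_or, Bool.or_eq_true, h4, hy', he']
      constructor
      · rintro ⟨i, hi, hf⟩
        rcases Nat.lt_or_ge i (bd a) with h | h
        · exact Or.inl ⟨i, h, hf⟩
        · obtain ⟨c1, c2⟩ := hG.outer ha hs hg h hi
          exact Or.inr ⟨i, ⟨h, hi⟩, (Fact.congr_iff c1 c2).2 hf⟩
      · rintro (⟨i, hi, hf⟩ | ⟨i, ⟨hi1, hi2⟩, hf⟩)
        · exact ⟨i, by omega, hf⟩
        · obtain ⟨c1, c2⟩ := hG.outer ha hs hg hi1 hi2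
          exact ⟨i, hi2, (Fact.congr_iff c1 c2).1 hf⟩
  · rintro ⟨hc, hlt, hcl, y, ⟨χ, h1, h2, h3, h4⟩, e, rfl, he⟩
    set χ' := colr q k s sc (bd a) hc with hχ'
    have hkχ : ∀ i, χ' i < k := fun i => by
      rw [hχ']; unfold colr
      split_ifs <;> exact Nat.mod_lt _ hG.k0
    -- The glued coloring. On the separator it follows `χ`, which agrees there with `χ'` because
    -- both decode `sc`.
    set ψ : ℕ → ℕ := fun i => if i < bd a then χ i else χ' i with hψ
    have p1 : ∀ i < bd a, χ i = ψ i := fun i hi => by simp [hψ, hi]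
    have p2 : ∀ i < s, χ' i = ψ i := fun i hi => by
      rw [← p1 i (by omega), h2 i hi, hχ', colr_sep hi]
    have p3 : ∀ i, bd a ≤ i → i < bd (a + 1) → χ' i = ψ i := fun i hi _ => by
      simp [hψ, Nat.not_lt.2 hi]
    refine ⟨ψ, fun i => ?_, fun i hi => ?_, fun i hi hc' => ?_, fun b => ?_⟩
    · simp only [hψ]; split_ifs
      · exact h1 i
      · exact hkχ i
    · rw [← p1 i (by omega), h2 i hi]
    · rcases Nat.lt_or_ge i (bd a) with h | h
      · obtain ⟨c1, c2⟩ := hG.inner ha.le p1 h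
        exact h3 i h ((Clash.congr_iff c1 c2).2 hc')
      · obtain ⟨c1, c2⟩ := hG.outer ha p2 p3 h hi
        exact hcl ⟨i, ⟨h, hi⟩, (Clash.congr_iff c1 c2).2 hc'⟩
    · rw [Nat.testBit_or, Bool.or_eq_true, h4, he]
      constructor
      · rintro (⟨i, hi, hf⟩ | ⟨i, ⟨hi1, hi2⟩, hf⟩)
        · obtain ⟨c1, c2⟩ := hG.inner ha.le p1 hi
          exact ⟨i, by omega, (Fact.congr_iff c1 c2).1 hf⟩
        · obtain ⟨c1, c2⟩ := hG.outer ha p2 p3 hi1 hi2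
          exact ⟨i, hi2, (Fact.congr_iff c1 c2).1 hf⟩
      · rintro ⟨i, hi, hf⟩
        rcases Nat.lt_or_ge i (bd a) with h | h
        · obtain ⟨c1, c2⟩ := hG.inner ha.le p1 h
          exact Or.inl ⟨i, h, (Fact.congr_iff c1 c2).2 hf⟩
        · obtain ⟨c1, c2⟩ := hG.outer ha p2 p3 h hi
          exact Or.inr ⟨i, ⟨h, hi⟩, (Fact.congr_iff c1 c2).2 hf⟩

theorem pos_eq {q i j c d : ℕ} (hc : c < q) (hd : d < q) (h : i * q + c = j * q + d) :
    i = j ∧ c = d := by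
  have h1 := congrArg (· / q) h
  have h2 := congrArg (· % q) h
  simp only [mul_comm _ q, Nat.mul_add_div (show 0 < q by omega), Nat.div_eq_of_lt hc,
    Nat.div_eq_of_lt hd, Nat.mul_add_mod, Nat.mod_eq_of_lt hc, Nat.mod_eq_of_lt hd] at h1 h2
  exact ⟨by omega, h2⟩

/-- Some reachable entry is accepted if and only if there is a b-coloring. -/
theorem Groups.accept_iff (hG : Groups n k q s pn g bd) :
    (∃ sc < 2 ^ (q * q), ∃ x, Reach n k q s pn bd sc g x ∧ Accept k q s sc x) ↔
      PosColoring n k pn := by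
  have hkq := hG.kq
  have hsq := hG.sq
  have hsn : s ≤ n := hG.le_n le_rfl |>.trans' (hG.s_le le_rfl)
  -- The only inspection that is left out looks from the separator into a group; such an edge is
  -- inspected from its other end.
  have hlm : ∀ {i j : ℕ}, i < n → j ∈ pn i → (s ≤ i ∨ j < s) → j < lm s n i := by
    intro i j hi hj h
    unfold lm
    split_ifs with h'
    · omega
    · exact hG.lt i hi j hj
  -- In the final mask, block `i` is exactly the set of colors in the closed neighbourhood of the
  -- separator position `i`: the neighbours themselves deposit their colors there, and adjacency is
  -- symmetric.
  have own : ∀ (χ : ℕ → ℕ) (x : ℕ), (∀ i, χ i < k) →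
      (∀ b, x.testBit b = true ↔ ∃ i < n, Fact pn χ q k s (lm s n i) i b) → ∀ i < s, ∀ c < k,
      (x.testBit (i * q + c) = true ↔ c = χ i ∨ ∃ j ∈ pn i, c = χ j) := by
    intro χ x hχ hx i hi c hc
    rw [hx]
    constructor
    · rintro ⟨u, hu, ⟨h1, h2⟩ | ⟨j, hj, ⟨h1, h2⟩, h3⟩ | ⟨h1, -⟩⟩
      · obtain ⟨rfl, rfl⟩ := pos_eq (by omega) ((hχ u).trans_le hkq) h2
        exact Or.inl rfl
      · obtain ⟨rfl, rfl⟩ := pos_eq (by omega) ((hχ u).trans_le hkq) h3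
        exact Or.inr ⟨u, hG.symm u hu i hj, rfl⟩
      · obtain ⟨rfl, -⟩ := pos_eq (by omega) ((hχ u).trans_le hkq) h1
        omega
    · rintro (rfl | ⟨j, hj, rfl⟩)
      · exact ⟨i, by omega, Or.inl ⟨hi, rfl⟩⟩
      · have hjn := hG.lt i (by omega) j hj
        have hji := hG.symm i (by omega) j hj
        exact ⟨j, hjn, Or.inr (Or.inl ⟨i, hji, ⟨hlm hjn hji (Or.inr hi), hi⟩, rfl⟩)⟩
  constructor
  · rintro ⟨sc, hsc, x, ⟨χ, h1, h2, h3, h4⟩, hacc⟩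
    rw [hG.bdg] at h3 h4
    refine ⟨χ, h1, fun i hi j hj he => ?_, fun c hc => ?_⟩
    · have hjn := hG.lt i hi j hj
      by_cases h : s ≤ i ∨ j < s
      · exact h3 i hi ⟨j, hj, hlm hi hj h, he⟩
      -- Here `i` is in the separator and `j` is not, so the clash is found from `j`.
      · exact h3 j hjn ⟨i, hG.symm i hi j hj, hlm hjn (hG.symm i hi j hj) (by omega), he.symm⟩
    · rcases hacc c hc with h | ⟨i, hi, hic, h⟩
      · obtain ⟨i, hi, ⟨h5, h6⟩ | ⟨j, hj, ⟨-, h5⟩, h6⟩ | ⟨h5, h6⟩⟩ := (h4 _).1 h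
        -- Bit q² + c would lie in block number `q`, while separator blocks have numbers below s ≤
        -- q.
        · obtain ⟨rfl, -⟩ := pos_eq (by omega) ((h1 i).trans_le hkq) h6
          omega
        · obtain ⟨rfl, -⟩ := pos_eq (by omega) ((h1 i).trans_le hkq) h6
          omega
        · refine ⟨i, hi, by omega, fun c' hc' => ?_⟩
          rcases h6 c' hc' with h | ⟨j, hj, -, h⟩
          · exact Or.inl h
          · exact Or.inr ⟨j, hj, h⟩
      · exact ⟨i, by omega, (h2 i hi).trans hic, fun c' hc' => (own χ x h1 h4 i hi c' hc').1 (h c' hc')⟩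
  · rintro ⟨χ, h1, h2, h3⟩
    obtain ⟨sc, hlt, hcode⟩ := exists_code hG.k0 (hkq.trans Nat.lt_two_pow_self.le) q χ h1
    obtain ⟨x, hx⟩ := exists_testBit (fun b => ∃ i < n, Fact pn χ q k s (lm s n i) i b)
      (q * q + q)
    have hx' : ∀ b, x.testBit b = true ↔ ∃ i < n, Fact pn χ q k s (lm s n i) i b := by
      intro b
      rw [hx]
      exact and_iff_right_of_imp fun ⟨i, _, hi⟩ => hG.fact_lt h1 hi
    refine ⟨sc, hlt, x, ⟨χ, h1, fun i hi => (hcode i (by omega)).symm, ?_, by rwa [hG.bdg]⟩, ?_⟩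
    · rintro i hi ⟨j, hj, -, he⟩
      rw [hG.bdg] at hi
      exact h2 i hi j hj he
    · intro c hc
      obtain ⟨i, hi, rfl, h⟩ := h3 c hc
      by_cases his : i < s
      · exact Or.inr ⟨i, his, hcode i (by omega), fun c' hc' =>
          (own χ x h1 hx' i his c' hc').2 (h c' hc')⟩
      · refine Or.inl ((hx' _).2 ⟨i, hi, Or.inr (Or.inr ⟨rfl, fun c' hc' => ?_⟩)⟩)
        rcases h c' hc' with h | ⟨j, hj, h⟩
        · exact Or.inl h
        · exact Or.inr ⟨j, hj, hlm hi hj (Or.inl (by omega)), h⟩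

/-! ### Positions in a list of the vertices -/

theorem mem_pnb {nb : ℕ → List ℕ} {o : List ℕ} (hn : IsNb n nb) (hg : Good n o)
    (hl : o.length = n) {i j : ℕ} : j ∈ pnb nb o i ↔ j < n ∧ o.getD j 0 ∈ nb (o.getD i 0) := by
  unfold pnb
  rw [List.mem_map]
  constructor
  · rintro ⟨u, hu, rfl⟩
    have huo : u ∈ o := by
      by_contra hno
      have := (hg.snoc (hn.lt _ _ hu) hno).length_le
      simp at this
      omega
    have := List.idxOf_lt_length_iff.2 huo
    refine ⟨by omega, ?_⟩
    rw [List.getD_eq_getElem _ _ this, List.getElem_idxOf]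
    exact hu
  · rintro ⟨hj, hu⟩
    refine ⟨_, hu, ?_⟩
    rw [List.getD_eq_getElem _ _ (by omega)]
    exact hg.nodup.idxOf_getElem j _

theorem groups_of_layout {nb : ℕ → List ℕ} {o : List ℕ} (hl : Layout n q nb s o g bd)
    (hn : IsNb n nb) (k0 : 0 < k) (kq : k ≤ q) (sq : s ≤ q) (hs : s ≤ n) :
    Groups n k q s (pnb nb o) g bd where
  bd0 := hl.bd0
  bdg := hl.bdg
  mono := hl.mono
  size := hl.size
  inside a ha i h1 h2 j hj := by
    have hle : ∀ b, a + b < g → bd (a + b + 1) ≤ n := by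
      intro b
      obtain ⟨c, hc⟩ : ∃ c, c = g - (a + b) := ⟨_, rfl⟩
      induction c generalizing b with
      | zero => omega
      | succ c ih =>
        intro hb
        by_cases h : a + b + 1 = g
        · rw [h, hl.bdg]
        · have := ih (b + 1) (by omega) (by omega)
          have := hl.mono (a + b + 1) (by omega)
          rw [← Nat.add_assoc] at *
          omega
    have hle0 := hle 0 ha
    obtain ⟨hjn, hu⟩ := (mem_pnb hn hl.good hl.len).1 hj
    obtain ⟨j', hj', h⟩ := hl.inside a ha i h1 h2 _ hu
    -- The layout speaks about vertices and names some position `j'` of the neighbour. Positions are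
    -- unique, so `j'` is `j`.
    have hj'n : j' < n := by simp at hle0; omega
    rw [List.getD_eq_getElem _ _ (by rw [hl.len]; exact hj'n),
      List.getD_eq_getElem _ _ (by rw [hl.len]; exact hjn), hl.good.nodup.getElem_inj_iff] at hj'
    subst hj'
    exact h
  lt i hi j hj := ((mem_pnb hn hl.good hl.len).1 hj).1
  symm i hi j hj := by
    rw [mem_pnb hn hl.good hl.len] at hj ⊢
    exact ⟨hi, hn.symm _ _ hj.2⟩
  k0 := k0
  kq := kq
  sq := sq

theorem pnb_nodup {nb : ℕ → List ℕ} {o : List ℕ} (hn : IsNb n nb) (hg : Good n o)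
    (hl : o.length = n) (i : ℕ) : (pnb nb o i).Nodup := by
  unfold pnb
  refine List.Nodup.map_on ?_ (hn.nodup _)
  intro x hx y hy h
  have mem : ∀ u ∈ nb (o.getD i 0), u ∈ o := by
    intro u hu
    by_contra hno
    have := (hg.snoc (hn.lt _ _ hu) hno).length_le
    simp at this
    omega
  exact (List.idxOf_inj (mem x hx)).1 h

/-- The vertices of a group have few neighbours. -/
theorem Groups.degree_le (hG : Groups n k q s pn g bd) (hnd : ∀ i, (pn i).Nodup) {a : ℕ}
    (ha : a < g) {i : ℕ} (h1 : bd a ≤ i) (h2 : i < bd (a + 1)) : (pn i).length ≤ q := by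
  have : (pn i).toFinset ⊆ Finset.range s ∪ Finset.Ico (bd a) (bd (a + 1)) := by
    intro j hj
    simpa using hG.inside a ha i h1 h2 j (by simpa using hj)
  have := (Finset.card_le_card this).trans (Finset.card_union_le _ _)
  rw [List.toFinset_card_of_nodup (hnd i)] at this
  have := hG.size a ha
  simp at *
  omega

end Mach

/-! ## The dynamic program -/

namespace Mach

open Grow

/-- Clears a table. -/
def wipe (t : Ar) : Stm := .fors .x .W (.put t (Va.x : Ex) 0)

/-- Copies the second table to the first. -/
def copy : Stm := .fors .x .W (.put .t1 (Va.x : Ex) (.get .t2 (Va.x : Ex)))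

/-- Extends all entries of the first table by a contribution. -/
def combine : Stm :=
  .fors .x .W (.ite (.get .t1 (Va.x : Ex)) (.put .t2 ((Va.x : Ex) ||| (Va.e : Ex)) 1) .skip)

/-- Starts the table with the separator. -/
def seed : Stm :=
  (.hc ≔ 0 ;; .ga ≔ 0 ;; .gb ≔ (Va.s : Ex)) ;; effect ;; wipe .t1 ;;
  .ite (Va.bad : Ex) .skip (.put .t1 (Va.e : Ex) 1)

/-- Extends the table by a group. -/
def groupBody : Stm :=
  (.ga ≔ .get .start (Va.a : Ex) ;; .gb ≔ .get .start (Va.a + 1 : Ex)) ;; wipe .t2 ;;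
  .fors .hc .M (effect ;; .ite (Va.bad : Ex) .skip combine) ;; copy

/-- Records the color of a b-vertex in the separator. -/
def checkSep : Stm :=
  .ite (Ex.same (((Va.x : Ex) >>> (Va.u * Va.q : Ex)) &&& (Va.full : Ex)) Va.full)
    (.b ≔ ((Va.b : Ex) ||| ((1 : Ex) <<< (((Va.sc : Ex) >>> (Va.q * Va.u : Ex)) % (Va.k : Ex)))))
    .skip

/-- Inspects an entry of the final table. -/
def checkBody : Stm :=
  .ite (.get .t1 (Va.x : Ex))
    (.b ≔ ((Va.x : Ex) >>> (Va.q * Va.q : Ex)) ;; .fors .u .s checkSep ;;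
      .ite (Ex.same ((Va.b : Ex) &&& (Va.full : Ex)) Va.full) (.ans ≔ 1) .skip) .skip

/-- Treats a coloring of the separator. -/
def sepBody : Stm := seed ;; .fors .a .g groupBody ;; .fors .x .W checkBody

/-- Decides whether there is a b-coloring. -/
def solve : Stm :=
  (.full ≔ (((1 : Ex) <<< (Va.k : Ex)) - 1 : Ex) ;;
    .W ≔ ((1 : Ex) <<< (Va.q * Va.q + Va.q : Ex)) ;; .ans ≔ 0) ;;
  .fors .sc .M sepBody

variable {E : Env} {p : Pars} {σ : St} {sc ga gb hc w : ℕ} {g : ℕ} {bd : ℕ → ℕ}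

theorem wipe_tri (hw : σ.reg .W = w) (hN : w < E.N) (t : Ar) :
    Tri E (wipe t) σ (30 * w + 10) (fun σ' => ∀ x < w, σ'.arr t x = 0) := by
  refine Tri.fors w hw hN (by decide) rfl rfl (fun i σ' => ∀ x < i, σ'.arr t x = 0)
    (fun _ => 20) (by simp) ?_ (by simp; omega) (fun _ _ h => h)
  intro i σ₁ hi hx _ _ h
  refine Tri.block (by simp [Stm.ok]; omega) (show 8 ≤ 20 by norm_num) ?_
  intro x hx'
  simp [Stm.den, hx, Function.update_apply]
  intro hne
  exact h x (by omega)

theorem copy_tri (hw : σ.reg .W = w) (hN : w < E.N) :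
    Tri E copy σ (30 * w + 10) (fun σ' => ∀ x < w, σ'.arr .t1 x = σ.arr .t2 x) := by
  refine Tri.fors w hw hN (by decide) rfl rfl (fun i σ' => ∀ x < i, σ'.arr .t1 x = σ.arr .t2 x)
    (fun _ => 20) (by simp) ?_ (by simp; omega) (fun _ _ h => h)
  intro i σ₁ hi hx _ hf h
  have h2 : σ₁.arr .t2 = σ.arr .t2 := hf.2 _ rfl
  refine Tri.block (by simp [Stm.ok]) (by decide) ?_
  intro x hx'
  simp only [Stm.den, Ex.eval_var, hx, Ex.eval_get, St.setReg_arr, St.setArr_arr, if_true,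
    Function.update_apply, h2]
  split_ifs with hne
  · rw [hne]
  · exact h x (by omega)

/-- Reading from one table and writing to the other ensures that each entry receives the
contribution of exactly one coloring of the group. -/
theorem combine_tri (hw : σ.reg .W = w) (hN : w < E.N) (h1N : 1 < E.N) :
    Tri E combine σ (40 * w + 10) (fun σ' => ∀ z, σ'.arr .t2 z ≠ 0 ↔
      σ.arr .t2 z ≠ 0 ∨ ∃ x < w, σ.arr .t1 x ≠ 0 ∧ z = x ||| σ.reg .e) := by
  refine Tri.fors w hw hN (by decide) rfl rfl (fun i σ' => ∀ z, σ'.arr .t2 z ≠ 0 ↔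
      σ.arr .t2 z ≠ 0 ∨ ∃ x < i, σ.arr .t1 x ≠ 0 ∧ z = x ||| σ.reg .e)
    (fun _ => 30) (by simp) ?_ (by simp; omega) (fun _ _ h => h)
  intro i σ₁ hi hx _ hf h
  have h2 : σ₁.arr .t1 = σ.arr .t1 := hf.2 _ rfl
  have he : σ₁.reg .e = σ.reg .e := hf.1 _ rfl
  have key : ∀ z, (∃ x < i + 1, σ.arr .t1 x ≠ 0 ∧ z = x ||| σ.reg .e) ↔
      (∃ x < i, σ.arr .t1 x ≠ 0 ∧ z = x ||| σ.reg .e) ∨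
        (σ.arr .t1 i ≠ 0 ∧ z = i ||| σ.reg .e) := by
    intro z
    have := exists_lt_succ (Nat.zero_le i) fun x => σ.arr .t1 x ≠ 0 ∧ z = x ||| σ.reg .e
    simpa only [Nat.zero_le, true_and] using this
  refine Tri.ite (T₁ := 20) (by simp) ?_ ?_ (by decide)
  · intro h0
    have h0' : σ.arr .t1 i ≠ 0 := by simpa [hx, h2] using h0
    refine Tri.block (by simp [Stm.ok]; omega) (by decide) fun z => ?_
    rw [key, ← or_assoc, ← h]
    simp only [Stm.den, Ex.eval_or, Ex.eval_var, hx, he, Ex.eval_one, St.setReg_arr,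
      St.setArr_arr, if_true, Function.update_apply]
    by_cases hz : z = i ||| σ.reg .e <;> simp [hz, h0']
  · intro h0
    have h0' : σ.arr .t1 i = 0 := by simpa [hx, h2] using h0
    refine Tri.block trivial (by decide) fun z => ?_
    rw [key, ← or_assoc, ← h]
    simp [Stm.den, h0']

/-- The variables that do not change while a coloring of the separator is treated. -/
structure DT (p : Pars) (g : ℕ) (bd : ℕ → ℕ) (σ : St) : Prop where
  dp : DP p σ
  M : σ.reg .M = 2 ^ (p.q * p.q)
  W : σ.reg .W = 2 ^ (p.q * p.q + p.q)
  gv : σ.reg .g = g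
  start : ∀ a ≤ g, σ.arr .start a = bd a

/-- The variables of `DT`. -/
def dtRegs : List Va := dpRegs ++ [.M, .W, .g]
/-- The arrays of `DT`. -/
def dtArrs : List Ar := dpArrs ++ [.start]

theorem DT.congr {σ' : St} (h : DT p g bd σ) (hr : ∀ x ∈ dtRegs, σ'.reg x = σ.reg x)
    (ha : ∀ a ∈ dtArrs, σ'.arr a = σ.arr a) : DT p g bd σ' :=
  ⟨h.dp.congr (fun x hx => hr x (List.mem_append_left _ hx))
      fun a h' => ha a (List.mem_append_left _ h'),
    (hr _ (by decide)).trans h.M, (hr _ (by decide)).trans h.W, (hr _ (by decide)).trans h.gv,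
    fun a h' => by rw [ha .start (by decide), h.start a h']⟩

theorem Fr.dt {P : Stm} {σ' : St} (hf : Fr P σ σ') (h : DT p g bd σ)
    (hr : ∀ x ∈ dtRegs, P.wr x = false) (ha : ∀ a ∈ dtArrs, P.wa a = false) : DT p g bd σ' :=
  h.congr (fun x hx => hf.1 x (hr x hx)) fun a h' => hf.2 a (ha a h')

theorem eq_of_bits {x y : ℕ} {P : ℕ → Prop} (hx : ∀ b, x.testBit b = true ↔ P b)
    (hy : ∀ b, y.testBit b = true ↔ P b) : x = y :=
  Nat.eq_of_testBit_eq fun b => by rw [Bool.eq_iff_iff, hx, hy]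

/-- The entries of the first table are the reachable ones. -/
def TabOk (p : Pars) (bd : ℕ → ℕ) (sc a : ℕ) (σ : St) : Prop :=
  ∀ x < 2 ^ (p.q * p.q + p.q), σ.arr .t1 x ≠ 0 ↔
    Reach p.n p.k p.q p.s (pnb p.nb p.o) bd sc a x

theorem Pars.Ok.deg_le (hp : p.Ok E) (i : ℕ) : (pnb p.nb p.o i).length ≤ p.n := by
  rw [pnb, List.length_map]
  exact Good.length_le ⟨hp.inp.isNb.nodup _, hp.inp.isNb.lt _⟩

theorem Pars.Ok.w_lt (hp : p.Ok E) : 2 ^ (p.q * p.q + p.q) < E.N := two_pow_lt hp.pow (by omega)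

theorem Pars.Ok.one_lt (hp : p.Ok E) : 1 < E.N := Nat.one_le_two_pow.trans_lt hp.pow

/-- The table starts empty if the separator coloring is improper, and otherwise with the single mask
contributed by the separator. The term `q * n` comes from the unbounded degrees of separator
vertices. -/
theorem seed_tri (hp : p.Ok E) (hG : Groups p.n p.k p.q p.s (pnb p.nb p.o) g bd)
    (ht : DT p g bd σ) (hsc : σ.reg .sc = sc) :
    Tri E seed σ (p.q * (100 * p.n + 160) + 30 * 2 ^ (p.q * p.q + p.q) + 100)
      (TabOk p bd sc 0) := by
  have h1N := hp.one_lt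
  have hwN := hp.w_lt
  have hsq := Nat.mul_le_mul_right (100 * p.n + 160) hp.sq
  refine Tri.seq (T₁ := 10) (T₂ := p.q * (100 * p.n + 160) + 30 * 2 ^ (p.q * p.q + p.q) + 90)
    (R := fun σ' => σ'.reg .hc = 0 ∧ σ'.reg .ga = 0 ∧ σ'.reg .gb = p.s)
    (Tri.block (by simp [Stm.ok]; omega) (by decide) (by simp [Stm.den, ht.dp.s])) ?_ (by omega)
  rintro σ₁ hf1 ⟨a1, a2, a3⟩
  have ht1 := hf1.dt ht (by decide) (by decide)
  have hco : Cols sc 0 p.s 0 σ₁ := ⟨(hf1.1 _ rfl).trans hsc, a2, a3, a1⟩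
  refine Tri.seq (effect_tri hp ht1.dp hco (Nat.zero_le _) hp.sn (D := p.n)
    fun i _ _ => hp.deg_le i) (T₂ := 30 * 2 ^ (p.q * p.q + p.q) + 60) ?_
    (by rw [Nat.sub_zero]; omega)
  intro σ₂ hf2 he
  have ht2 := hf2.dt ht1 (by decide) (by decide)
  refine Tri.seq (wipe_tri ht2.W hwN .t1) (T₂ := 50) ?_ (by omega)
  intro σ₃ hf3 hz
  have b3 : σ₃.reg .bad = σ₂.reg .bad := hf3.1 _ rfl
  have e3 : σ₃.reg .e = σ₂.reg .e := hf3.1 _ rfl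
  refine Tri.ite (T₁ := 20) (by simp) ?_ ?_ (by decide)
  · intro h
    refine Tri.block trivial (by decide) fun x hx => ?_
    rw [Ex.eval_var, b3, he.bad] at h
    simp only [Stm.den, hz x hx, ne_eq, not_true_eq_false, false_iff, hG.reach_zero]
    exact fun hc => hc.1 h
  · intro h
    refine Tri.block (by simp [Stm.ok]; omega) (by decide) fun x hx => ?_
    have h' : ¬ ∃ i, (0 ≤ i ∧ i < p.s) ∧ Clash (pnb p.nb p.o) (colr p.q p.k p.s sc 0 0) p.s i := by
      rw [← he.bad, ← b3]; simpa using h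
    rw [hG.reach_zero, and_iff_right h']
    simp only [Stm.den, Ex.eval_var, Ex.eval_one, St.setArr_arr, if_true, Function.update_apply,
      e3]
    split_ifs with hxe
    · subst hxe
      simpa using he.e
    · simp only [hz x hx, ne_eq, not_true_eq_false, false_iff]
      exact fun hc => hxe (eq_of_bits hc he.e)

/-- A bound for the time spent on a group. -/
def groupTime (q : ℕ) : ℕ :=
  2 ^ (q * q) * (q * (100 * q + 160) + 40 * 2 ^ (q * q + q) + 60) + 60 * 2 ^ (q * q + q) + 70

/-- The program evaluates the right-hand side of `Groups.reach_succ` literally, one code at a time.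
Its time does not depend on `n`: a group has at most `q` vertices, of degree at most `q`, and the
table has 2^(q² + q) entries. -/
theorem groupBody_tri (hp : p.Ok E) (hG : Groups p.n p.k p.q p.s (pnb p.nb p.o) g bd)
    (ht : DT p g bd σ) (hsc : σ.reg .sc = sc) {a : ℕ} (ha : σ.reg .a = a) (hag : a < g)
    (hT : TabOk p bd sc a σ) :
    Tri E groupBody σ (groupTime p.q) (TabOk p bd sc (a + 1)) := by
  have h1N := hp.one_lt
  have hwN := hp.w_lt
  have hMN : 2 ^ (p.q * p.q) < E.N := two_pow_lt hp.pow (by omega)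
  have hn := hp.inp.hn
  have hag' := hG.le_n (show a + 1 ≤ g from hag)
  have hmono := hG.mono a hag
  have hsz := hG.size a hag
  -- The boundaries increase strictly, so a ≤ bd a ≤ n and the index `a + 1` does not overflow.
  have halt : a < E.N - 1 := by
    have : ∀ b ≤ g, b ≤ bd b := by
      intro b
      induction b with
      | zero => simp
      | succ b ih => intro hb; have := hG.mono b hb; have := ih (by omega); omega
    have := this a hag.le
    omega
  have hgt : groupTime p.q = 2 ^ (p.q * p.q) * (p.q * (100 * p.q + 160) +
    40 * 2 ^ (p.q * p.q + p.q) + 60) + 60 * 2 ^ (p.q * p.q + p.q) + 70 := rfl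
  rw [hgt]
  refine Tri.seq (T₁ := 20) (T₂ := 2 ^ (p.q * p.q) * (p.q * (100 * p.q + 160) +
      40 * 2 ^ (p.q * p.q + p.q) + 60) + 60 * 2 ^ (p.q * p.q + p.q) + 50)
    (R := fun σ' => σ'.reg .ga = bd a ∧ σ'.reg .gb = bd (a + 1))
    (Tri.block ?_ (by decide) ?_) ?_ (by omega)
  · simp [Stm.ok, Stm.den, ha]; omega
  · simp [Stm.den, ha, ht.start a hag.le, ht.start (a + 1) hag]
  rintro σ₁ hf1 ⟨a1, a2⟩
  have ht1 := hf1.dt ht (by decide) (by decide)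
  refine Tri.seq (wipe_tri ht1.W hwN .t2) (T₂ := 2 ^ (p.q * p.q) * (p.q * (100 * p.q + 160) +
      40 * 2 ^ (p.q * p.q + p.q) + 60) + 30 * 2 ^ (p.q * p.q + p.q) + 30) ?_ (by omega)
  intro σ₂ hf2 hz
  have ht2 := hf2.dt ht1 (by decide) (by decide)
  have hT2 : TabOk p bd sc a σ₂ := by
    have e1 : σ₂.arr .t1 = σ.arr .t1 := (hf2.2 _ rfl).trans (hf1.2 _ rfl)
    intro x hx
    rw [e1, hT x hx]
  have hco2 : ∀ i, Cols sc (bd a) (bd (a + 1)) i (σ₂.setReg .hc i) := by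
    intro i
    refine ⟨?_, ?_, ?_, by simp⟩
    · simpa using (hf2.1 .sc rfl).trans ((hf1.1 .sc rfl).trans hsc)
    · simpa using (hf2.1 .ga rfl).trans a1
    · simpa using (hf2.1 .gb rfl).trans a2
  refine Tri.seq (T₁ := 2 ^ (p.q * p.q) * (p.q * (100 * p.q + 160) +
      40 * 2 ^ (p.q * p.q + p.q) + 60) + 10) (T₂ := 30 * 2 ^ (p.q * p.q + p.q) + 10)
    (R := fun σ' => ∀ z < 2 ^ (p.q * p.q + p.q), σ'.arr .t2 z ≠ 0 ↔
      Reach p.n p.k p.q p.s (pnb p.nb p.o) bd sc (a + 1) z) ?_ ?_ (by omega)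
  · refine Tri.fors (2 ^ (p.q * p.q)) ht2.M hMN (by decide) rfl rfl
      (fun h σ' => ∀ z < 2 ^ (p.q * p.q + p.q), σ'.arr .t2 z ≠ 0 ↔ ∃ hc < h,
        (¬ ∃ i, (bd a ≤ i ∧ i < bd (a + 1)) ∧
          Clash (pnb p.nb p.o) (colr p.q p.k p.s sc (bd a) hc) (bd (a + 1)) i) ∧
        ∃ y, Reach p.n p.k p.q p.s (pnb p.nb p.o) bd sc a y ∧ ∃ e, z = y ||| e ∧
          ∀ b, e.testBit b = true ↔ ∃ i, (bd a ≤ i ∧ i < bd (a + 1)) ∧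
            Fact (pnb p.nb p.o) (colr p.q p.k p.s sc (bd a) hc) p.q p.k p.s (bd (a + 1)) i b)
      (fun _ => p.q * (100 * p.q + 160) + 40 * 2 ^ (p.q * p.q + p.q) + 50) ?_ ?_ ?_ ?_
    · intro z hzlt
      simp [hz z hzlt]
    · intro h σ₃ hh hh3 hM3 hf3 hI
      have ht3 := hf3.dt ht2 (by decide) (by decide)
      have hco3 : Cols sc (bd a) (bd (a + 1)) h σ₃ := by
        have := hco2 h
        refine ⟨?_, ?_, ?_, hh3⟩
        · exact (hf3.1 .sc rfl).trans (by simpa using this.sc)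
        · exact (hf3.1 .ga rfl).trans (by simpa using this.ga)
        · exact (hf3.1 .gb rfl).trans (by simpa using this.gb)
      have hsz' := Nat.mul_le_mul_right (100 * p.q + 160)
        (show bd (a + 1) - bd a ≤ p.q by omega)
      refine Tri.seq (effect_tri hp ht3.dp hco3 hmono.le hag' (D := p.q) fun i h1 h2 =>
        hG.degree_le (pnb_nodup hp.inp.isNb hp.good hp.len) hag h1 h2)
        (T₂ := 40 * 2 ^ (p.q * p.q + p.q) + 20) ?_ (by omega)
      intro σ₄ hf4 he
      have ht4 := hf4.dt ht3 (by decide) (by decide)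
      have ht24 : σ₄.arr .t2 = σ₃.arr .t2 := hf4.2 _ rfl
      have ht14 : σ₄.arr .t1 = σ₂.arr .t1 := (hf4.2 _ rfl).trans (hf3.2 _ rfl)
      refine Tri.ite (T₁ := 40 * 2 ^ (p.q * p.q + p.q) + 10) (by simp) ?_ ?_
        (by simp only [Ex.cost]; omega)
      · intro hbad
        rw [Ex.eval_var, he.bad] at hbad
        refine Tri.block trivial (by simp only [Stm.cost]; omega) fun z hzlt => ?_
        simp only [Stm.den, St.setReg_arr, ht24]
        rw [hI z hzlt]
        constructor
        · rintro ⟨hc, hlt, h⟩; exact ⟨hc, by omega, h⟩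
        · rintro ⟨hc, hlt, h1, h2⟩
          rcases Nat.lt_succ_iff_lt_or_eq.1 hlt with h | rfl
          · exact ⟨hc, h, h1, h2⟩
          · exact absurd hbad h1
      · intro hbad
        have hbad' : ¬ ∃ i, (bd a ≤ i ∧ i < bd (a + 1)) ∧
            Clash (pnb p.nb p.o) (colr p.q p.k p.s sc (bd a) h) (bd (a + 1)) i := by
          rw [← he.bad]; simpa using hbad
        refine (combine_tri ht4.W hwN h1N).mono le_rfl ?_
        intro σ₅ hf5 hcomb z hzlt
        rw [St.setReg_arr, hcomb z, ht24, hI z hzlt]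
        constructor
        · rintro (⟨hc, hlt, h⟩ | ⟨x, hx, h1, h2⟩)
          · exact ⟨hc, by omega, h⟩
          · rw [ht14, hT2 x hx] at h1
            exact ⟨h, by omega, hbad', x, h1, _, h2, he.e⟩
        · rintro ⟨hc, hlt, h1, y, hy, e, rfl, hbits⟩
          rcases Nat.lt_succ_iff_lt_or_eq.1 hlt with h' | rfl
          · exact Or.inl ⟨hc, h', h1, y, hy, e, rfl, hbits⟩
          -- A reachable mask is a valid table index, and a contribution is determined by its bits,
          -- so it is the value the program has computed.
          · refine Or.inr ⟨y, hy.lt hG, ?_, by rw [eq_of_bits hbits he.e]⟩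
            rw [ht14]
            exact (hT2 y (hy.lt hG)).2 hy
    · simp only [Finset.sum_const, Finset.card_range, smul_eq_mul]
      exact le_rfl
    · intro σ' _ h z hzlt
      rw [h z hzlt, hG.reach_succ hag]
  · intro σ₃ hf3 h3
    have ht3 := hf3.dt ht2 (by decide) (by decide)
    refine (copy_tri ht3.W hwN).mono le_rfl ?_
    intro σ₄ _ h4 x hx
    rw [h4 x hx, h3 x hx]

theorem shift_and_full (x a k : ℕ) : (x >>> a) &&& (2 ^ k - 1) = 2 ^ k - 1 ↔
    ∀ c < k, x.testBit (a + c) = true := by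
  rw [and_full_iff]
  exact forall₂_congr fun c _ => by rw [Nat.testBit_shiftRight]

/-- The variable `b` collects the colors owning a b-vertex: first those in the top block of the
mask, then the colors of separator vertices whose block is full. Acceptance is the test that the
first `k` bits of `b` are set. -/
theorem checkBody_tri (hp : p.Ok E) (ht : DT p g bd σ) (hsc : σ.reg .sc = sc) {x : ℕ}
    (hx : σ.reg .x = x) :
    Tri E checkBody σ (60 * p.q + 70) (fun σ' => (σ'.reg .ans = σ.reg .ans ∨ σ'.reg .ans = 1) ∧
      (σ'.reg .ans = 1 ↔ σ.reg .ans = 1 ∨ (σ.arr .t1 x ≠ 0 ∧ Accept p.k p.q p.s sc x))) := by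
  have h1N := hp.one_lt
  have hq := ht.dp.qv
  have hs := ht.dp.s
  have hk := ht.dp.k
  have hfl := ht.dp.full
  have hsq := hp.sq
  have hkq := hp.kq
  have hpow := hp.pow
  have hqq : p.q * p.q < E.N := Nat.lt_two_pow_self.trans (two_pow_lt hpow (by omega))
  have hqN : p.q < E.N := Nat.lt_two_pow_self.trans (two_pow_lt hpow (by omega))
  refine Tri.ite (T₁ := 60 * p.q + 60) (by simp) ?_ ?_ (by simp only [Ex.cost]; omega)
  · intro h0
    have h0' : σ.arr .t1 x ≠ 0 := by simpa [hx] using h0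
    refine Tri.seq (T₁ := 10) (T₂ := 60 * p.q + 50)
      (R := fun σ' => σ'.reg .b = x >>> (p.q * p.q) )
      (Tri.block (by simp [Stm.ok, hq]; omega) (by decide) (by simp [Stm.den, hx, hq])) ?_ (by omega)
    intro σ₁ hf1 hb1
    refine Tri.seq (T₁ := 60 * p.q + 10) (T₂ := 40) (R := fun σ' => ∀ c,
        (σ'.reg .b).testBit c = true ↔ x.testBit (p.q * p.q + c) = true ∨ ∃ i < p.s,
          (sc >>> (p.q * i)) % p.k = c ∧ ∀ c' < p.k, x.testBit (i * p.q + c') = true) ?_ ?_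
        (by omega)
    · refine Tri.fors p.s ((hf1.1 _ rfl).trans hs) (by omega) (by decide) rfl rfl
        (fun m σ' => ∀ c, (σ'.reg .b).testBit c = true ↔
          x.testBit (p.q * p.q + c) = true ∨ ∃ i < m,
          (sc >>> (p.q * i)) % p.k = c ∧ ∀ c' < p.k, x.testBit (i * p.q + c') = true)
        (fun _ => 50) ?_ ?_ ?_ (fun _ _ h => h)
      · simp [hb1]
      · intro i σ₂ hi hu _ hf2 hI
        have r1 : σ₂.reg .x = x := (hf2.1 _ rfl).trans ((hf1.1 _ rfl).trans hx)
        have r2 : σ₂.reg .q = p.q := (hf2.1 _ rfl).trans ((hf1.1 _ rfl).trans hq)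
        have r3 : σ₂.reg .k = p.k := (hf2.1 _ rfl).trans ((hf1.1 _ rfl).trans hk)
        have r4 : σ₂.reg .full = 2 ^ p.k - 1 := (hf2.1 _ rfl).trans ((hf1.1 _ rfl).trans hfl)
        have r5 : σ₂.reg .sc = sc := (hf2.1 _ rfl).trans ((hf1.1 _ rfl).trans hsc)
        have hcol : (sc >>> (p.q * i)) % p.k < p.k := Nat.mod_lt _ hp.k0
        have p1 : 2 ^ ((sc >>> (p.q * i)) % p.k) < E.N := two_pow_lt hpow (by omega)
        have p2 : p.q * i < E.N := by
          have : p.q * i ≤ p.q * p.q := Nat.mul_le_mul_left _ (by omega)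
          omega
        have p3 : i * p.q < E.N := by rwa [mul_comm]
        have key : ∀ c, (∃ i' < i + 1, (sc >>> (p.q * i')) % p.k = c ∧
            ∀ c' < p.k, x.testBit (i' * p.q + c') = true) ↔
            (∃ i' < i, (sc >>> (p.q * i')) % p.k = c ∧
            ∀ c' < p.k, x.testBit (i' * p.q + c') = true) ∨ ((sc >>> (p.q * i)) % p.k = c ∧
            ∀ c' < p.k, x.testBit (i * p.q + c') = true) := by
          intro c
          have := exists_lt_succ (Nat.zero_le i) fun i' => (sc >>> (p.q * i')) % p.k = c ∧
            ∀ c' < p.k, x.testBit (i' * p.q + c') = true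
          simpa only [Nat.zero_le, true_and] using this
        refine Tri.block ?_ (by decide) ?_
        · simp only [checkSep, Stm.ok, Ex.safe_same, Ex.safe_and, Ex.safe_shr, Ex.safe_var,
            Ex.safe_mul, Ex.eval_var, r2, r3, r5, hu, true_and, and_true, Ex.safe_or,
            Ex.safe_shl, Ex.safe_one, Ex.safe_mod, Ex.eval_one, Ex.eval_mod, Ex.eval_shr,
            Ex.eval_mul, Nat.one_shiftLeft]
          exact ⟨p3, fun _ => ⟨h1N, p2, p1⟩, fun _ => trivial⟩
        · intro c
          rw [key, ← or_assoc, ← hI]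
          by_cases h : (x >>> (i * p.q)) &&& (2 ^ p.k - 1) = 2 ^ p.k - 1
          · have h' := (shift_and_full _ _ _).1 h
            simp only [checkSep, Stm.den, Ex.eval_same, Ex.eval_and, Ex.eval_shr, Ex.eval_mul,
              Ex.eval_var, r1, r2, r3, r4, r5, hu, h, if_true, ne_eq, one_ne_zero,
              not_false_eq_true, Ex.eval_or, Ex.eval_shl, Ex.eval_one, Ex.eval_mod,
              St.setReg_reg, reduceCtorEq, if_false, testBit_or_shift]
            exact or_congr Iff.rfl ⟨fun e => ⟨e.symm, h'⟩, fun e => e.1.symm⟩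
          · have h' := mt (shift_and_full _ _ _).2 h
            simp only [checkSep, Stm.den, Ex.eval_same, Ex.eval_and, Ex.eval_shr, Ex.eval_mul,
              Ex.eval_var, r1, r2, r4, hu, h, if_false, ne_eq, not_true_eq_false,
              St.setReg_reg, reduceCtorEq]
            exact ⟨Or.inl, fun e => e.resolve_right fun e => h' e.2⟩
      · rw [Finset.sum_const, Finset.card_range, smul_eq_mul]
        omega
    · intro σ₂ hf2 hb2
      have r1 : σ₂.reg .ans = σ.reg .ans := (hf2.1 _ rfl).trans (hf1.1 _ rfl)
      have r2 : σ₂.reg .full = 2 ^ p.k - 1 := (hf2.1 _ rfl).trans ((hf1.1 _ rfl).trans hfl)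
      have hacc : σ₂.reg .b &&& (2 ^ p.k - 1) = 2 ^ p.k - 1 ↔ Accept p.k p.q p.s sc x := by
        rw [and_full_iff]
        exact forall₂_congr fun c _ => hb2 c
      refine Tri.block (by simp [Stm.ok]; omega) (by decide) ?_
      by_cases h : σ₂.reg .b &&& (2 ^ p.k - 1) = 2 ^ p.k - 1
      · simp [Stm.den, r2, h, h0', hacc.1 h]
      · simp [Stm.den, r2, h, r1, h0', mt hacc.2 h, -Nat.and_two_pow_sub_one_eq_mod]
  · intro h0
    have h0' : σ.arr .t1 x = 0 := by simpa [hx] using h0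
    refine Tri.block trivial (by simp only [Stm.cost]; omega) ?_
    simp [Stm.den, h0']

/-- A bound for the time spent on a coloring of the separator. -/
def sepTime (q n : ℕ) : ℕ :=
  q * (100 * n + 160) + n * (groupTime q + 10) + 2 ^ (q * q + q) * (60 * q + 110) + 130

theorem sepBody_tri (hp : p.Ok E) (hG : Groups p.n p.k p.q p.s (pnb p.nb p.o) g bd)
    (ht : DT p g bd σ) (hsc : σ.reg .sc = sc) (hans : σ.reg .ans ≤ 1) :
    Tri E sepBody σ (sepTime p.q p.n) (fun σ' => σ'.reg .ans ≤ 1 ∧ (σ'.reg .ans = 1 ↔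
      σ.reg .ans = 1 ∨ ∃ x, Reach p.n p.k p.q p.s (pnb p.nb p.o) bd sc g x ∧
        Accept p.k p.q p.s sc x)) := by
  have hwN := hp.w_lt
  have hn := hp.inp.hn
  have hgn : g ≤ p.n := by
    have : ∀ b ≤ g, b ≤ bd b := by
      intro b
      induction b with
      | zero => simp
      | succ b ih => intro hb; have := hG.mono b hb; have := ih (by omega); omega
    exact (this g le_rfl).trans hG.bdg.le
  have hgt := Nat.mul_le_mul_right (groupTime p.q + 10) hgn
  have hst : sepTime p.q p.n = p.q * (100 * p.n + 160) + p.n * (groupTime p.q + 10) +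
    2 ^ (p.q * p.q + p.q) * (60 * p.q + 110) + 130 := rfl
  have hsplit : 2 ^ (p.q * p.q + p.q) * (60 * p.q + 110) =
      30 * 2 ^ (p.q * p.q + p.q) + 2 ^ (p.q * p.q + p.q) * (60 * p.q + 80) := by ring
  rw [hst, hsplit]
  refine Tri.seq (seed_tri hp hG ht hsc) (T₂ := p.n * (groupTime p.q + 10) +
    2 ^ (p.q * p.q + p.q) * (60 * p.q + 80) + 30) ?_ (by omega)
  intro σ₁ hf1 hT1
  have ht1 := hf1.dt ht (by decide) (by decide)
  refine Tri.seq (T₁ := p.n * (groupTime p.q + 10) + 10)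
    (T₂ := 2 ^ (p.q * p.q + p.q) * (60 * p.q + 80) + 10) (R := TabOk p bd sc g) ?_ ?_ (by omega)
  · refine Tri.fors g ht1.gv (by omega) (by decide) rfl rfl (fun a σ' => TabOk p bd sc a σ')
      (fun _ => groupTime p.q) hT1 ?_ ?_ (fun _ _ h => h)
    · intro a σ₂ ha ha2 _ hf2 hI
      exact (groupBody_tri hp hG (hf2.dt ht1 (by decide) (by decide))
        ((hf2.1 _ rfl).trans ((hf1.1 _ rfl).trans hsc)) ha2 ha hI).mono le_rfl
        fun _ _ h => h
    · rw [Finset.sum_const, Finset.card_range, smul_eq_mul]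
      omega
  · intro σ₂ hf2 hT2
    have ht2 := hf2.dt ht1 (by decide) (by decide)
    have hans2 : σ₂.reg .ans = σ.reg .ans := (hf2.1 _ rfl).trans (hf1.1 _ rfl)
    refine Tri.fors _ ht2.W hwN (by decide) rfl rfl (fun m σ' => σ'.reg .ans ≤ 1 ∧
      (σ'.reg .ans = 1 ↔ σ.reg .ans = 1 ∨ ∃ x < m,
        Reach p.n p.k p.q p.s (pnb p.nb p.o) bd sc g x ∧ Accept p.k p.q p.s sc x))
      (fun _ => 60 * p.q + 70) ?_ ?_ ?_ ?_
    · simp [hans2, hans]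
    · intro x σ₃ hx hx3 _ hf3 hI
      have ht3 := hf3.dt ht2 (by decide) (by decide)
      have h3 : σ₃.arr .t1 = σ₂.arr .t1 := hf3.2 _ rfl
      refine (checkBody_tri hp ht3 ((hf3.1 _ rfl).trans ((hf2.1 _ rfl).trans
        ((hf1.1 _ rfl).trans hsc))) hx3).mono le_rfl ?_
      rintro σ₄ - ⟨j1, j2⟩
      simp only [St.setReg_reg, reduceCtorEq, if_false]
      refine ⟨by rcases j1 with j | j <;> omega, ?_⟩
      rw [j2, hI.2, h3, hT2 x hx, or_assoc]
      refine or_congr Iff.rfl ?_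
      have := exists_lt_succ (Nat.zero_le x) fun x =>
        Reach p.n p.k p.q p.s (pnb p.nb p.o) bd sc g x ∧ Accept p.k p.q p.s sc x
      simp only [Nat.zero_le, true_and] at this
      exact this.symm
    · rw [Finset.sum_const, Finset.card_range, smul_eq_mul]
    · rintro σ' - ⟨h1, h2⟩
      refine ⟨h1, h2.trans (or_congr Iff.rfl (exists_congr fun x => ?_))⟩
      exact and_iff_right_of_imp fun h => h.1.lt hG

/-- The value `M` left by the search is the number of color codes as well: both are 2^(q²). The
answer is only ever raised to 1, so over the loops it becomes the disjunction asked for by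
`Groups.accept_iff`. -/
theorem solve_tri (hp : p.Ok E) (hG : Groups p.n p.k p.q p.s (pnb p.nb p.o) g bd)
    (hb : Base p.n p.off σ) (hqu : Queue p.n p.o σ) (hk : σ.reg .k = p.k) (hq : σ.reg .q = p.q)
    (hs : σ.reg .s = p.s) (hM : σ.reg .M = 2 ^ (p.q * p.q)) (hg : σ.reg .g = g)
    (hst : ∀ a ≤ g, σ.arr .start a = bd a) :
    Tri E solve σ (2 ^ (p.q * p.q) * (sepTime p.q p.n + 10) + 40) (fun σ' => σ'.reg .ans ≤ 1 ∧
      (σ'.reg .ans = 1 ↔ PosColoring p.n p.k (pnb p.nb p.o))) := by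
  have h1N := hp.one_lt
  have hwN := hp.w_lt
  have hpow := hp.pow
  have hkq := hp.kq
  have hMN : 2 ^ (p.q * p.q) < E.N := two_pow_lt hpow (by omega)
  have hkN : 2 ^ p.k < E.N := two_pow_lt hpow (by omega)
  have hqN : p.q * p.q + p.q < E.N := Nat.lt_two_pow_self.trans hwN
  refine Tri.seq (T₁ := 30) (T₂ := 2 ^ (p.q * p.q) * (sepTime p.q p.n + 10) + 10)
    (R := fun σ' => σ'.reg .full = 2 ^ p.k - 1 ∧ σ'.reg .W = 2 ^ (p.q * p.q + p.q) ∧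
      σ'.reg .ans = 0) (Tri.block ?_ (by decide) ?_) ?_ (by omega)
  · simp [Stm.ok, Stm.den, hk, hq, Nat.one_shiftLeft]
    omega
  · simp [Stm.den, hk, hq, Nat.one_shiftLeft]
  rintro σ₁ hf1 ⟨a1, a2, a3⟩
  have hd1 : DT p g bd σ₁ := by
    refine ⟨⟨hb.congr (hf1.1 _ rfl) (hf1.2 _ rfl), hqu.congr (hf1.1 _ rfl) (hf1.2 _ rfl)
      (hf1.2 _ rfl), (hf1.1 _ rfl).trans hk, (hf1.1 _ rfl).trans hq, (hf1.1 _ rfl).trans hs, a1⟩,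
      (hf1.1 _ rfl).trans hM, a2, (hf1.1 _ rfl).trans hg, fun a ha => ?_⟩
    rw [hf1.2 .start rfl, hst a ha]
  refine Tri.fors _ hd1.M hMN (by decide) rfl rfl (fun m σ' => σ'.reg .ans ≤ 1 ∧
    (σ'.reg .ans = 1 ↔ ∃ sc < m, ∃ x, Reach p.n p.k p.q p.s (pnb p.nb p.o) bd sc g x ∧
        Accept p.k p.q p.s sc x)) (fun _ => sepTime p.q p.n) ?_ ?_ ?_ ?_
  · simp [a3]
  · rintro sc σ₂ hsc hsc2 - hf2 hI
    refine (sepBody_tri hp hG (hf2.dt hd1 (by decide) (by decide)) hsc2 hI.1).mono le_rfl ?_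
    rintro σ₃ - ⟨j1, j2⟩
    simp only [St.setReg_reg, reduceCtorEq, if_false]
    refine ⟨j1, ?_⟩
    rw [j2, hI.2]
    have := exists_lt_succ (Nat.zero_le sc) fun sc => ∃ x,
      Reach p.n p.k p.q p.s (pnb p.nb p.o) bd sc g x ∧ Accept p.k p.q p.s sc x
    simp only [Nat.zero_le, true_and] at this
    exact this.symm
  · rw [Finset.sum_const, Finset.card_range, smul_eq_mul]
  · rintro σ' - ⟨h1, h2⟩
    exact ⟨h1, h2.trans hG.accept_iff⟩

end Mach

/-! ## Graphs and their adjacency lists -/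

namespace Mach

open Grow

/-- The list contains each vertex exactly once, so passing to positions is a relabelling of the
graph. -/
theorem posColoring_pnb {n k : ℕ} {nb : ℕ → List ℕ} {o : List ℕ} (hn : IsNb n nb)
    (hg : Good n o) (hl : o.length = n) : PosColoring n k (pnb nb o) ↔ PosColoring n k nb := by
  have hmem : ∀ v < n, v ∈ o := by
    intro v hv
    by_contra hno
    have := (hg.snoc hv hno).length_le
    simp at this
    omega
  have hix : ∀ v < n, o.idxOf v < n := fun v hv => hl ▸ List.idxOf_lt_length_iff.2 (hmem v hv)
  have hgi : ∀ v < n, o.getD (o.idxOf v) 0 = v := fun v hv => by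
    rw [List.getD_eq_getElem _ _ (List.idxOf_lt_length_iff.2 (hmem v hv)), List.getElem_idxOf]
  have hig : ∀ i < n, o.idxOf (o.getD i 0) = i := fun i hi => by
    rw [List.getD_eq_getElem _ _ (by omega)]
    exact hg.nodup.idxOf_getElem i _
  have hgl : ∀ i < n, o.getD i 0 < n := fun i hi => by
    rw [List.getD_eq_getElem _ _ (by omega)]
    exact hg.lt _ (List.getElem_mem _)
  constructor
  · rintro ⟨χ, h1, h2, h3⟩
    have hmp : ∀ v < n, ∀ u ∈ nb v, o.idxOf u ∈ pnb nb o (o.idxOf v) := fun v hv u hu => by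
      have hun := hn.lt v u hu
      rw [mem_pnb hn hg hl, hgi v hv, hgi u hun]
      exact ⟨hix u hun, hu⟩
    refine ⟨fun v => χ (o.idxOf v), fun v => h1 _, fun v hv u hu => h2 _ (hix v hv) _
      (hmp v hv u hu), fun c hc => ?_⟩
    obtain ⟨i, hi, hic, h⟩ := h3 c hc
    refine ⟨o.getD i 0, hgl i hi, by simp only [hig i hi, hic], fun c' hc' => ?_⟩
    simp only [hig i hi]
    rcases h c' hc' with h | ⟨j, hj, h⟩
    · exact Or.inl h
    · obtain ⟨hjn, hj⟩ := (mem_pnb hn hg hl).1 hj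
      exact Or.inr ⟨_, hj, by simp only [hig j hjn, h]⟩
  · rintro ⟨χ, h1, h2, h3⟩
    refine ⟨fun i => χ (o.getD i 0), fun v => h1 _, fun i hi j hj => ?_, fun c hc => ?_⟩
    · exact h2 _ (hgl i hi) _ ((mem_pnb hn hg hl).1 hj).2
    · obtain ⟨v, hv, hvc, h⟩ := h3 c hc
      refine ⟨o.idxOf v, hix v hv, by simp only [hgi v hv, hvc], fun c' hc' => ?_⟩
      simp only [hgi v hv]
      rcases h c' hc' with h | ⟨u, hu, h⟩
      · exact Or.inl h
      · have hun := hn.lt v u hu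
        refine Or.inr ⟨o.idxOf u, ?_, by simp only [hgi u hun, h]⟩
        rw [mem_pnb hn hg hl, hgi v hv, hgi u hun]
        exact ⟨hix u hun, hu⟩

/-- With more colors than the size of the groups allows, there is no b-coloring. -/
theorem Groups.le_of_posColoring {n k q s : ℕ} {pn : ℕ → List ℕ} {g : ℕ} {bd : ℕ → ℕ}
    (hG : Groups n 1 q s pn g bd) (hnd : ∀ i, (pn i).Nodup) (hir : ∀ i < n, i ∉ pn i)
    (h : PosColoring n k pn) : k ≤ q := by
  obtain ⟨χ, h1, -, h3⟩ := h
  choose! f hf using h3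
  by_cases hex : ∃ c < k, s ≤ f c
  · obtain ⟨c, hc, hs⟩ := hex
    obtain ⟨hi, -, hsee⟩ := hf c hc
    obtain ⟨a, ha, h4, h5⟩ : ∃ a < g, bd a ≤ f c ∧ f c < bd (a + 1) := by
      have : ∀ b ≤ g, f c < bd b → ∃ a < g, bd a ≤ f c ∧ f c < bd (a + 1) := by
        intro b
        induction b with
        | zero => intro _ h; have := hG.bd0; omega
        | succ b ih =>
          intro hb h
          rcases Nat.lt_or_ge (f c) (bd b) with h' | h'
          · exact ih (by omega) h'
          · exact ⟨b, hb, h', h⟩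
      exact this g le_rfl (hG.bdg.symm ▸ hi)
    -- A b-vertex outside the separator has all neighbours in its group or the separator. Removing
    -- the vertex itself leaves at most q - 1 of them, so its closed neighbourhood shows at most `q`
    -- colors.
    have hsub : (pn (f c)).toFinset ⊆
        (Finset.range s ∪ Finset.Ico (bd a) (bd (a + 1))).erase (f c) := by
      intro j hj
      have hj' : j ∈ pn (f c) := by simpa using hj
      rw [Finset.mem_erase]
      refine ⟨fun h => hir _ hi (h ▸ hj'), ?_⟩
      simpa using hG.inside a ha _ h4 h5 j hj'
    have c1 := Finset.card_le_card hsub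
    rw [Finset.card_erase_of_mem (by simp [h4, h5]), List.toFinset_card_of_nodup (hnd _)] at c1
    have c2 := Finset.card_union_le (Finset.range s) (Finset.Ico (bd a) (bd (a + 1)))
    have hsz := hG.size a ha
    rw [Finset.card_range, Nat.card_Ico] at c2
    have hcol : Finset.range k ⊆ insert (χ (f c)) ((pn (f c)).toFinset.image χ) := by
      intro c' hc'
      rcases hsee c' (by simpa using hc') with h | ⟨j, hj, h⟩
      · simp [h]
      · rw [Finset.mem_insert, Finset.mem_image]
        exact Or.inr ⟨j, by simpa using hj, h.symm⟩
    have c3 := (Finset.card_le_card hcol).trans (Finset.card_insert_le _ _)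
    have c4 := Finset.card_image_le (s := (pn (f c)).toFinset) (f := χ)
    rw [List.toFinset_card_of_nodup (hnd _)] at c4
    rw [Finset.card_range] at c3
    have : 0 < bd (a + 1) - bd a := by omega
    omega
  -- All chosen b-vertices lie in the separator, and they are distinct because their colors are.
  · push Not at hex
    have : (Finset.range k).card ≤ (Finset.range s).card := by
      refine Finset.card_le_card_of_injOn f (fun c hc => ?_) fun c hc d hd he => ?_
      · simpa using hex c (by simpa using hc)
      · rw [← (hf c (by simpa using hc)).2.1, he, (hf d (by simpa using hd)).2.1]
    have := hG.sq
    simp at *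
    omega

/-- The adjacency lists, with vertices as natural numbers. -/
def nbOf {n : ℕ} (adj : Fin n → List (Fin n)) (v : ℕ) : List ℕ :=
  if h : v < n then (adj ⟨v, h⟩).map Fin.val else []

section
variable {n : ℕ} {G : SimpleGraph (Fin n)} {adj : Fin n → List (Fin n)}

theorem nbOf_val (v : Fin n) : nbOf adj v = (adj v).map Fin.val := by simp [nbOf]

theorem mem_nbOf (h : BCol.IsAdjList G adj) (v u : Fin n) : (u : ℕ) ∈ nbOf adj v ↔ G.Adj v u := by
  rw [nbOf_val, ← (h v).2 u]
  exact List.mem_map_of_injective Fin.val_injective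

theorem isNb_nbOf (h : BCol.IsAdjList G adj) : IsNb n (nbOf adj) where
  nodup v := by
    unfold nbOf
    split_ifs
    · exact (h _).1.map Fin.val_injective
    · exact List.nodup_nil
  lt v u hu := by
    unfold nbOf at hu
    split_ifs at hu
    · obtain ⟨w, -, rfl⟩ := List.mem_map.1 hu
      exact w.2
    · simp at hu
  symm u v huv := by
    have hv : v < n := by
      by_contra hv
      simp [nbOf, hv] at huv
    have hu : u < n := by
      unfold nbOf at huv
      rw [dif_pos hv] at huv
      obtain ⟨w, -, rfl⟩ := List.mem_map.1 huv
      exact w.2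
    exact (mem_nbOf h ⟨u, hu⟩ ⟨v, hv⟩).2 ((mem_nbOf h ⟨v, hv⟩ ⟨u, hu⟩).1 huv).symm
  irrefl v hv := by
    by_cases hvn : v < n
    · exact G.loopless.irrefl _ ((mem_nbOf h ⟨v, hvn⟩ ⟨v, hvn⟩).1 hv)
    · simp [nbOf, hvn] at hv

theorem isBVertex_iff {k : ℕ} {χ : Fin n → Fin k} {u : Fin n} :
    BCol.IsBVertex G χ u ↔ ∀ c, c = χ u ∨ ∃ w, G.Adj u w ∧ c = χ w := by
  unfold BCol.IsBVertex
  rw [Set.eq_univ_iff_forall]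
  refine forall_congr' fun c => ?_
  simp only [Set.mem_image, Set.mem_insert_iff, SimpleGraph.mem_neighborSet, or_and_right, exists_or,
    exists_eq_left]
  simp only [@eq_comm _ c]

theorem posColoring_nbOf {k : ℕ} (h : BCol.IsAdjList G adj) (h0 : 0 < n) :
    PosColoring n k (nbOf adj) ↔ BCol.HasBColoring G k := by
  constructor
  · rintro ⟨χ, h1, h2, h3⟩
    refine ⟨fun v => ⟨χ v, h1 v⟩, fun u v huv he => ?_, fun c => ?_⟩
    · exact h2 v v.2 u ((mem_nbOf h v u).2 huv.symm) (by simpa using he)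
    · obtain ⟨i, hi, hic, hs⟩ := h3 c c.2
      refine ⟨⟨i, hi⟩, isBVertex_iff.2 fun c' => ?_, Fin.ext hic⟩
      rcases hs c' c'.2 with hs | ⟨j, hj, hs⟩
      · exact Or.inl (Fin.ext hs)
      · have hjn := (isNb_nbOf h).lt _ _ hj
        exact Or.inr ⟨⟨j, hjn⟩, (mem_nbOf h ⟨i, hi⟩ ⟨j, hjn⟩).1 hj, Fin.ext hs⟩
  · rintro ⟨χ, h1, h2⟩
    have hk : 0 < k := (Nat.zero_le _).trans_lt (χ ⟨0, h0⟩).2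
    set ψ : ℕ → ℕ := fun v => if hv : v < n then χ ⟨v, hv⟩ else 0 with hψ
    have hv : ∀ v : Fin n, ψ v = χ v := fun v => by simp [hψ]
    refine ⟨ψ, fun i => ?_, fun i hi j hj he => ?_, fun c hc => ?_⟩
    · simp only [hψ]
      split_ifs
      · exact (χ _).2
      · exact hk
    · have hjn := (isNb_nbOf h).lt _ _ hj
      have e1 := hv ⟨i, hi⟩
      have e2 := hv ⟨j, hjn⟩
      exact h1 _ _ ((mem_nbOf h ⟨i, hi⟩ ⟨j, hjn⟩).1 hj) (Fin.ext (by rw [← e1, ← e2]; exact he.symm))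
    · obtain ⟨u, hu, huc⟩ := h2 ⟨c, hc⟩
      refine ⟨u, u.2, by rw [hv, huc], fun c' hc' => ?_⟩
      rcases isBVertex_iff.1 hu ⟨c', hc'⟩ with hs | ⟨w, hw, hs⟩
      · exact Or.inl (by rw [hv, ← hs])
      · exact Or.inr ⟨w, (mem_nbOf h u w).2 hw, by rw [hv, ← hs]⟩

/-- The vertex integrity is attained. -/
theorem exists_separator (h : BCol.IsAdjList G adj) (h0 : 0 < n) :
    ∃ T, Separator n (BCol.vertexIntegrity G) (nbOf adj) T := by
  have hne : {p : ℕ | ∃ S : Set (Fin n), S ≠ Set.univ ∧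
      ∀ H : (G.induce Sᶜ).ConnectedComponent, (S ∪ Subtype.val '' H.supp).ncard ≤ p}.Nonempty := by
    -- The empty set with bound `n` is admissible, so the infimum is that of a non-empty set and is
    -- attained.
    refine ⟨n, ∅, ?_, fun H => ?_⟩
    · intro he
      exact (he ▸ Set.mem_univ (⟨0, h0⟩ : Fin n) : (⟨0, h0⟩ : Fin n) ∈ (∅ : Set (Fin n)))
    · have := Set.ncard_le_card (∅ ∪ Subtype.val '' H.supp : Set (Fin n))
      simpa using this
  obtain ⟨S, hS, hH⟩ := Nat.sInf_mem hne
  change ∀ H : (G.induce Sᶜ).ConnectedComponent, (S ∪ Subtype.val '' H.supp).ncard ≤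
    BCol.vertexIntegrity G at hH
  classical
  set T : Finset ℕ := S.toFinset.image Fin.val with hT
  have hTc : T.card = S.ncard := by
    rw [hT, Finset.card_image_of_injective _ Fin.val_injective, Set.ncard_eq_toFinset_card']
  have hmT : ∀ v : Fin n, (v : ℕ) ∈ T ↔ v ∈ S := by
    intro v
    simp [hT, Fin.val_inj]
  refine ⟨T, fun v hv => ?_, ?_, fun l hl hlT hne hpar => ?_⟩
  · obtain ⟨w, -, rfl⟩ := Finset.mem_image.1 hv
    exact w.2
  -- A vertex outside `S` lies in a component that makes the union strictly larger than `S`. This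
  -- strict inequality is what stops the branching in `exists_attempt`.
  · obtain ⟨v, hv⟩ := (Set.ne_univ_iff_exists_notMem S).1 hS
    have := hH ((G.induce Sᶜ).connectedComponentMk ⟨v, hv⟩)
    refine lt_of_lt_of_le ?_ this
    rw [hTc]
    refine Set.ncard_lt_ncard ⟨Set.subset_union_left, fun hsub => hv (hsub (Or.inr ?_))⟩
      (Set.toFinite _)
    exact ⟨⟨v, hv⟩, rfl, rfl⟩
  · have hlen : 0 < l.length := List.length_pos_iff.2 hne
    have hln : ∀ i (hi : i < l.length), l[i] < n := fun i hi => hl.lt _ (List.getElem_mem _)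
    have hlS : ∀ i (hi : i < l.length), (⟨l[i], hln i hi⟩ : Fin n) ∈ Sᶜ := fun i hi hS =>
      hlT _ (List.getElem_mem hi) ((hmT ⟨l[i], hln i hi⟩).2 hS)
    set H := (G.induce Sᶜ).connectedComponentMk ⟨_, hlS 0 hlen⟩ with hHdef
    -- Following earlier neighbours back to position 0 shows that the whole list lies in a single
    -- component.
    have hin : ∀ i (hi : i < l.length), (G.induce Sᶜ).connectedComponentMk ⟨_, hlS i hi⟩ = H := by
      intro i
      induction i using Nat.strong_induction_on with
      | _ i ih =>
        intro hi
        rcases Nat.eq_zero_or_pos i with rfl | hpos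
        · rfl
        · obtain ⟨j, -, hj, hadj⟩ := hpar i hpos hi
          rw [← ih j hj (by omega)]
          rw [List.getD_eq_getElem _ _ hi, List.getD_eq_getElem _ _ (by omega)] at hadj
          have := (mem_nbOf h ⟨l[j], hln j (by omega)⟩ ⟨l[i], hln i hi⟩).1 hadj
          refine SimpleGraph.ConnectedComponent.sound (SimpleGraph.Adj.reachable ?_)
          exact this.symm
    have hcard := hH H
    have hsub : T ∪ l.toFinset ⊆ ((S ∪ Subtype.val '' H.supp).toFinset).image Fin.val := by
      intro v hv
      rw [Finset.mem_image]
      rcases Finset.mem_union.1 hv with hv | hv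
      · obtain ⟨w, hw, rfl⟩ := Finset.mem_image.1 hv
        exact ⟨w, by simpa using Or.inl (by simpa using hw), rfl⟩
      · obtain ⟨i, hi, rfl⟩ := List.mem_iff_getElem.1 (List.mem_toFinset.1 hv)
        refine ⟨⟨l[i], hln i hi⟩, ?_, rfl⟩
        rw [Set.mem_toFinset]
        exact Or.inr ⟨⟨_, hlS i hi⟩, hin i hi, rfl⟩
    have hd : Disjoint T l.toFinset := by
      rw [Finset.disjoint_right]
      intro v hv
      exact hlT v (by simpa using hv)
    have := Finset.card_le_card hsub
    rw [Finset.card_union_of_disjoint hd, List.toFinset_card_of_nodup hl.nodup,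
      Finset.card_image_of_injective (S ∪ Subtype.val '' H.supp).toFinset Fin.val_injective, ← Set.ncard_eq_toFinset_card'] at this
    exact this.trans hcard

/-- The number of edges is small. -/
theorem wt_range_le {p : ℕ} {nb : ℕ → List ℕ} (hn : IsNb n nb) {T : Finset ℕ}
    (hT : Separator n p nb T) : wt nb (List.range n) ≤ 2 * p * n := by
  have hdeg : ∀ v, (nb v).length ≤ n := fun v => Good.length_le ⟨hn.nodup v, hn.lt v⟩
  have hdegn : ∀ v < n, (nb v).length + 1 ≤ n := by
    intro v hv
    have := Good.length_le (n := n) (o := v :: nb v)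
      ⟨List.nodup_cons.2 ⟨hn.irrefl v, hn.nodup v⟩, fun u hu => by
        rcases List.mem_cons.1 hu with rfl | hu
        · exact hv
        · exact hn.lt v u hu⟩
    simpa using this
  -- The vertex and its neighbours outside `T` form a star, which is connected; with |T| it has at
  -- most `p` vertices, and all other neighbours are in `T`.
  have hout : ∀ v < n, v ∉ T → (nb v).length + 1 ≤ p := by
    intro v hv hvT
    set l := (nb v).filter (fun u => u ∉ T) with hl
    have hcon := hT.conn (v :: l) ⟨List.nodup_cons.2 ⟨fun hm => hn.irrefl v (List.mem_filter.1 hm).1,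
        (hn.nodup v).filter _⟩, fun u hu => ?_⟩ (fun u hu => ?_) (by simp) ?_
    · have hsub : (nb v).toFinset ⊆ T ∪ l.toFinset := by
        intro u hu
        by_cases huT : u ∈ T
        · exact Finset.mem_union_left _ huT
        · exact Finset.mem_union_right _ (by simpa [hl, huT] using hu)
      have c1 := (Finset.card_le_card hsub).trans (Finset.card_union_le _ _)
      rw [List.toFinset_card_of_nodup (hn.nodup v)] at c1
      have c2 := List.toFinset_card_le l
      simp only [List.length_cons] at hcon
      omega
    · rcases List.mem_cons.1 hu with rfl | hu
      · exact hv
      · exact hn.lt v u (List.mem_filter.1 hu).1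
    · rcases List.mem_cons.1 hu with rfl | hu
      · exact hvT
      · simpa using (List.mem_filter.1 hu).2
    · intro i hi hil
      refine ⟨0, le_rfl, hi, ?_⟩
      obtain ⟨i, rfl⟩ : ∃ i', i = i' + 1 := ⟨i - 1, by omega⟩
      simp only [List.length_cons] at hil
      rw [List.getD_cons_succ, List.getD_cons_zero, List.getD_eq_getElem _ _ (by omega)]
      exact (List.mem_filter.1 (List.getElem_mem _ : l[i] ∈ l)).1
  have hsum : wt nb (List.range n) = ∑ v ∈ Finset.range n, ((nb v).length + 1) := by
    unfold wt
    rw [← List.sum_toFinset _ List.nodup_range, List.toFinset_range]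
  rw [hsum]
  -- Vertices of `T` may have large degree, but there are fewer than `p` of them; both terms sum to
  -- at most pn.
  have hle : ∀ v ∈ Finset.range n, (nb v).length + 1 ≤ p + if v ∈ T then n else 0 := by
    intro v hv
    have hv' := Finset.mem_range.1 hv
    by_cases hvT : v ∈ T
    · rw [if_pos hvT]; have := hdegn v hv'; omega
    · rw [if_neg hvT]; exact hout v hv' hvT
  refine (Finset.sum_le_sum hle).trans ?_
  rw [Finset.sum_add_distrib, Finset.sum_const, Finset.card_range, ← Finset.sum_filter,
    Finset.sum_const, smul_eq_mul, smul_eq_mul]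
  have hc : ((Finset.range n).filter (· ∈ T)).card ≤ T.card :=
    Finset.card_le_card fun v hv => (Finset.mem_filter.1 hv).2
  have := Nat.mul_le_mul_right n (hc.trans hT.card.le)
  nlinarith

/-! ### The encoding -/

theorem getD_flatten (L : List (List ℕ)) {v : ℕ} (hv : v < L.length) {j : ℕ}
    (hj : j < L[v].length) : L.flatten.getD ((L.take v).flatten.length + j) 0 = L[v][j] := by
  have : L.flatten = (L.take v).flatten ++ (L[v] ++ (L.drop (v + 1)).flatten) := by
    rw [← List.flatten_cons, ← List.drop_eq_getElem_cons hv, ← List.flatten_append,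
      List.take_append_drop]
  rw [this, List.getD_append_right _ _ _ _ (by omega), Nat.add_sub_cancel_left,
    List.getD_append _ _ _ _ hj, List.getD_eq_getElem]

/-- The records of the vertices. -/
def recs (adj : Fin n → List (Fin n)) : List (List ℕ) :=
  List.ofFn fun v : Fin n => (adj v).length :: (adj v).map Fin.val

theorem recs_getElem {v : ℕ} (hv : v < (recs adj).length) :
    (recs adj)[v] = (nbOf adj v).length :: nbOf adj v := by
  have hvn : v < n := by simpa [recs] using hv
  simp only [recs, List.getElem_ofFn, nbOf, dif_pos hvn, List.length_map]

theorem take_recs : ∀ v ≤ n, ((recs adj).take v).flatten.length = wt (nbOf adj) (List.range v) := by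
  intro v
  induction v with
  | zero => simp [wt]
  | succ v ih =>
    intro hv
    have hvl : v < (recs adj).length := by simp [recs]; omega
    rw [List.take_succ_eq_append_getElem hvl, List.flatten_append, List.length_append,
      ih (by omega), recs_getElem, wt, wt, List.range_succ, List.map_append, List.sum_append]
    simp

/-- The position of the record of a vertex in the input. -/
def offs (adj : Fin n → List (Fin n)) (v : ℕ) : ℕ := wt (nbOf adj) (List.range v) + 2

theorem offs_succ (v : ℕ) : offs adj (v + 1) = offs adj v + ((nbOf adj v).length + 1) := by
  simp [offs, wt, List.range_succ]
  omega

theorem encode_eq (k : ℕ) : BCol.encode adj k = n :: k :: (recs adj).flatten := by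
  have : ∀ l : List (Fin n), (l >>= fun a => pure (a : ℕ)) = l.map Fin.val := fun l =>
    bind_pure_comp _ _
  simp only [BCol.encode, recs, this, List.map_id']

theorem encode_length (k : ℕ) : (BCol.encode adj k).length = offs adj n := by
  have := take_recs (adj := adj) n le_rfl
  rw [List.take_of_length_le (by simp [recs])] at this
  rw [encode_eq, List.length_cons, List.length_cons, this, offs]

theorem encode_getD (k : ℕ) {v : ℕ} (hv : v < n) {j : ℕ} (hj : j < (nbOf adj v).length + 1) :
    (BCol.encode adj k).getD (offs adj v + j) 0 = ((nbOf adj v).length :: nbOf adj v)[j] := by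
  have hvl : v < (recs adj).length := by simpa [recs] using hv
  have h1 := getD_flatten (recs adj) hvl (j := j) (by rw [recs_getElem]; simpa using hj)
  rw [take_recs v hv.le] at h1
  rw [encode_eq, offs, Nat.add_right_comm, List.getD_cons_succ, List.getD_cons_succ, h1]
  simp only [recs_getElem]

theorem offs_mono {u v : ℕ} (h : u ≤ v) : offs adj u ≤ offs adj v := by
  induction v with
  | zero => rw [Nat.le_zero.1 h]
  | succ v ih =>
    rcases Nat.le_succ_iff.1 h with h | rfl
    · have := offs_succ (adj := adj) v
      have := ih h
      omega
    · exact le_rfl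

/-- The input length is not given, but it is below a number computable from `n` alone; the arrays
are placed from that address on. -/
theorem offs_le (h : BCol.IsAdjList G adj) : offs adj n ≤ (n + 2) * (n + 2) := by
  have hn := isNb_nbOf h
  have : ∀ v, offs adj v ≤ v * (n + 1) + 2 := by
    intro v
    induction v with
    | zero => simp [offs, wt]
    | succ v ih =>
      have := Good.length_le ⟨hn.nodup v, hn.lt v⟩
      rw [offs_succ, add_one_mul]
      omega
  have := this n
  nlinarith

theorem mem_encode_le (h : BCol.IsAdjList G adj) {k a : ℕ} (ha : a ∈ BCol.encode adj k) :
    a ≤ n + k := by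
  have hn := isNb_nbOf h
  rw [encode_eq] at ha
  simp only [List.mem_cons, List.mem_flatten] at ha
  rcases ha with rfl | rfl | ⟨l, hl, ha⟩
  · omega
  · omega
  · obtain ⟨v, hv, rfl⟩ := List.mem_iff_getElem.1 hl
    rw [recs_getElem] at ha
    rcases List.mem_cons.1 ha with rfl | ha
    · have := Good.length_le ⟨hn.nodup v, hn.lt v⟩; omega
    · have := hn.lt v a ha; omega

theorem inp_encode (h : BCol.IsAdjList G adj) {E : Env} {k : ℕ}
    (hE : E.inp = fun i => (BCol.encode adj k).getD i 0) (hEL : E.L = (BCol.encode adj k).length)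
    (hL : E.L < E.N) (hN : 2 * n + 2 < E.N) : Inp E n (nbOf adj) (offs adj) where
  isNb := isNb_nbOf h
  deg v hv := by
    have := encode_getD (adj := adj) k hv (j := 0) (by omega)
    simpa [hE] using this
  ent v hv j hj := by
    have := encode_getD (adj := adj) k hv (j := j + 1) (by omega)
    rw [hE, Nat.add_assoc, Nat.add_comm 1 j]
    simpa [-List.getD_eq_getElem?_getD] using this
  lim v hv := by
    have h1 := offs_succ (adj := adj) v
    have h2 := offs_mono (adj := adj) (show v + 1 ≤ n from hv)
    rw [hEL, encode_length]
    omega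
  hL := hL
  hn := hN

end

end Mach

/-! ## The whole program -/

namespace Mach

open Grow

/-- Reads `n` and `k` and computes the positions of the records of the vertices. -/
def setup : Stm :=
  (.n ≔ .inp 0 ;; .k ≔ .inp 1 ;; .o ≔ .lit 2) ;;
  .fors .v .n (.put .off (Va.v : Ex) (Va.o : Ex) ;; .o ≔ (Va.o + (.inp (Va.o : Ex) + 1) : Ex))

/-- Decides b-coloring. -/
def program : Stm :=
  setup ;; .ite (Va.k : Ex) (search ;; .ite (Ex.less Va.q Va.k) .skip solve) .skip

/-- Places the arrays behind the input. -/
def prelude : RAM.Prog :=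
  .seq (.load 3 3) (.seq (.const 5 2) (.seq (.op .add 3 3 5) (.op .mul 1 3 3)))

variable {E : Env} {n k : ℕ} {nb : ℕ → List ℕ} {off : ℕ → ℕ} {σ : St}

theorem setup_tri (hE : Inp E n nb off) (h0 : E.inp 0 = n) (h1 : E.inp 1 = k) (h2 : 2 ≤ E.L)
    (o0 : off 0 = 2) (o1 : ∀ v, off (v + 1) = off v + ((nb v).length + 1)) :
    Tri E setup σ (40 * n + 30) (fun σ' => Base n off σ' ∧ σ'.reg .k = k) := by
  have hN := hE.hn
  have hL := hE.hL
  refine Tri.seq (T₁ := 20) (R := fun σ' => σ'.reg .n = n ∧ σ'.reg .k = k ∧ σ'.reg .o = 2)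
    (Tri.block (by simp [Stm.ok]; omega) (by decide) (by simp [Stm.den, h0, h1])) ?_
    (show 20 + (40 * n + 10) ≤ _ by omega)
  rintro σ₁ - ⟨a1, a2, a3⟩
  refine Tri.fors n a1 (by omega) (by decide) rfl rfl
    (fun v σ' => σ'.reg .o = off v ∧ ∀ u < v, σ'.arr .off u = off u) (fun _ => 30) ?_ ?_ ?_ ?_
  · simp [a3, o0]
  · rintro v σ₂ hv hv2 - - ⟨b1, b2⟩
    have hlim := hE.lim v hv
    have hdeg := hE.deg v hv
    refine Tri.block ?_ (by decide) ?_
    · simp [Stm.ok, Stm.den, b1, hdeg]; omega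
    · refine ⟨by simp [Stm.den, b1, hdeg, o1], fun u hu => ?_⟩
      simp only [Stm.den, Ex.eval_var, hv2, b1, St.setReg_arr, St.setArr_arr, if_true,
        Function.update_apply]
      split_ifs with huv
      · rw [huv]
      · exact b2 u (by omega)
  · rw [Finset.sum_const, Finset.card_range, smul_eq_mul]; omega
  · rintro σ' hf ⟨-, b2⟩
    exact ⟨⟨(hf.1 _ rfl).trans a1, b2⟩, (hf.1 _ rfl).trans a2⟩

/-! ### Time bounds in powers of D = 2^(p²) -/

theorem groupTime_le {q D : ℕ} (hD : 0 < D) (hq : q ≤ D) (h1 : 2 ^ (q * q) ≤ D)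
    (h2 : 2 ^ (q * q + q) ≤ D ^ 2) : groupTime q ≤ 490 * D ^ 3 := by
  unfold groupTime
  have e1 : q * (100 * q + 160) ≤ 260 * D ^ 2 := by nlinarith
  have e2 : 1 ≤ D ^ 2 := Nat.one_le_pow _ _ hD
  have e3 : D ^ 2 ≤ D ^ 3 := Nat.pow_le_pow_right hD (by norm_num)
  have e4 : 2 ^ (q * q) * (q * (100 * q + 160) + 40 * 2 ^ (q * q + q) + 60) ≤
      D * (360 * D ^ 2) := Nat.mul_le_mul h1 (by omega)
  have e5 : D * (360 * D ^ 2) = 360 * D ^ 3 := by ring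
  omega

theorem solveTime_le {q D n : ℕ} (hn : 0 < n) (hD : 0 < D) (hq : q ≤ D) (h1 : 2 ^ (q * q) ≤ D)
    (h2 : 2 ^ (q * q + q) ≤ D ^ 2) :
    2 ^ (q * q) * (sepTime q n + 10) + 40 ≤ 1110 * (D ^ 4 * n) := by
  have hg := groupTime_le hD hq h1 h2
  have e0 : 1 ≤ D ^ 3 * n := Nat.mul_pos (Nat.pow_pos hD) hn
  have e1 : q * (100 * n + 160) ≤ D * (260 * n) := Nat.mul_le_mul hq (by omega)
  have e2 : D ≤ D ^ 3 := Nat.le_self_pow (by norm_num) D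
  have e3 : D * (260 * n) ≤ 260 * (D ^ 3 * n) := by
    calc D * (260 * n) ≤ D ^ 3 * (260 * n) := Nat.mul_le_mul_right _ e2
      _ = _ := by ring
  have e4 : n * (groupTime q + 10) ≤ 500 * (D ^ 3 * n) := by
    calc n * (groupTime q + 10) ≤ n * (500 * D ^ 3) := Nat.mul_le_mul_left _ (by
          have : 1 ≤ D ^ 3 := Nat.one_le_pow _ _ hD
          omega)
      _ = _ := by ring
  have e5 : 2 ^ (q * q + q) * (60 * q + 110) ≤ 170 * (D ^ 3 * n) := by
    calc 2 ^ (q * q + q) * (60 * q + 110) ≤ D ^ 2 * (170 * D) := Nat.mul_le_mul h2 (by omega)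
      _ = 170 * D ^ 3 := by ring
      _ ≤ 170 * (D ^ 3 * n) := Nat.mul_le_mul_left _ (Nat.le_mul_of_pos_right _ hn)
  have e6 : sepTime q n + 10 ≤ 1070 * (D ^ 3 * n) := by
    unfold sepTime
    omega
  have e7 : 2 ^ (q * q) * (sepTime q n + 10) ≤ 1070 * (D ^ 4 * n) := by
    calc _ ≤ D * (1070 * (D ^ 3 * n)) := Nat.mul_le_mul h1 e6
      _ = _ := by ring
  have e8 : 1 ≤ D ^ 4 * n := Nat.mul_pos (Nat.pow_pos hD) hn
  omega

/-- A bound for the time spent on the search for a separator. -/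
def searchTime (p W : ℕ) : ℕ :=
  p * (2 ^ (p * p) * ((p + 1) * (400 * W + 200) + 50) + 50) + 20

theorem searchTime_le {p D n W : ℕ} (hn : 0 < n) (hpD : 2 ^ (p * p) = D) (hp : p + 1 ≤ D)
    (hW : W ≤ 2 * p * n) : searchTime p W ≤ 1120 * (D ^ 4 * n) := by
  have hD : 0 < D := by omega
  have e1 : W ≤ 2 * (D * n) := hW.trans (by rw [mul_assoc]; gcongr; omega)
  have f : ∀ j, 1 ≤ D ^ j * n := fun j => Nat.mul_pos (Nat.pow_pos hD) hn
  have f1 : 1 ≤ D * n := Nat.mul_pos hD hn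
  have f2 := f 2
  have f3 := f 3
  have f4 := f 4
  have e2 : (p + 1) * (400 * W + 200) ≤ 1000 * (D ^ 2 * n) := by
    calc _ ≤ D * (1000 * (D * n)) := Nat.mul_le_mul hp (by omega)
      _ = _ := by ring
  have e3 : D * ((p + 1) * (400 * W + 200) + 50) ≤ 1050 * (D ^ 3 * n) := by
    calc _ ≤ D * (1050 * (D ^ 2 * n)) := Nat.mul_le_mul_left _ (by omega)
      _ = _ := by ring
  have e4 : p * (D * ((p + 1) * (400 * W + 200) + 50) + 50) ≤ 1100 * (D ^ 4 * n) := by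
    have e5 : D * ((p + 1) * (400 * W + 200) + 50) + 50 ≤ 1100 * (D ^ 3 * n) :=
      (Nat.add_le_add e3 (Nat.mul_le_mul_left 50 f3)).trans_eq (by ring)
    have e6 : p ≤ D := by omega
    calc p * (D * ((p + 1) * (400 * W + 200) + 50) + 50) ≤ D * (1100 * (D ^ 3 * n)) :=
          Nat.mul_le_mul e6 e5
      _ = _ := by ring
  rw [searchTime, hpD]
  exact (Nat.add_le_add e4 (Nat.mul_le_mul_left 20 f4)).trans_eq (by ring)

theorem program_tri (hE : Inp E n nb off) (hn0 : 0 < n) (h0 : E.inp 0 = n) (h1 : E.inp 1 = k)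
    (h2 : 2 ≤ E.L) (o0 : off 0 = 2) (o1 : ∀ v, off (v + 1) = off v + ((nb v).length + 1))
    (hans : σ.reg .ans = 0) {p : ℕ} {T : Finset ℕ} (hT : Separator n p nb T)
    (hN : 2 ^ (p * p + p + p) < E.N) (hpN : p * n + n < E.N) :
    Tri E program σ (2400 * ((2 ^ (p * p)) ^ 4 * n)) (fun σ' => σ'.reg .ans ≤ 1 ∧
      (σ'.reg .ans = 1 ↔ PosColoring n k nb)) := by
  have hp0 : 0 < p := (Nat.zero_le _).trans_lt hT.card
  have hEn := hE.hn
  have hpp : p ≤ p * p := Nat.le_mul_self p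
  have hp1 : p + 1 ≤ 2 ^ (p * p) := by
    have : p * p < 2 ^ (p * p) := Nat.lt_two_pow_self
    omega
  have hN1 : 2 ^ (p * p) < E.N := two_pow_lt hN (by omega)
  obtain ⟨D, hD⟩ : ∃ D, 2 ^ (p * p) = D := ⟨_, rfl⟩
  rw [hD]
  have hst := searchTime_le hn0 hD (hD ▸ hp1) (wt_range_le hE.isNb hT)
  have hDn : n ≤ D ^ 4 * n := Nat.le_mul_of_pos_left _ (Nat.pow_pos (by omega))
  set Z := D ^ 4 * n with hZ
  refine Tri.seq (setup_tri hE h0 h1 h2 o0 o1) (T₂ := 2330 * Z) ?_ (by omega)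
  rintro σ₁ hf1 ⟨hb1, hk1⟩
  have hans1 : σ₁.reg .ans = 0 := (hf1.1 _ rfl).trans hans
  refine Tri.ite (T₁ := 2300 * Z) (by simp) ?_ ?_ (by simp only [Ex.cost]; omega)
  · intro hk
    have hk0 : 0 < k := by
      rw [Ex.eval_var, hk1] at hk; omega
    refine Tri.seq (T₁ := searchTime p (wt nb (List.range n)))
      (search_tri hE hb1 hT hN1 (by omega)) (T₂ := 1150 * Z) ?_ (by omega)
    rintro σ₂ hf2 ⟨q, hqp, hq0, R, hF⟩
    have hb2 : Base n off σ₂ := hb1.congr (hf2.1 _ rfl) (hf2.2 _ rfl)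
    have hk2 : σ₂.reg .k = k := (hf2.1 _ rfl).trans hk1
    have hans2 : σ₂.reg .ans = 0 := (hf2.1 _ rfl).trans hans1
    have hq2 := hF.qv
    have hlay := layout_of_ovf hE.isNb hF.good hF.ovf
    have hgood := hlay.good
    have hlen := hlay.len
    have hRn := hF.good.length_le
    refine Tri.ite (T₁ := 1130 * Z) (by simp) ?_ ?_ (by simp only [Ex.less, Ex.cost]; omega)
    · intro hlt
      have hqk : q < k := by
        by_contra hc
        simp [hq2, hk2, hc] at hlt
      refine Tri.block trivial (by simp only [Stm.cost]; omega) ?_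
      simp only [Stm.den, hans2, Nat.zero_le, zero_ne_one, false_iff, true_and]
      intro hcol
      rw [← posColoring_pnb hE.isNb hgood hlen] at hcol
      have hG := groups_of_layout hlay hE.isNb (k := 1) Nat.one_pos hq0 hF.le hRn
      have := hG.le_of_posColoring (pnb_nodup hE.isNb hgood hlen) (fun i hi hm =>
        hE.isNb.irrefl _ ((mem_pnb hE.isNb hgood hlen).1 hm).2) hcol
      omega
    · intro hlt
      have hkq : k ≤ q := by
        by_contra hc
        simp [hq2, hk2, Nat.lt_of_not_le hc] at hlt
      have hqq : q * q ≤ p * p := Nat.mul_le_mul hqp hqp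
      have hqq' : q ≤ q * q := Nat.le_mul_self q
      have hok : Pars.Ok ⟨n, k, q, R.length, nb, off, ordr nb n R n⟩ E :=
        { inp := hE, good := hgood, len := hlen, k0 := hk0, kq := hkq, sq := hF.le, sn := hRn
          qn := by
            have := Nat.mul_le_mul_right n hqp
            exact (show q * n + n ≤ p * n + n by omega).trans_lt hpN
          pow := two_pow_lt hN (show q * q + q + q ≤ _ by omega) }
      have hq1 : 2 ^ (q * q) ≤ D := hD ▸ Nat.pow_le_pow_right (by norm_num) hqq
      have hq3 : 2 ^ (q * q + q) ≤ D ^ 2 := by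
        rw [← hD, ← pow_mul]
        exact Nat.pow_le_pow_right (by norm_num) (by omega)
      have htime := solveTime_le hn0 (by omega) (by omega) hq1 hq3
      refine (solve_tri hok (groups_of_layout hlay hE.isNb hk0 hkq hF.le hRn) hb2 hF.listed.queue hk2 hq2
        hF.listed.s hF.M hF.listed.marks.g hF.listed.start).mono
        (htime.trans (show 1110 * Z ≤ _ by omega)) ?_
      rintro σ₃ - ⟨c1, c2⟩
      exact ⟨c1, c2.trans (posColoring_pnb hE.isNb hgood hlen)⟩
  · intro hk
    have hk0 : k = 0 := by rwa [Ex.eval_var, hk1] at hk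
    refine Tri.block trivial (by simp only [Stm.cost]; omega) ?_
    simp only [Stm.den, hans1, Nat.zero_le, zero_ne_one, false_iff, true_and]
    rintro ⟨χ, h, -⟩
    have := h 0
    omega

/-- Registers 3 and 5 are the first two temporaries, and register 1 holds the base of the arrays.
The cells behind the input are 0, so all arrays start out as zero. -/
theorem prelude_exec {w n : ℕ} {input : List ℕ} (h0 : input.getD 0 0 = n)
    (hw : (n + 2) * (n + 2) < 2 ^ w) (hl : input.length ≤ (n + 2) * (n + 2)) {E : Env}
    (hE : E.inp = fun i => input.getD i 0) :
    ∃ s, RAM.Exec w prelude (RAM.Store.start input) 4 s ∧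
      Rep E ((n + 2) * (n + 2)) ⟨fun _ => 0, fun _ _ => 0⟩ s := by
  have hle : n + 2 ≤ (n + 2) * (n + 2) := Nat.le_mul_self _
  have m0 : (RAM.Store.start input).mem 0 = n := h0
  have r0 : ∀ x, (RAM.Store.start input).reg x = 0 := fun _ => rfl
  refine ⟨_, .seq (.load _ _ _) (.seq (.const _ _ _ (by omega)) (.seq (.op _ _ _ _ _ ?_)
    (.op _ _ _ _ _ ?_))), ?_⟩
  · simp [RAM.Store.setReg, RAM.Op.eval, r0, m0]
    omega
  · simp [RAM.Store.setReg, RAM.Op.eval, r0, m0]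
    exact hw
  · refine ⟨fun x => ?_, ?_, fun i _ => by rw [hE]; rfl, fun a i => ?_⟩
    · have e1 := rg_ne_one x
      have e3 : x.rg ≠ 3 := rg_ne_tmp x 0
      have e5 : x.rg ≠ 5 := rg_ne_tmp x 1
      simp [RAM.Store.setReg, e1, e3, e5, r0]
    · simp [RAM.Store.setReg, RAM.Op.eval, r0, m0]
    · exact List.getD_eq_default _ _ (by omega)

end Mach

open Mach in
theorem proposition2p4 :
    ∃ (P : RAM.Prog) (C : ℕ), ∀ (n : ℕ), 0 < n → ∀ (G : SimpleGraph (Fin n)) (k : ℕ)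
      (adj : Fin n → List (Fin n)), BCol.IsAdjList G adj →
      P.Decides (C * (BCol.vertexIntegrity G ^ 2 + Nat.log 2 (n + k))) (BCol.encode adj k)
        (2 ^ (C * BCol.vertexIntegrity G ^ 2) * n) (BCol.HasBColoring G k) := by
  refine ⟨.seq prelude program.comp, 20, fun n hn G k adj hadj => ?_⟩
  obtain ⟨T, hT⟩ := exists_separator hadj hn
  set p := BCol.vertexIntegrity G with hp
  clear_value p
  have hp0 : 0 < p := (Nat.zero_le _).trans_lt hT.card
  obtain ⟨l, hl⟩ : ∃ l, Nat.log 2 (n + k) = l := ⟨_, rfl⟩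
  have hnk : n + k < 2 ^ (l + 1) := hl ▸ Nat.lt_pow_succ_log_self (by norm_num) _
  have hpp : p ≤ p * p := Nat.le_mul_self p
  rw [hl, pow_two]
  -- The required exponents are 2l + 5 for (n + 2)², p + l + 1 for pn + n, and p² + 2p for shifted
  -- masks. As p ≥ 1, all are at most 5(p² + l).
  obtain ⟨E, hEi, hEL, hElg⟩ : ∃ E : Env, E.inp = (fun i => (BCol.encode adj k).getD i 0) ∧
      E.L = (BCol.encode adj k).length ∧ E.lg = 5 * (p * p + l) := ⟨⟨_, _, _⟩, rfl, rfl, rfl⟩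
  have hN : E.N = 2 ^ (5 * (p * p + l)) := by rw [Env.N, hElg]
  have hmono : ∀ {a}, a ≤ 5 * (p * p + l) → 2 ^ a ≤ E.N := fun h =>
    hN ▸ Nat.pow_le_pow_right (by norm_num) h
  have hl2 : n + 2 ≤ 2 ^ (l + 2) := by
    rw [pow_succ] at hnk ⊢
    have : 1 ≤ 2 ^ l := Nat.one_le_two_pow
    rw [pow_succ]
    omega
  have hB : (n + 2) * (n + 2) < E.N := by
    calc (n + 2) * (n + 2) ≤ 2 ^ (l + 2) * 2 ^ (l + 2) := Nat.mul_le_mul hl2 hl2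
      _ = 2 ^ (l + 2 + (l + 2)) := (pow_add _ _ _).symm
      _ < 2 ^ (l + 2 + (l + 2) + 1) := Nat.pow_lt_pow_right (by norm_num) (Nat.lt_succ_self _)
      _ ≤ E.N := hmono (by omega)
  have hoff : E.L ≤ (n + 2) * (n + 2) := by
    rw [hEL, encode_length]
    exact offs_le hadj
  have h2n : 2 * n + 2 < E.N := by nlinarith
  have hnkN : n + k < E.N := hnk.trans_le (hmono (by omega))
  have hpn : p * n + n < E.N := by
    calc p * n + n = (p + 1) * n := by ring
      _ ≤ 2 ^ p * n := Nat.mul_le_mul_right _ Nat.lt_two_pow_self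
      _ < 2 ^ p * 2 ^ (l + 1) := Nat.mul_lt_mul_of_pos_left (by omega) (by positivity)
      _ = 2 ^ (p + (l + 1)) := (pow_add _ _ _).symm
      _ ≤ E.N := hmono (by omega)
  have hpow : 2 ^ (p * p + p + p) < E.N := by
    rw [hN]
    exact Nat.pow_lt_pow_right (by norm_num) (by omega)
  -- Addresses exceed values by the base and the stride 8; five more bits cover both, since the
  -- exponent is itself at least 5.
  have hw : (n + 2) * (n + 2) + 8 * E.N + 8 ≤ 2 ^ (20 * (p * p + l)) := by
    have h1 : 1 ≤ E.N := by omega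
    calc (n + 2) * (n + 2) + 8 * E.N + 8 ≤ E.N * 2 ^ 5 := by omega
      _ = 2 ^ (5 * (p * p + l) + 5) := by rw [hN, pow_add]
      _ ≤ _ := Nat.pow_le_pow_right (by norm_num) (by omega)
  have hroom : Room E ((n + 2) * (n + 2)) (20 * (p * p + l)) := ⟨hoff, hw⟩
  have hmem : ∀ a ∈ BCol.encode adj k, a < E.N := fun a ha =>
    (mem_encode_le hadj ha).trans_lt hnkN
  have hinp := inp_encode hadj hEi hEL (by omega) h2n
  have hlen : 2 ≤ E.L := by
    rw [hEL, encode_eq, List.length_cons, List.length_cons]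
    omega
  obtain ⟨s₁, x₁, r₁⟩ := prelude_exec (w := 20 * (p * p + l)) (n := n) (input := BCol.encode adj k)
    (by rw [encode_eq]; rfl) (hroom.lt hB) (hEL ▸ hoff) hEi
  obtain ⟨t, σ', hrun, ht, hans, hiff⟩ := program_tri
    (σ := ⟨fun _ => 0, fun _ _ => 0⟩) hinp hn (k := k) (by rw [hEi, encode_eq]; rfl)
    (by rw [hEi, encode_eq]; rfl) hlen (by simp [offs, wt]) offs_succ rfl hT hpow hpn
  have hbdd : Bdd E ⟨fun _ => 0, fun _ _ => 0⟩ := by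
    have hpos : 0 < E.N := by omega
    refine ⟨fun _ => hpos, fun _ _ => hpos, fun i => ?_, by rw [hElg]; omega⟩
    rw [hEi]
    by_cases hi : i < (BCol.encode adj k).length
    · simp only [List.getD_eq_getElem _ _ hi]
      exact hmem _ (List.getElem_mem _)
    · simp only [List.getD_eq_default _ _ (not_lt.1 hi)]
      omega
  obtain ⟨s₂, x₂, r₂⟩ := hrun.comp hroom hbdd r₁
  have hreg : s₂.reg 0 = σ'.reg .ans := r₂.reg .ans
  rw [posColoring_nbOf hadj hn] at hiff
  refine ⟨fun a ha => hroom.lt (hmem a ha), _, ?_, s₂, .seq x₁ x₂, fun hQ => ?_, fun hQ => ?_⟩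
  · obtain ⟨D, hD⟩ : ∃ D, 2 ^ (p * p) = D := ⟨_, rfl⟩
    have hD2 : 2 ≤ D := by
      calc 2 = 2 ^ 1 := rfl
        _ ≤ 2 ^ (p * p) := Nat.pow_le_pow_right (by norm_num) (by omega)
        _ = D := hD
    rw [hD] at ht
    have h16 : 2 ^ 16 ≤ D ^ 16 := Nat.pow_le_pow_left hD2 16
    have hpos : 0 < D ^ 4 * n := Nat.mul_pos (Nat.pow_pos (by omega)) hn
    -- The 4 steps of the prelude and the factor 2400 are below 2^16, which D^16 absorbs because D ≥
    -- 2. Together with D^4 this gives the constant 20 = 16 + 4.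
    calc 4 + t ≤ 2 ^ 16 * (D ^ 4 * n) := by omega
      _ ≤ D ^ 16 * (D ^ 4 * n) := Nat.mul_le_mul_right _ h16
      _ = (2 ^ (p * p)) ^ 20 * n := by rw [hD]; ring
      _ = 2 ^ (20 * (p * p)) * n := by rw [← pow_mul, Nat.mul_comm (p * p)]
  · rw [hreg]; exact hiff.2 hQ
  · rw [hreg]
    have := mt hiff.1 hQ
    omega
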